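/- **Setting.** Let $\mathcal A$ be an abelian category. A pair $(\mathcal X,\mathcal Y)$ of classes of objects is a cotorsion pair if $\mathcal Y=\{Y:\operatorname{Ext}^1_{\mathcal A}(X,Y)=0\ \forall X\in\mathcal X\}$ and $\mathcal X=\{X:\operatorname{Ext}^1_{\mathcal A}(X,Y)=0\ \forall Y\in\mathcal Y\}$. It is complete if for each object $A$ there are short exact sequences $0\to Y\to X\to A\to 0$ and $0\to A\to Y'\to X'\to 0$ with $X,X'\in\mathcal X$ and $Y,Y'\in\mathcal Y$. It is hereditary if $\operatorname{Ext}^i_{\mathcal A}(X,Y)=0$ for all $i\ge 1$, $X\in\mathcal X$, $Y\in\mathcal Y$. Let $\mathfrak M=(\mathcal Q,\mathcal W,\mathcal R)$ be a hereditary abelian model structure: $\mathcal W$ satisfies the 2-out-of-3 property on short exact sequences, and $(\mathcal Q,\mathcal W\cap\mathcal R)$ and $(\mathcal Q\cap\mathcal W,\mathcal R)$ are complete hereditary cotorsion pairs. A cofibrant replacement of $A$ is an epimorphism $QA\to A$ with $QA\in\mathcal Q$ and kernel in $\mathcal W\cap\mathcal R$. A fibrant replacement of $A$ is a monomorphism $A\to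 RA$ with $RA\in\mathcal R$ and cokernel in $\mathcal Q\cap\mathcal W$. Fix for every $A$ a cofibrant replacement $QA$ and a fibrant replacement $RQA$ of $QA$. For $f:A\to B$ there are $Q(f):QA\to QB$ covering $f$ and $R(Q(f)):RQA\to RQB$ extending $Q(f)$. Two morphisms are homotopic if their difference factors through an object of $\mathcal Q\cap\mathcal W\cap\mathcal R$. The category $\mathrm{Ho}(\mathfrak M)$ has the objects of $\mathcal A$; its morphisms $A\to B$ are the homotopy classes of morphisms $RQA\to RQB$. The functor $\gamma:\mathcal A\to\mathrm{Ho}(\mathfrak M)$ is the identity on objects and sends $f$ to $[R(Q(f))]$. An $\mathfrak M$-resolution of $A$ is an exact chain complex $W_A$ obtained by splicing, via $d_0=\eta\epsilon$, an exact sequence $\cdots\to W_1\to W_0\xrightarrow{\epsilon}A\to 0$, whose terms $W_n$ lie in $\mathcal Q\cap\mathcal W$ and whose kernels $\ker\epsilon$, $\ker d_n$ ($n\geq 1$) lie in $\mathcal R$, with an exact sequence $0\to A\xrightarrow{\eta}W_{-1}\to W_{-2}\to\cdots$, whose terms lie in $\mathcal W\cap\mathcal R$ and whose cokernels $\operatorname{cok}\eta$,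 $\operatorname{cok}d_n$ ($n\le -1$) lie in $\mathcal Q$. An $\mathfrak M$-coresolution $W^A$ is the same kind of exact complex written as a cochain complex $\cdots\to W^{-1}\to W^0\to\cdots$, with $A=\operatorname{im}(W^{-1}\to W^0)$, $W^n\in\mathcal Q\cap\mathcal W$ for $n\le -1$ and $W^n\in\mathcal W\cap\mathcal R$ for $n\ge 0$. A canonical resolution of $A$ is an $\mathfrak M$-resolution of a cofibrant replacement of $A$. A canonical coresolution of $A$ is an $\mathfrak M$-coresolution of a fibrant replacement of $A$. For $A$ cofibrant and $B$ fibrant, $\operatorname{Ext}^n_{\mathfrak M}(A,B)$ denotes, for $n\in\mathbb Z$, the group $H^n[\operatorname{Hom}_{\mathcal A}(W_A,B)]\cong H^n[\operatorname{Hom}_{\mathcal A}(A,W^B)]$. Put $$\operatorname{Ext}^n_{\mathrm{Ho}(\mathfrak M)}(A,B):=\operatorname{Ext}^n_{\mathfrak M}(RQA,RQB).$$ **Theorem.** $\mathfrak M$-resolutions and $\mathfrak M$-coresolutions of every object exist, and for every $n\in\mathbb Z$ the groups $\operatorname{Ext}^n_{\mathrm{Ho}(\mathfrak M)}(A,B)$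 form a bifunctor $\mathcal A^{op}\times\mathcal A\to\mathbf{Ab}$. Its action on morphisms $f:A'\to A$, $g:B\to B'$ is induced by any choice of $R(Q(f))$ and $R(Q(g))$ together with any (co)chain map between the $\mathfrak M$-(co)resolutions extending the relevant one of them; such choices exist and the result does not depend on them. Moreover: 1. For each $A$ and $n$, $\operatorname{Ext}^n_{\mathrm{Ho}(\mathfrak M)}(A,-)$ is a covariant additive functor. For every short exact sequence $0\to X\to Y\to Z\to0$ in $\mathcal A$ and every $A$ there is a long exact sequence $$\cdots\to\operatorname{Ext}^n_{\mathrm{Ho}(\mathfrak M)}(A,X)\to\operatorname{Ext}^n_{\mathrm{Ho}(\mathfrak M)}(A,Y)\to\operatorname{Ext}^n_{\mathrm{Ho}(\mathfrak M)}(A,Z)\to\operatorname{Ext}^{n+1}_{\mathrm{Ho}(\mathfrak M)}(A,X)\to\cdots\quad(n\in\mathbb Z).$$ The functor $\operatorname{Ext}^n_{\mathrm{Ho}(\mathfrak M)}(A,-)$ factors uniquely through $\gamma$. 2. For each $B$ and $n$, $\operatorname{Ext}^n_{\mathrm{Ho}(\mathfrak M)}(-,B)$ is a contravariant additive functor. For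 every short exact sequence $0\to X\to Y\to Z\to0$ and every $B$ there is a long exact sequence $$\cdots\to\operatorname{Ext}^n_{\mathrm{Ho}(\mathfrak M)}(Z,B)\to\operatorname{Ext}^n_{\mathrm{Ho}(\mathfrak M)}(Y,B)\to\operatorname{Ext}^n_{\mathrm{Ho}(\mathfrak M)}(X,B)\to\operatorname{Ext}^{n+1}_{\mathrm{Ho}(\mathfrak M)}(Z,B)\to\cdots\quad(n\in\mathbb Z).$$ The functor $\operatorname{Ext}^n_{\mathrm{Ho}(\mathfrak M)}(-,B)$ factors uniquely through $\gamma$. 3. There are isomorphisms, natural in $A$ and $B$, $\operatorname{Ext}^n_{\mathrm{Ho}(\mathfrak M)}(A,B)\cong\operatorname{Ext}^n_{\mathfrak M}(QA,RB)$, for arbitrary cofibrant replacements $QA$ and fibrant replacements $RB$. That is, $\operatorname{Ext}^n_{\mathrm{Ho}(\mathfrak M)}(A,B)$ is naturally isomorphic to $H^n[\operatorname{Hom}_{\mathcal A}(W_{QA},RB)]$ for any canonical resolution $W_{QA}$ of $A$, and to $H^n[\operatorname{Hom}_{\mathcal A}(QA,W^{RB})]$ for any canonical coresolution $W^{RB}$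 of $B$, where morphisms act on these groups through any lifts to the replacements and the (co)resolutions. -/

import Mathlib

open CategoryTheory CategoryTheory.Limits Opposite

universe v u

noncomputable section

namespace HoExt

variable {C : Type u} [Category.{v} C] [Abelian C]

/-! ### Cotorsion pairs and abelian model structures -/

/-- `Extⁱ(X, Y) = 0` for the Yoneda `Ext` of the abelian category `C`. No smallness of `Ext` is
needed, since `Ext` always lives in the universe `max u v`. -/
def ExtVanishes (X Y : C) (i : ℕ) : Prop :=
  letI := HasExt.standard.{v} C
  Subsingleton (Abelian.Ext.{max u v} X Y i)

/-- The pair `(X, Y)` of classes of objects satisfies `Y = X^⊥` and `X = ^⊥Y` with respect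
to `Ext¹`. -/
structure IsCotorsionPair (X Y : ObjectProperty C) : Prop where
  mem_right_iff : ∀ B : C, Y B ↔ ∀ A : C, X A → ExtVanishes A B 1
  mem_left_iff : ∀ A : C, X A ↔ ∀ B : C, Y B → ExtVanishes A B 1

/-- A complete cotorsion pair: one with enough projectives and enough injectives. -/
structure IsCompleteCotorsionPair (X Y : ObjectProperty C) : Prop extends
    IsCotorsionPair X Y where
  enough_projectives : ∀ A : C, ∃ (E : C) (p : E ⟶ A), Epi p ∧ X E ∧ Y (kernel p)
  enough_injectives : ∀ A : C, ∃ (E : C) (i : A ⟶ E), Mono i ∧ Y E ∧ X (cokernel i)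

/-- The `Extⁱ` of the pair vanish for all `i ≥ 1`. -/
def IsHereditaryPair (X Y : ObjectProperty C) : Prop :=
  ∀ A B : C, X A → Y B → ∀ i : ℕ, 1 ≤ i → ExtVanishes A B i

/-! ### Lifting properties -/

lemma ExtVanishes.exists_lift {X E B : C} (p : E ⟶ B) [Epi p] (h : ExtVanishes X (kernel p) 1)
    (g : X ⟶ B) : ∃ l : X ⟶ E, l ≫ p = g := by
  let := HasExt.standard.{v} C
  have h' : Subsingleton (Abelian.Ext.{max u v} X (kernel p) 1) := h
  have hS : (ShortComplex.mk (kernel.ι p) p (kernel.condition p)).ShortExact :=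
    { exact := ShortComplex.exact_kernel p }
  obtain ⟨x, hx⟩ := Abelian.Ext.covariant_sequence_exact₃ X hS (Abelian.Ext.mk₀ g)
    (zero_add 1) (Subsingleton.elim _ _)
  obtain ⟨l, rfl⟩ := (Abelian.Ext.mk₀_bijective _ _).2 x
  refine ⟨l, (Abelian.Ext.mk₀_bijective _ _).1 ?_⟩
  simpa using hx

lemma ExtVanishes.exists_extension {A E Y : C} (i : A ⟶ E) [Mono i]
    (h : ExtVanishes (cokernel i) Y 1) (g : A ⟶ Y) : ∃ l : E ⟶ Y, i ≫ l = g := by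
  let := HasExt.standard.{v} C
  have h' : Subsingleton (Abelian.Ext.{max u v} (cokernel i) Y 1) := h
  have hS : (ShortComplex.mk i (cokernel.π i) (cokernel.condition i)).ShortExact :=
    { exact := ShortComplex.exact_cokernel i }
  obtain ⟨x, hx⟩ := Abelian.Ext.contravariant_sequence_exact₁ hS Y (Abelian.Ext.mk₀ g)
    (add_zero 1) (Subsingleton.elim _ _)
  obtain ⟨l, rfl⟩ := (Abelian.Ext.mk₀_bijective _ _).2 x
  refine ⟨l, (Abelian.Ext.mk₀_bijective _ _).1 ?_⟩
  simpa using hx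

lemma ExtVanishes.biprod_left {X Y B : C} {i : ℕ} (hX : ExtVanishes X B i)
    (hY : ExtVanishes Y B i) : ExtVanishes (X ⊞ Y) B i := by
  let := HasExt.standard.{v} C
  have hX' : Subsingleton (Abelian.Ext.{max u v} X B i) := hX
  have hY' : Subsingleton (Abelian.Ext.{max u v} Y B i) := hY
  refine subsingleton_of_forall_eq (0 : Abelian.Ext.{max u v} (X ⊞ Y) B i) fun e ↦ ?_
  rw [← Abelian.Ext.mk₀_id_comp e, ← biprod.total, Abelian.Ext.mk₀_add, Abelian.Ext.add_comp,
    ← Abelian.Ext.mk₀_comp_mk₀, ← Abelian.Ext.mk₀_comp_mk₀,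
    Abelian.Ext.comp_assoc_of_second_deg_zero, Abelian.Ext.comp_assoc_of_second_deg_zero,
    Subsingleton.elim ((Abelian.Ext.mk₀ (biprod.inl : X ⟶ X ⊞ Y)).comp e (zero_add i)) 0,
    Subsingleton.elim ((Abelian.Ext.mk₀ (biprod.inr : Y ⟶ X ⊞ Y)).comp e (zero_add i)) 0]
  simp

lemma ExtVanishes.biprod_right {A X Y : C} {i : ℕ} (hX : ExtVanishes A X i)
    (hY : ExtVanishes A Y i) : ExtVanishes A (X ⊞ Y) i := by
  let := HasExt.standard.{v} C
  have hX' : Subsingleton (Abelian.Ext.{max u v} A X i) := hX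
  have hY' : Subsingleton (Abelian.Ext.{max u v} A Y i) := hY
  refine subsingleton_of_forall_eq (0 : Abelian.Ext.{max u v} A (X ⊞ Y) i) fun e ↦ ?_
  rw [← Abelian.Ext.comp_mk₀_id e, ← biprod.total, Abelian.Ext.mk₀_add, Abelian.Ext.comp_add,
    ← Abelian.Ext.mk₀_comp_mk₀, ← Abelian.Ext.mk₀_comp_mk₀,
    ← Abelian.Ext.comp_assoc_of_second_deg_zero, ← Abelian.Ext.comp_assoc_of_second_deg_zero,
    Subsingleton.elim (e.comp (Abelian.Ext.mk₀ (biprod.fst : X ⊞ Y ⟶ X)) (add_zero i)) 0,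
    Subsingleton.elim (e.comp (Abelian.Ext.mk₀ (biprod.snd : X ⊞ Y ⟶ Y)) (add_zero i)) 0]
  simp

lemma ExtVanishes.extension_left {S : ShortComplex C} (hS : S.ShortExact) {B : C} {i : ℕ}
    (h₁ : ExtVanishes S.X₁ B i) (h₃ : ExtVanishes S.X₃ B i) : ExtVanishes S.X₂ B i := by
  let := HasExt.standard.{v} C
  have h₁' : Subsingleton (Abelian.Ext.{max u v} S.X₁ B i) := h₁
  have h₃' : Subsingleton (Abelian.Ext.{max u v} S.X₃ B i) := h₃
  refine subsingleton_of_forall_eq (0 : Abelian.Ext.{max u v} S.X₂ B i) fun e ↦ ?_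
  obtain ⟨x, rfl⟩ := Abelian.Ext.contravariant_sequence_exact₂ hS B e (Subsingleton.elim _ _)
  simp [Subsingleton.elim x 0]

lemma ExtVanishes.extension_right {S : ShortComplex C} (hS : S.ShortExact) {A : C} {i : ℕ}
    (h₁ : ExtVanishes A S.X₁ i) (h₃ : ExtVanishes A S.X₃ i) : ExtVanishes A S.X₂ i := by
  let := HasExt.standard.{v} C
  have h₁' : Subsingleton (Abelian.Ext.{max u v} A S.X₁ i) := h₁
  have h₃' : Subsingleton (Abelian.Ext.{max u v} A S.X₃ i) := h₃
  refine subsingleton_of_forall_eq (0 : Abelian.Ext.{max u v} A S.X₂ i) fun e ↦ ?_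
  obtain ⟨x, rfl⟩ := Abelian.Ext.covariant_sequence_exact₂ A hS e (Subsingleton.elim _ _)
  simp [Subsingleton.elim x 0]

lemma shortExact_of_epi {E A : C} (p : E ⟶ A) [Epi p] :
    (ShortComplex.mk (kernel.ι p) p (kernel.condition p)).ShortExact :=
  { exact := ShortComplex.exact_kernel p }

lemma shortExact_of_mono {A E : C} (i : A ⟶ E) [Mono i] :
    (ShortComplex.mk i (cokernel.π i) (cokernel.condition i)).ShortExact :=
  { exact := ShortComplex.exact_cokernel i }

variable (C) in
/-- An abelian model structure `(Q, W, R)` on `C`, given by its classes of cofibrant, trivial and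
fibrant objects. -/
structure AbelianModelStructure where
  cofibrant : ObjectProperty C
  trivial : ObjectProperty C
  fibrant : ObjectProperty C
  trivial_X₁ : ∀ S : ShortComplex C, S.ShortExact → trivial S.X₂ → trivial S.X₃ → trivial S.X₁
  trivial_X₂ : ∀ S : ShortComplex C, S.ShortExact → trivial S.X₁ → trivial S.X₃ → trivial S.X₂
  trivial_X₃ : ∀ S : ShortComplex C, S.ShortExact → trivial S.X₁ → trivial S.X₂ → trivial S.X₃
  left_pair : IsCompleteCotorsionPair cofibrant (trivial ⊓ fibrant)
  right_pair : IsCompleteCotorsionPair (cofibrant ⊓ trivial) fibrant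

namespace AbelianModelStructure

variable (M : AbelianModelStructure C)

/-- The class of trivially cofibrant objects. -/
def trivCofibrant : ObjectProperty C := M.cofibrant ⊓ M.trivial

/-- The class of trivially fibrant objects. -/
def trivFibrant : ObjectProperty C := M.trivial ⊓ M.fibrant

/-- The core `ω` of the model structure. -/
def core : ObjectProperty C := M.cofibrant ⊓ M.trivial ⊓ M.fibrant

/-- Both cotorsion pairs of the model structure are hereditary. -/
def IsHereditary : Prop :=
  IsHereditaryPair M.cofibrant M.trivFibrant ∧ IsHereditaryPair M.trivCofibrant M.fibrant

/-! ### Cofibrant, fibrant and bifibrant replacements -/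

/-- A cofibrant replacement `QA` of `A`: a short exact sequence `0 ⟶ K ⟶ QA ⟶ A ⟶ 0` with `QA`
cofibrant and `K` trivially fibrant. -/
structure CofibrantReplacement (A : C) where
  obj : C
  π : obj ⟶ A
  epi_π : Epi π
  cofibrant_obj : M.cofibrant obj
  trivFibrant_kernel : M.trivFibrant (kernel π)

/-- A fibrant replacement `RA` of `A`: a short exact sequence `0 ⟶ A ⟶ RA ⟶ K ⟶ 0` with `RA`
fibrant and `K` trivially cofibrant. -/
structure FibrantReplacement (A : C) where
  obj : C
  ι : A ⟶ obj
  mono_ι : Mono ι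
  fibrant_obj : M.fibrant obj
  trivCofibrant_cokernel : M.trivCofibrant (cokernel ι)

/-- A bifibrant replacement `RQA` of `A`: a fibrant replacement of a cofibrant replacement. -/
structure BifibrantReplacement (A : C) where
  cof : M.CofibrantReplacement A
  fib : M.FibrantReplacement cof.obj

variable {M}

/-- The object `RQA`. -/
abbrev BifibrantReplacement.obj {A : C} (P : M.BifibrantReplacement A) : C := P.fib.obj

/-- `q : QA ⟶ QB` covers `f : A ⟶ B`. -/
def CofibrantReplacement.IsLift {A B : C} (P : M.CofibrantReplacement A)
    (P' : M.CofibrantReplacement B) (f : A ⟶ B) (q : P.obj ⟶ P'.obj) : Prop :=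
  q ≫ P'.π = P.π ≫ f

/-- `r : RA ⟶ RB` extends `f : A ⟶ B`. -/
def FibrantReplacement.IsLift {A B : C} (T : M.FibrantReplacement A)
    (T' : M.FibrantReplacement B) (f : A ⟶ B) (r : T.obj ⟶ T'.obj) : Prop :=
  T.ι ≫ r = f ≫ T'.ι

/-- `h : RQA ⟶ RQB` is of the form `R(Q(f))`: it extends some `q : QA ⟶ QB` which
covers `f`. -/
def BifibrantReplacement.IsLift {A B : C} (P : M.BifibrantReplacement A)
    (P' : M.BifibrantReplacement B) (f : A ⟶ B) (h : P.obj ⟶ P'.obj) : Prop :=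
  ∃ q : P.cof.obj ⟶ P'.cof.obj, P.cof.IsLift P'.cof f q ∧ P.fib.IsLift P'.fib q h

variable (M)

/-! ### The stable category -/

/-- Two parallel morphisms are homotopic if their difference factors through an object of the
core. -/
def homotopic : HomRel C := fun A B f g ↦
  ∃ (W : C) (α : A ⟶ W) (β : W ⟶ B), M.core W ∧ α ≫ β = g - f

lemma core_biprod {X Y : C} (hX : M.core X) (hY : M.core Y) : M.core (X ⊞ Y) := by
  refine ⟨⟨?_, ?_⟩, ?_⟩
  · rw [M.left_pair.mem_left_iff]
    exact fun B hB ↦ ((M.left_pair.mem_left_iff X).1 hX.1.1 B hB).biprod_left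
      ((M.left_pair.mem_left_iff Y).1 hY.1.1 B hB)
  · exact M.trivial_X₂ (ShortComplex.mk (biprod.inl : X ⟶ X ⊞ Y) biprod.snd (by simp))
      (ShortComplex.Splitting.ofHasBinaryBiproduct X Y).shortExact hX.1.2 hY.1.2
  · rw [M.right_pair.mem_right_iff]
    exact fun A hA ↦ ((M.right_pair.mem_right_iff X).1 hX.2 A hA).biprod_right
      ((M.right_pair.mem_right_iff Y).1 hY.2 A hA)

open ZeroObject in
lemma exists_core : ∃ W : C, M.core W := by
  obtain ⟨E, p, _, hE, hK⟩ := M.left_pair.enough_projectives (0 : C)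
  have : IsIso (kernel.ι p) := by
    have : p = 0 := (isZero_zero C).eq_of_tgt _ _
    subst this
    infer_instance
  have hE₀ : M.trivFibrant E := by
    rw [AbelianModelStructure.trivFibrant, M.left_pair.mem_right_iff]
    refine fun A hA ↦ ExtVanishes.extension_right (shortExact_of_epi p)
      ((M.left_pair.mem_right_iff _).1 hK A hA) ?_
    let := HasExt.standard.{v} C
    refine subsingleton_of_forall_eq (0 : Abelian.Ext.{max u v} A (0 : C) 1) fun e ↦ ?_
    rw [← Abelian.Ext.comp_mk₀_id e, (isZero_zero C).eq_of_src (𝟙 (0 : C)) 0]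
    simp
  exact ⟨E, ⟨hE, hE₀.1⟩, hE₀.2⟩

instance : Congruence M.homotopic where
  equivalence {X Y} :=
    { refl := fun f ↦ by
        obtain ⟨W, hW⟩ := M.exists_core
        exact ⟨W, 0, 0, hW, by simp⟩
      symm := by
        rintro f g ⟨W, α, β, hW, h⟩
        exact ⟨W, α, -β, hW, by simp [h]⟩
      trans := by
        rintro f g k ⟨W, α, β, hW, h⟩ ⟨W', α', β', hW', h'⟩
        exact ⟨W ⊞ W', biprod.lift α α', biprod.desc β β', M.core_biprod hW hW',
          by simp [h, h']⟩ }
  comp_left := by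
    rintro X Y Z f g g' ⟨W, α, β, hW, h⟩
    exact ⟨W, f ≫ α, β, hW, by simp [h]⟩
  comp_right := by
    rintro X Y Z f f' g ⟨W, α, β, hW, h⟩
    exact ⟨W, α, β ≫ g, hW, by rw [reassoc_of% h, Preadditive.sub_comp]⟩

/-- The stable category of the model structure: the objects of `C`, with morphisms the homotopy
classes of morphisms of `C`. -/
abbrev Stable : Type u := Quotient M.homotopic

/-! ### The homotopy category -/

lemma factors_of_trivFibrant {X K : C} (hX : M.cofibrant X) (hK : M.trivFibrant K) (k : X ⟶ K) :
    ∃ (W : C) (α : X ⟶ W) (β : W ⟶ K), M.core W ∧ α ≫ β = k := by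
  obtain ⟨E, p, _, hE, hp⟩ := M.left_pair.enough_projectives K
  have hE' : M.trivFibrant E := (M.left_pair.mem_right_iff E).2 fun A hA ↦
    ExtVanishes.extension_right (shortExact_of_epi p)
      ((M.left_pair.mem_right_iff _).1 hp A hA) ((M.left_pair.mem_right_iff _).1 hK A hA)
  obtain ⟨l, hl⟩ := ExtVanishes.exists_lift p ((M.left_pair.mem_right_iff _).1 hp X hX) k
  exact ⟨E, l, p, ⟨⟨hE, hE'.1⟩, hE'.2⟩, hl⟩

lemma factors_of_trivCofibrant {K Y : C} (hK : M.trivCofibrant K) (hY : M.fibrant Y) (k : K ⟶ Y) :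
    ∃ (W : C) (α : K ⟶ W) (β : W ⟶ Y), M.core W ∧ α ≫ β = k := by
  obtain ⟨E, i, _, hE, hi⟩ := M.right_pair.enough_injectives K
  have hE' : M.trivCofibrant E := (M.right_pair.mem_left_iff E).2 fun A hA ↦
    ExtVanishes.extension_left (shortExact_of_mono i)
      ((M.right_pair.mem_left_iff _).1 hK A hA) ((M.right_pair.mem_left_iff _).1 hi A hA)
  obtain ⟨l, hl⟩ := ExtVanishes.exists_extension i ((M.right_pair.mem_left_iff _).1 hi Y hY) k
  exact ⟨E, i, l, ⟨⟨hE'.1, hE'.2⟩, hE⟩, hl⟩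

variable {M}

namespace BifibrantReplacement

lemma exists_isLift {A B : C} (P : M.BifibrantReplacement A) (P' : M.BifibrantReplacement B)
    (f : A ⟶ B) : ∃ h, P.IsLift P' f h := by
  have := P'.cof.epi_π
  have := P.fib.mono_ι
  obtain ⟨q, hq⟩ := ExtVanishes.exists_lift P'.cof.π
    ((M.left_pair.mem_right_iff _).1 P'.cof.trivFibrant_kernel _ P.cof.cofibrant_obj)
    (P.cof.π ≫ f)
  obtain ⟨h, hh⟩ := ExtVanishes.exists_extension P.fib.ι
    ((M.right_pair.mem_left_iff _).1 P.fib.trivCofibrant_cokernel _ P'.fib.fibrant_obj)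
    (q ≫ P'.fib.ι)
  exact ⟨h, q, hq, hh⟩

lemma IsLift.homotopic {A B : C} {P : M.BifibrantReplacement A} {P' : M.BifibrantReplacement B}
    {f : A ⟶ B} {h h' : P.obj ⟶ P'.obj} (H : P.IsLift P' f h) (H' : P.IsLift P' f h') :
    M.homotopic h h' := by
  obtain ⟨q, hq, hh⟩ := H
  obtain ⟨q', hq', hh'⟩ := H'
  have := P.fib.mono_ι
  dsimp only [CofibrantReplacement.IsLift, FibrantReplacement.IsLift] at hq hh hq' hh'
  obtain ⟨W, α, β, hW, e⟩ := M.factors_of_trivFibrant P.cof.cofibrant_obj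
    P'.cof.trivFibrant_kernel (kernel.lift P'.cof.π (q' - q) (by simp [hq, hq']))
  obtain ⟨l, hl⟩ := ExtVanishes.exists_extension P.fib.ι
    ((M.right_pair.mem_left_iff _).1 P.fib.trivCofibrant_cokernel _ hW.2) α
  let β' : W ⟶ P'.obj := β ≫ kernel.ι _ ≫ P'.fib.ι
  have hz : P.fib.ι ≫ (h' - h - l ≫ β') = 0 := by
    simp [β', hh, hh', reassoc_of% hl, reassoc_of% e]
  obtain ⟨W', α', β'', hW', e'⟩ := M.factors_of_trivCofibrant P.fib.trivCofibrant_cokernel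
    P'.fib.fibrant_obj (cokernel.desc _ _ hz)
  refine ⟨W ⊞ W', biprod.lift l (cokernel.π _ ≫ α'), biprod.desc β' β'', M.core_biprod hW hW', ?_⟩
  simp [e']

end BifibrantReplacement

section Ho

variable (ρ : ∀ A : C, M.BifibrantReplacement A)

/-- The homotopy category (for a choice of bifibrant replacements): its objects are those
of `C`, and the morphisms from `A` to `B` are the homotopy classes of morphisms `RQA ⟶ RQB`. -/
abbrev Ho : Type u := InducedCategory M.Stable (fun A : C ↦ (⟨(ρ A).obj⟩ : M.Stable))

/-- The canonical functor `γ`: the identity on objects, and `f ↦ [R(Q(f))]` on morphisms. -/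
def toHo : C ⥤ Ho ρ where
  obj A := A
  map {A B} f := InducedCategory.homMk
    ((Quotient.functor M.homotopic).map ((ρ A).exists_isLift (ρ B) f).choose)
  map_id A := by
    ext
    refine (Quotient.functor_map_eq_iff M.homotopic _ (𝟙 (ρ A).obj)).2 ?_
    exact ((ρ A).exists_isLift (ρ A) (𝟙 A)).choose_spec.homotopic
      ⟨𝟙 _, by simp [CofibrantReplacement.IsLift], by simp [FibrantReplacement.IsLift]⟩
  map_comp {A B D} f g := by
    ext
    obtain ⟨q, hq, hh⟩ := ((ρ A).exists_isLift (ρ B) f).choose_spec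
    obtain ⟨q', hq', hh'⟩ := ((ρ B).exists_isLift (ρ D) g).choose_spec
    refine (Quotient.functor_map_eq_iff M.homotopic _
      (((ρ A).exists_isLift (ρ B) f).choose ≫ ((ρ B).exists_isLift (ρ D) g).choose)).2 ?_
    dsimp only [CofibrantReplacement.IsLift, FibrantReplacement.IsLift] at hq hh hq' hh'
    refine ((ρ A).exists_isLift (ρ D) (f ≫ g)).choose_spec.homotopic ⟨q ≫ q', ?_, ?_⟩
    · simp only [CofibrantReplacement.IsLift, Category.assoc, hq', reassoc_of% hq]
    · simp only [FibrantReplacement.IsLift, Category.assoc, ← hh', reassoc_of% hh]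

lemma toHo_map_hom {A B : C} (f : A ⟶ B) (h : (ρ A).obj ⟶ (ρ B).obj)
    (H : (ρ A).IsLift (ρ B) f h) :
    ((toHo ρ).map f).hom = (Quotient.functor M.homotopic).map h :=
  (Quotient.functor_map_eq_iff M.homotopic _ _).2
    (((ρ A).exists_isLift (ρ B) f).choose_spec.homotopic H)

end Ho

/-! ### `M`-resolutions and `M`-coresolutions -/

variable (M)

/-- An `M`-resolution of `A`: an exact chain complex `W` obtained by splicing a resolution
`⋯ ⟶ W₁ ⟶ W₀ ⟶ A ⟶ 0` with trivially cofibrant terms and fibrant kernels, and a coresolution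
`0 ⟶ A ⟶ W₋₁ ⟶ W₋₂ ⟶ ⋯` with trivially fibrant terms and cofibrant cokernels. -/
structure Resolution (A : C) where
  complex : ChainComplex C ℤ
  ε : complex.X 0 ⟶ A
  η : A ⟶ complex.X (-1)
  ε_η : ε ≫ η = complex.d 0 (-1)
  epi_ε : Epi ε
  mono_η : Mono η
  acyclic : complex.Acyclic
  trivCofibrant_X : ∀ n : ℤ, 0 ≤ n → M.trivCofibrant (complex.X n)
  fibrant_kernel_ε : M.fibrant (kernel ε)
  fibrant_kernel_d : ∀ n : ℤ, 1 ≤ n → M.fibrant (kernel (complex.d n (n - 1)))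
  trivFibrant_X : ∀ n : ℤ, n ≤ -1 → M.trivFibrant (complex.X n)
  cofibrant_cokernel_η : M.cofibrant (cokernel η)
  cofibrant_cokernel_d : ∀ n : ℤ, n ≤ -1 → M.cofibrant (cokernel (complex.d n (n - 1)))

/-- An `M`-coresolution of `A`: an exact cochain complex `W` obtained by splicing a resolution
`⋯ ⟶ W⁻² ⟶ W⁻¹ ⟶ A ⟶ 0` with trivially cofibrant terms and fibrant kernels, and a coresolution
`0 ⟶ A ⟶ W⁰ ⟶ W¹ ⟶ ⋯` with trivially fibrant terms and cofibrant cokernels. -/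
structure Coresolution (A : C) where
  complex : CochainComplex C ℤ
  ε : complex.X (-1) ⟶ A
  η : A ⟶ complex.X 0
  ε_η : ε ≫ η = complex.d (-1) 0
  epi_ε : Epi ε
  mono_η : Mono η
  acyclic : complex.Acyclic
  trivCofibrant_X : ∀ n : ℤ, n ≤ -1 → M.trivCofibrant (complex.X n)
  fibrant_kernel_ε : M.fibrant (kernel ε)
  fibrant_kernel_d : ∀ n : ℤ, n ≤ -2 → M.fibrant (kernel (complex.d n (n + 1)))
  trivFibrant_X : ∀ n : ℤ, 0 ≤ n → M.trivFibrant (complex.X n)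
  cofibrant_cokernel_η : M.cofibrant (cokernel η)
  cofibrant_cokernel_d : ∀ n : ℤ, 0 ≤ n → M.cofibrant (cokernel (complex.d n (n + 1)))

/-- A canonical resolution of `A`: an `M`-resolution of a cofibrant replacement of `A`. -/
structure CanonicalResolution (A : C) where
  cof : M.CofibrantReplacement A
  res : M.Resolution cof.obj

/-- A canonical coresolution of `A`: an `M`-coresolution of a fibrant replacement of `A`. -/
structure CanonicalCoresolution (A : C) where
  fib : M.FibrantReplacement A
  cores : M.Coresolution fib.obj

variable {M}

/-- The chain map `φ` extends `f : A ⟶ B`. -/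
def Resolution.IsLift {A B : C} (W : M.Resolution A) (W' : M.Resolution B) (f : A ⟶ B)
    (φ : W.complex ⟶ W'.complex) : Prop :=
  φ.f 0 ≫ W'.ε = W.ε ≫ f ∧ W.η ≫ φ.f (-1) = f ≫ W'.η

/-- The cochain map `φ` extends `f : A ⟶ B`. -/
def Coresolution.IsLift {A B : C} (W : M.Coresolution A) (W' : M.Coresolution B) (f : A ⟶ B)
    (φ : W.complex ⟶ W'.complex) : Prop :=
  φ.f (-1) ≫ W'.ε = W.ε ≫ f ∧ W.η ≫ φ.f 0 = f ≫ W'.η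

/-- The chain map `φ` extends a morphism `QA ⟶ QB` which covers `f : A ⟶ B`. -/
def CanonicalResolution.IsLift {A B : C} (W : M.CanonicalResolution A)
    (W' : M.CanonicalResolution B) (f : A ⟶ B) (φ : W.res.complex ⟶ W'.res.complex) : Prop :=
  ∃ q : W.cof.obj ⟶ W'.cof.obj, W.cof.IsLift W'.cof f q ∧ W.res.IsLift W'.res q φ

/-- The cochain map `φ` extends a morphism `RA ⟶ RB` which extends `f : A ⟶ B`. -/
def CanonicalCoresolution.IsLift {A B : C} (W : M.CanonicalCoresolution A)
    (W' : M.CanonicalCoresolution B) (f : A ⟶ B)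
    (φ : W.cores.complex ⟶ W'.cores.complex) : Prop :=
  ∃ r : W.fib.obj ⟶ W'.fib.obj, W.fib.IsLift W'.fib f r ∧ W.cores.IsLift W'.cores r φ

/-! ### Cohomology of Hom complexes -/

/-- The cochain complex of abelian groups `Hom(W, B)`, with `Hom(Wₙ, B)` in degree `n`. (The shape
`(ComplexShape.down ℤ).symm` is the cohomological one.) -/
def homFrom (W : ChainComplex C ℤ) (B : C) :
    HomologicalComplex AddCommGrpCat.{v} (ComplexShape.down ℤ).symm :=
  ((preadditiveYoneda.obj B).mapHomologicalComplex _).obj W.op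

/-- The cochain map `Hom(W, B) ⟶ Hom(W', B')`, `h ↦ φ ≫ h ≫ g`. -/
def homFromMap {W W' : ChainComplex C ℤ} (φ : W' ⟶ W) {B B' : C} (g : B ⟶ B') :
    homFrom W B ⟶ homFrom W' B' :=
  ((preadditiveYoneda.obj B).mapHomologicalComplex _).map
      ((HomologicalComplex.opFunctor C (ComplexShape.down ℤ)).map φ.op) ≫
    (NatTrans.mapHomologicalComplex (preadditiveYoneda.map g) _).app W'.op

/-- The cochain complex of abelian groups `Hom(A, W)`, with `Hom(A, Wⁿ)` in degree `n`. -/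
def homTo (A : C) (W : CochainComplex C ℤ) : CochainComplex AddCommGrpCat.{v} ℤ :=
  ((preadditiveCoyoneda.obj (op A)).mapHomologicalComplex _).obj W

/-- The cochain map `Hom(A, W) ⟶ Hom(A', W')`, `h ↦ f ≫ h ≫ φ`. -/
def homToMap {A A' : C} (f : A' ⟶ A) {W W' : CochainComplex C ℤ} (φ : W ⟶ W') :
    homTo A W ⟶ homTo A' W' :=
  ((preadditiveCoyoneda.obj (op A)).mapHomologicalComplex _).map φ ≫
    (NatTrans.mapHomologicalComplex (preadditiveCoyoneda.map f.op) _).app W'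

/-- `Hⁿ[Hom(W, B)]`. This is `ℓExtⁿ(A, B)` when `W` is an `M`-resolution of `A`. -/
abbrev lExt (n : ℤ) (W : ChainComplex C ℤ) (B : C) : AddCommGrpCat.{v} :=
  (homFrom W B).homology n

/-- The map `Hⁿ[Hom(W, B)] ⟶ Hⁿ[Hom(W', B')]` induced by `φ : W' ⟶ W` and `g : B ⟶ B'`. -/
abbrev lExt.map (n : ℤ) {W W' : ChainComplex C ℤ} (φ : W' ⟶ W) {B B' : C} (g : B ⟶ B') :
    lExt n W B ⟶ lExt n W' B' :=
  HomologicalComplex.homologyMap (homFromMap φ g) n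

/-- `Hⁿ[Hom(A, W)]`. This is `rExtⁿ(A, B)` when `W` is an `M`-coresolution of `B`. -/
abbrev rExt (n : ℤ) (A : C) (W : CochainComplex C ℤ) : AddCommGrpCat.{v} :=
  (homTo A W).homology n

/-- The map `Hⁿ[Hom(A, W)] ⟶ Hⁿ[Hom(A', W')]` induced by `f : A' ⟶ A` and `φ : W ⟶ W'`. -/
abbrev rExt.map (n : ℤ) {A A' : C} (f : A' ⟶ A) {W W' : CochainComplex C ℤ} (φ : W ⟶ W') :
    rExt n A W ⟶ rExt n A' W' :=
  HomologicalComplex.homologyMap (homToMap f φ) n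

/-! ### The functors `Extⁿ` of the homotopy category -/

/-- The map `E(A, B) ⟶ E(A', B')` induced by `f : A' ⟶ A` and `g : B ⟶ B'`. -/
abbrev bifunctorMap (E : Cᵒᵖ ⥤ C ⥤ AddCommGrpCat.{v}) {A A' B B' : C} (f : A' ⟶ A) (g : B ⟶ B') :
    (E.obj (op A)).obj B ⟶ (E.obj (op A')).obj B' :=
  (E.map f.op).app B ≫ (E.obj (op A')).map g

/-- The bifunctor `E` is `(A, B) ↦ Extⁿ(RQA, RQB)`. For the object `RQA` (cofibrant) and the object
`RQB` (fibrant) this group is given both by `Hⁿ[Hom(W, RQB)]` for any `M`-resolution `W` of `RQA`,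
and by `Hⁿ[Hom(RQA, W)]` for any `M`-coresolution `W` of `RQB`. Under these identifications, `E`
sends `f : A' ⟶ A` and `g : B ⟶ B'` to the map induced by morphisms `R(Q(f))` and `R(Q(g))` and an
extension of the relevant one of them to the `M`-(co)resolutions. The equivalences say that
such morphisms and extensions exist, and that the induced map does not depend on them. -/
structure IsExtHo (ρ : ∀ A : C, M.BifibrantReplacement A) (n : ℤ)
    (E : Cᵒᵖ ⥤ C ⥤ AddCommGrpCat.{v}) : Prop where
  left : ∃ e : ∀ (A B : C) (W : M.Resolution (ρ A).obj),
      (E.obj (op A)).obj B ≅ lExt n W.complex (ρ B).obj,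
    ∀ {A A' B B' : C} (f : A' ⟶ A) (g : B ⟶ B')
      (W : M.Resolution (ρ A).obj) (W' : M.Resolution (ρ A').obj)
      (m : lExt n W.complex (ρ B).obj ⟶ lExt n W'.complex (ρ B').obj),
      (∃ (f' : (ρ A').obj ⟶ (ρ A).obj) (g' : (ρ B).obj ⟶ (ρ B').obj)
        (φ : W'.complex ⟶ W.complex),
        (ρ A').IsLift (ρ A) f f' ∧ (ρ B).IsLift (ρ B') g g' ∧ W'.IsLift W f' φ ∧
          m = lExt.map n φ g') ↔
      m = (e A B W).inv ≫ bifunctorMap E f g ≫ (e A' B' W').hom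
  right : ∃ e : ∀ (A B : C) (W : M.Coresolution (ρ B).obj),
      (E.obj (op A)).obj B ≅ rExt n (ρ A).obj W.complex,
    ∀ {A A' B B' : C} (f : A' ⟶ A) (g : B ⟶ B')
      (W : M.Coresolution (ρ B).obj) (W' : M.Coresolution (ρ B').obj)
      (m : rExt n (ρ A).obj W.complex ⟶ rExt n (ρ A').obj W'.complex),
      (∃ (f' : (ρ A').obj ⟶ (ρ A).obj) (g' : (ρ B).obj ⟶ (ρ B').obj)
        (φ : W.complex ⟶ W'.complex),
        (ρ A').IsLift (ρ A) f f' ∧ (ρ B).IsLift (ρ B') g g' ∧ W.IsLift W' g' φ ∧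
          m = rExt.map n f' φ) ↔
      m = (e A B W).inv ≫ bifunctorMap E f g ≫ (e A' B' W').hom

end AbelianModelStructure

end HoExt

end

open HoExt HoExt.AbelianModelStructure

noncomputable section

namespace HoExt

variable {C : Type u} [Category.{v} C] [Abelian C]

/-! ### Lifting against short exact sequences -/

/-! Everything takes place in the stable category, where morphisms factoring through the core become
zero. Let `A` be cofibrant with `M`-resolution `W`, and let `B` be fibrant. A degree `n` cocycle of
`Hom(W, B)` is a morphism from the `n`-th syzygy (the opcycles of `W`) to `B`, and it is a
coboundary when it extends over `W.X (n - 1)`. Heredity makes all terms of `W` trivially cofibrant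
and all syzygies cofibrant (`isLeft`), and then "extends" means "stably zero". So the cohomology is
the group of stable morphisms from the syzygy to `B` (`exists_lExtEquiv`). Dually, a coresolution of
`B` yields the stable morphisms from `A` to the cosyzygies of `B` (`exists_rExtEquiv`).

The two answers agree by dimension shifting. For morphisms between short exact sequences of this
kind, one end is stably zero exactly when the other is (`stablyZero_τ₁`, `stablyZero_τ₃`), and any
morphism prescribed at one end extends to the whole sequence. Hence stable morphisms between
syzygies do not change when both indices are raised by one (`exists_shift`, `balanceIso`). The same
facts make syzygies functorial in the stable class of a morphism of base objects
(`exists_functor_map`), which is why no choice of lift or chain map matters.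

The bifunctor is therefore defined on the homotopy category as stable morphisms from `RQA` to the
`n`-th cosyzygy of `RQB`, and each property is read off from the more convenient of its two forms.
Replacing `RQA` by `QA` and `RQB` by `RB` is harmless, because the comparison maps are inverted by
stable Hom into fibrant, respectively out of cofibrant, objects (`isLeftWeq_of_shortExact`,
`isRightWeq_of_shortExact`, `isIso_biMap`). A short exact sequence has a short exact sequence of
replacements, and applying Hom to it gives a short exact sequence of complexes, whence the long
exact sequences. Factorization through `γ` exists by construction. It is unique because every
morphism of the homotopy category is a composite of morphisms `γ(f)` and inverses of such morphisms
(`toHo_induction`). -/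

lemma ExtVanishes.exists_lift_of_shortExact {S : ShortComplex C} (hS : S.ShortExact) {X : C}
    (h : ExtVanishes X S.X₁ 1) (g : X ⟶ S.X₃) : ∃ l : X ⟶ S.X₂, l ≫ S.g = g := by
  let := HasExt.standard.{v} C
  have h' : Subsingleton (Abelian.Ext.{max u v} X S.X₁ 1) := h
  obtain ⟨x, hx⟩ := Abelian.Ext.covariant_sequence_exact₃ X hS (Abelian.Ext.mk₀ g)
    (zero_add 1) (Subsingleton.elim _ _)
  obtain ⟨l, rfl⟩ := (Abelian.Ext.mk₀_bijective _ _).2 x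
  refine ⟨l, (Abelian.Ext.mk₀_bijective _ _).1 ?_⟩
  simpa using hx

lemma ExtVanishes.exists_extension_of_shortExact {S : ShortComplex C} (hS : S.ShortExact) {Y : C}
    (h : ExtVanishes S.X₃ Y 1) (g : S.X₁ ⟶ Y) : ∃ l : S.X₂ ⟶ Y, S.f ≫ l = g := by
  let := HasExt.standard.{v} C
  have h' : Subsingleton (Abelian.Ext.{max u v} S.X₃ Y 1) := h
  obtain ⟨x, hx⟩ := Abelian.Ext.contravariant_sequence_exact₁ hS Y (Abelian.Ext.mk₀ g)
    (add_zero 1) (Subsingleton.elim _ _)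
  obtain ⟨l, rfl⟩ := (Abelian.Ext.mk₀_bijective _ _).2 x
  refine ⟨l, (Abelian.Ext.mk₀_bijective _ _).1 ?_⟩
  simpa using hx

lemma ExtVanishes.of_shortExact_left {S : ShortComplex C} (hS : S.ShortExact) {B : C} {i : ℕ}
    (h₂ : ExtVanishes S.X₂ B i) (h₃ : ExtVanishes S.X₃ B (i + 1)) : ExtVanishes S.X₁ B i := by
  let := HasExt.standard.{v} C
  have h₂' : Subsingleton (Abelian.Ext.{max u v} S.X₂ B i) := h₂
  have h₃' : Subsingleton (Abelian.Ext.{max u v} S.X₃ B (i + 1)) := h₃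
  refine subsingleton_of_forall_eq (0 : Abelian.Ext.{max u v} S.X₁ B i) fun e ↦ ?_
  obtain ⟨x, rfl⟩ := Abelian.Ext.contravariant_sequence_exact₁ hS B e (add_comm 1 i)
    (Subsingleton.elim _ _)
  simp [Subsingleton.elim x 0]

lemma ExtVanishes.of_shortExact_right {S : ShortComplex C} (hS : S.ShortExact) {A : C} {i : ℕ}
    (h₂ : ExtVanishes A S.X₂ i) (h₁ : ExtVanishes A S.X₁ (i + 1)) : ExtVanishes A S.X₃ i := by
  let := HasExt.standard.{v} C
  have h₂' : Subsingleton (Abelian.Ext.{max u v} A S.X₂ i) := h₂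
  have h₁' : Subsingleton (Abelian.Ext.{max u v} A S.X₁ (i + 1)) := h₁
  refine subsingleton_of_forall_eq (0 : Abelian.Ext.{max u v} A S.X₃ i) fun e ↦ ?_
  obtain ⟨x, rfl⟩ := Abelian.Ext.covariant_sequence_exact₃ A hS e rfl (Subsingleton.elim _ _)
  simp [Subsingleton.elim x 0]

lemma ExtVanishes.of_iso_left {X Y B : C} {i : ℕ} (e : X ≅ Y) (h : ExtVanishes X B i) :
    ExtVanishes Y B i := by
  let := HasExt.standard.{v} C
  have h' : Subsingleton (Abelian.Ext.{max u v} X B i) := h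
  refine subsingleton_of_forall_eq (0 : Abelian.Ext.{max u v} Y B i) fun x ↦ ?_
  rw [← Abelian.Ext.mk₀_id_comp x, ← e.inv_hom_id, ← Abelian.Ext.mk₀_comp_mk₀,
    Abelian.Ext.comp_assoc_of_second_deg_zero,
    Subsingleton.elim ((Abelian.Ext.mk₀ e.hom).comp x (zero_add i)) 0]
  simp

lemma ExtVanishes.of_iso_right {A X Y : C} {i : ℕ} (e : X ≅ Y) (h : ExtVanishes A X i) :
    ExtVanishes A Y i := by
  let := HasExt.standard.{v} C
  have h' : Subsingleton (Abelian.Ext.{max u v} A X i) := h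
  refine subsingleton_of_forall_eq (0 : Abelian.Ext.{max u v} A Y i) fun x ↦ ?_
  rw [← Abelian.Ext.comp_mk₀_id x, ← e.inv_hom_id, ← Abelian.Ext.mk₀_comp_mk₀,
    ← Abelian.Ext.comp_assoc_of_second_deg_zero,
    Subsingleton.elim (x.comp (Abelian.Ext.mk₀ e.inv) (add_zero i)) 0]
  simp

lemma IsCotorsionPair.isClosedUnderIsomorphisms_left {X Y : ObjectProperty C}
    (h : IsCotorsionPair X Y) : X.IsClosedUnderIsomorphisms where
  of_iso e hX := (h.mem_left_iff _).2 fun B hB ↦ ((h.mem_left_iff _).1 hX B hB).of_iso_left e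

lemma IsCotorsionPair.isClosedUnderIsomorphisms_right {X Y : ObjectProperty C}
    (h : IsCotorsionPair X Y) : Y.IsClosedUnderIsomorphisms where
  of_iso e hX := (h.mem_right_iff _).2 fun B hB ↦ ((h.mem_right_iff _).1 hX B hB).of_iso_right e

lemma IsCotorsionPair.left_X₂ {X Y : ObjectProperty C} (h : IsCotorsionPair X Y)
    {S : ShortComplex C} (hS : S.ShortExact) (h₁ : X S.X₁) (h₃ : X S.X₃) : X S.X₂ :=
  (h.mem_left_iff _).2 fun B hB ↦ .extension_left hS ((h.mem_left_iff _).1 h₁ B hB)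
    ((h.mem_left_iff _).1 h₃ B hB)

lemma IsCotorsionPair.right_X₂ {X Y : ObjectProperty C} (h : IsCotorsionPair X Y)
    {S : ShortComplex C} (hS : S.ShortExact) (h₁ : Y S.X₁) (h₃ : Y S.X₃) : Y S.X₂ :=
  (h.mem_right_iff _).2 fun B hB ↦ .extension_right hS ((h.mem_right_iff _).1 h₁ B hB)
    ((h.mem_right_iff _).1 h₃ B hB)

/-- `Ext¹(X₁, B)` lies between `Ext¹(X₂, B)` and `Ext²(X₃, B)`, and the latter vanishes by heredity.
This lemma and its dual `right_X₃` are the only places where heredity itself is used. -/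
lemma IsCotorsionPair.left_X₁ {X Y : ObjectProperty C} (h : IsCotorsionPair X Y)
    (h' : IsHereditaryPair X Y) {S : ShortComplex C} (hS : S.ShortExact) (h₂ : X S.X₂)
    (h₃ : X S.X₃) : X S.X₁ :=
  (h.mem_left_iff _).2 fun B hB ↦ .of_shortExact_left hS ((h.mem_left_iff _).1 h₂ B hB)
    (h' _ _ h₃ hB 2 (by norm_num))

lemma IsCotorsionPair.right_X₃ {X Y : ObjectProperty C} (h : IsCotorsionPair X Y)
    (h' : IsHereditaryPair X Y) {S : ShortComplex C} (hS : S.ShortExact) (h₁ : Y S.X₁)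
    (h₂ : Y S.X₂) : Y S.X₃ :=
  (h.mem_right_iff _).2 fun B hB ↦ .of_shortExact_right hS ((h.mem_right_iff _).1 h₂ B hB)
    (h' _ _ hB h₁ 2 (by norm_num))

lemma IsCotorsionPair.exists_lift {X Y : ObjectProperty C} (h : IsCotorsionPair X Y)
    {S : ShortComplex C} (hS : S.ShortExact) {A : C} (hA : X A) (h₁ : Y S.X₁) (g : A ⟶ S.X₃) :
    ∃ l : A ⟶ S.X₂, l ≫ S.g = g :=
  ExtVanishes.exists_lift_of_shortExact hS ((h.mem_left_iff _).1 hA _ h₁) g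

lemma IsCotorsionPair.exists_extension {X Y : ObjectProperty C} (h : IsCotorsionPair X Y)
    {S : ShortComplex C} (hS : S.ShortExact) {B : C} (h₃ : X S.X₃) (hB : Y B) (g : S.X₁ ⟶ B) :
    ∃ l : S.X₂ ⟶ B, S.f ≫ l = g :=
  ExtVanishes.exists_extension_of_shortExact hS ((h.mem_left_iff _).1 h₃ _ hB) g

namespace AbelianModelStructure

variable (M : AbelianModelStructure C)

instance : M.cofibrant.IsClosedUnderIsomorphisms := M.left_pair.isClosedUnderIsomorphisms_left

instance : M.fibrant.IsClosedUnderIsomorphisms := M.right_pair.isClosedUnderIsomorphisms_right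

instance : M.trivCofibrant.IsClosedUnderIsomorphisms :=
  M.right_pair.isClosedUnderIsomorphisms_left

instance : M.trivFibrant.IsClosedUnderIsomorphisms :=
  M.left_pair.isClosedUnderIsomorphisms_right

lemma left_cotorsionPair : IsCotorsionPair M.cofibrant M.trivFibrant :=
  M.left_pair.toIsCotorsionPair

lemma right_cotorsionPair : IsCotorsionPair M.trivCofibrant M.fibrant :=
  M.right_pair.toIsCotorsionPair

variable {M}

lemma trivFibrant_of_core {X : C} (h : M.core X) : M.trivFibrant X := ⟨h.1.2, h.2⟩

/-! ### The stable category is preadditive -/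

variable (M)

/-- A morphism is stably zero if it factors through an object of the core. -/
def StablyZero {A B : C} (f : A ⟶ B) : Prop :=
  ∃ (W : C) (α : A ⟶ W) (β : W ⟶ B), M.core W ∧ α ≫ β = f

lemma homotopic_add ⦃X Y : C⦄ (f₁ f₂ g₁ g₂ : X ⟶ Y) (hf : M.homotopic f₁ f₂)
    (hg : M.homotopic g₁ g₂) : M.homotopic (f₁ + g₁) (f₂ + g₂) := by
  obtain ⟨W, α, β, hW, h⟩ := hf
  obtain ⟨W', α', β', hW', h'⟩ := hg
  exact ⟨W ⊞ W', biprod.lift α α', biprod.desc β β', M.core_biprod hW hW', by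
    rw [biprod.lift_desc, h, h']; abel⟩

instance : Preadditive M.Stable := Quotient.preadditive _ M.homotopic_add

/-- The projection to the stable category. -/
abbrev stable : C ⥤ M.Stable := Quotient.functor M.homotopic

instance : M.stable.Additive := Quotient.functor_additive _ M.homotopic_add

variable {M}

lemma stable_map_eq_zero_iff {A B : C} (f : A ⟶ B) : M.stable.map f = 0 ↔ M.StablyZero f := by
  rw [eq_comm, ← M.stable.map_zero A B, Quotient.functor_map_eq_iff, homotopic, sub_zero,
    StablyZero]

lemma stable_map_eq_iff {A B : C} (f g : A ⟶ B) :
    M.stable.map f = M.stable.map g ↔ M.StablyZero (f - g) := by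
  rw [← sub_eq_zero, ← M.stable.map_sub, stable_map_eq_zero_iff]

lemma StablyZero.precomp {A A' B : C} {f : A ⟶ B} (h : M.StablyZero f) (g : A' ⟶ A) :
    M.StablyZero (g ≫ f) := by
  rw [← stable_map_eq_zero_iff] at h ⊢
  simp [h]

lemma StablyZero.postcomp {A B B' : C} {f : A ⟶ B} (h : M.StablyZero f) (g : B ⟶ B') :
    M.StablyZero (f ≫ g) := by
  rw [← stable_map_eq_zero_iff] at h ⊢
  simp [h]

lemma stablyZero_of_trivCofibrant {K A Y : C} (hK : M.trivCofibrant K) (hY : M.fibrant Y)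
    (f : A ⟶ K) (g : K ⟶ Y) : M.StablyZero (f ≫ g) :=
  StablyZero.precomp (M.factors_of_trivCofibrant hK hY g) f

lemma stablyZero_of_trivFibrant {X K B : C} (hX : M.cofibrant X) (hK : M.trivFibrant K)
    (f : X ⟶ K) (g : K ⟶ B) : M.StablyZero (f ≫ g) :=
  StablyZero.postcomp (M.factors_of_trivFibrant hX hK f) g

/-- The core object is trivially cofibrant, so the second half of the factorization already lifts
against a fibrant kernel. In the dual statement the core object is trivially fibrant and the first
half extends. -/
lemma StablyZero.exists_lift {S : ShortComplex C} (hS : S.ShortExact) (h₁ : M.fibrant S.X₁)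
    {A : C} {f : A ⟶ S.X₃} (hf : M.StablyZero f) : ∃ l : A ⟶ S.X₂, l ≫ S.g = f := by
  obtain ⟨W, α, β, hW, rfl⟩ := hf
  obtain ⟨l, hl⟩ := M.right_cotorsionPair.exists_lift hS hW.1 h₁ β
  exact ⟨α ≫ l, by simp [hl]⟩

lemma StablyZero.exists_extension {S : ShortComplex C} (hS : S.ShortExact)
    (h₃ : M.cofibrant S.X₃) {B : C} {f : S.X₁ ⟶ B} (hf : M.StablyZero f) :
    ∃ l : S.X₂ ⟶ B, S.f ≫ l = f := by
  obtain ⟨W, α, β, hW, rfl⟩ := hf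
  obtain ⟨l, hl⟩ := M.left_cotorsionPair.exists_extension hS h₃ (trivFibrant_of_core hW) α
  exact ⟨l ≫ β, by simp [reassoc_of% hl]⟩

/-- In a morphism of short exact sequences, if the map between the quotients is stably zero, so is
the map between the subobjects. -/
lemma stablyZero_τ₁ {S T : ShortComplex C} (hT : T.ShortExact) (φ : S ⟶ T)
    (hS₂ : M.trivCofibrant S.X₂) (hT₁ : M.fibrant T.X₁) (h : M.StablyZero φ.τ₃) :
    M.StablyZero φ.τ₁ := by
  obtain ⟨l, hl⟩ := h.exists_lift hT hT₁
  have := hT.mono_f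
  -- Correcting the middle map by the lift makes it land in `T.X₁`. Restricted to `S.X₁` it is still
  -- `τ₁`, which therefore factors through the trivially cofibrant `S.X₂`.
  let s := hT.exact.lift (φ.τ₂ - S.g ≫ l) (by simp [hl, φ.comm₂₃])
  have hs : s ≫ T.f = φ.τ₂ - S.g ≫ l := hT.exact.lift_f _ _
  have : φ.τ₁ = S.f ≫ s := by
    rw [← cancel_mono T.f, Category.assoc, hs]
    simp [φ.comm₁₂]
  rw [this]
  exact stablyZero_of_trivCofibrant hS₂ hT₁ _ _

/-- In a morphism of short exact sequences, if the map between the subobjects is stably zero, so is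
the map between the quotients. -/
lemma stablyZero_τ₃ {S T : ShortComplex C} (hS : S.ShortExact) (φ : S ⟶ T)
    (hS₃ : M.cofibrant S.X₃) (hT₂ : M.trivFibrant T.X₂) (h : M.StablyZero φ.τ₁) :
    M.StablyZero φ.τ₃ := by
  obtain ⟨l, hl⟩ := h.exists_extension hS hS₃
  have := hS.epi_g
  let s := hS.exact.desc (φ.τ₂ - l ≫ T.f) (by simp [reassoc_of% hl, φ.comm₁₂])
  have hs : S.g ≫ s = φ.τ₂ - l ≫ T.f := hS.exact.g_desc _ _
  have : φ.τ₃ = s ≫ T.g := by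
    rw [← cancel_epi S.g, reassoc_of% hs]
    simp [φ.comm₂₃]
  rw [this]
  exact stablyZero_of_trivFibrant hS₃ hT₂ _ _

/-- The obstruction to lifting to the middle terms lies in `Ext¹(S.X₂, T.X₁)`, which vanishes; the
map of kernels is then forced. -/
lemma exists_shortComplex_hom_of_τ₃ {S T : ShortComplex C} (hT : T.ShortExact)
    (hS₂ : M.trivCofibrant S.X₂) (hT₁ : M.fibrant T.X₁) (z : S.X₃ ⟶ T.X₃) :
    ∃ φ : S ⟶ T, φ.τ₃ = z := by
  obtain ⟨l, hl⟩ := M.right_cotorsionPair.exists_lift hT hS₂ hT₁ (S.g ≫ z)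
  have := hT.mono_f
  exact ⟨{ τ₁ := hT.exact.lift (S.f ≫ l) (by simp [hl]), τ₂ := l, τ₃ := z,
           comm₁₂ := hT.exact.lift_f _ _, comm₂₃ := hl }, rfl⟩

lemma exists_shortComplex_hom_of_τ₁ {S T : ShortComplex C} (hS : S.ShortExact)
    (hS₃ : M.cofibrant S.X₃) (hT₂ : M.trivFibrant T.X₂) (k : S.X₁ ⟶ T.X₁) :
    ∃ φ : S ⟶ T, φ.τ₁ = k := by
  obtain ⟨l, hl⟩ := M.left_cotorsionPair.exists_extension hS hS₃ hT₂ (k ≫ T.f)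
  have := hS.epi_g
  exact ⟨{ τ₁ := k, τ₂ := l, τ₃ := hS.exact.desc (l ≫ T.g) (by simp [reassoc_of% hl]),
           comm₁₂ := hl.symm, comm₂₃ := (hS.exact.g_desc _ _).symm }, rfl⟩

end AbelianModelStructure

end HoExt

end

noncomputable section

namespace HoExt

/-- A family indexed by `ℤ` can be constructed from its value at `0` by successive choices. -/
lemma exists_int_family {X : ℤ → Type*} (r : ∀ n, X n → X (n + 1) → Prop) (x₀ : X 0)
    (up : ∀ n, 0 ≤ n → ∀ x, ∃ y, r n x y) (down : ∀ n, n < 0 → ∀ y, ∃ x, r n x y) :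
    ∃ x : ∀ n, X n, x 0 = x₀ ∧ ∀ n, r n (x n) (x (n + 1)) := by
  choose u hu using up
  choose d hd using down
  let a : ∀ k : ℕ, X (Int.ofNat k) := fun k ↦
    Nat.rec x₀ (fun k x ↦ u (Int.ofNat k) (Int.natCast_nonneg k) x) k
  let b : ∀ k : ℕ, X (Int.negSucc k) := fun k ↦
    Nat.rec (d (Int.negSucc 0) (Int.negSucc_lt_zero 0) x₀)
      (fun k x ↦ d (Int.negSucc (k + 1)) (Int.negSucc_lt_zero _) x) k
  refine ⟨fun n ↦ match n with
    | .ofNat k => a k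
    | .negSucc k => b k, rfl, fun n ↦ ?_⟩
  match n with
  | .ofNat k => exact hu _ _ _
  | .negSucc 0 => exact hd _ _ _
  | .negSucc (k + 1) => exact hd _ _ _

variable {C : Type u} [Category.{v} C] [Abelian C]

namespace AbelianModelStructure

variable (M : AbelianModelStructure C)

/-! ### Spliced sequences of short exact sequences -/

/-- The short exact sequences `0 ⟶ Z n ⟶ P n ⟶ Z (n + 1) ⟶ 0` into which an `M`-(co)resolution
of an object `base ≅ Z 0` decomposes. -/
structure SplicedTower where
  Z : ℤ → C
  P : ℤ → C
  i (n : ℤ) : Z n ⟶ P n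
  p (n : ℤ) : P n ⟶ Z (n + 1)
  i_p (n : ℤ) : i n ≫ p n = 0
  shortExact (n : ℤ) : (ShortComplex.mk (i n) (p n) (i_p n)).ShortExact
  base : C
  iso : Z 0 ≅ base
  trivCofibrant_P (n : ℤ) (hn : n < 0) : M.trivCofibrant (P n)
  fibrant_Z (n : ℤ) (hn : n < 0) : M.fibrant (Z n)
  trivFibrant_P (n : ℤ) (hn : 0 ≤ n) : M.trivFibrant (P n)
  cofibrant_Z (n : ℤ) (hn : 0 < n) : M.cofibrant (Z n)

namespace SplicedTower

variable {M}

/-- The short complex `Z n ⟶ P n ⟶ Z (n + 1)`. -/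
abbrev sc (T : M.SplicedTower) (n : ℤ) : ShortComplex C := ShortComplex.mk (T.i n) (T.p n) (T.i_p n)

/-- The family `z` is part of a morphism between the short exact sequences of two towers. -/
def IsHom (T T' : M.SplicedTower) (z : ∀ n, T.Z n ⟶ T'.Z n) : Prop :=
  ∀ n, ∃ φ : T.sc n ⟶ T'.sc n, φ.τ₁ = z n ∧ φ.τ₃ = z (n + 1)

lemma IsHom.comp {T T' T'' : M.SplicedTower} {z : ∀ n, T.Z n ⟶ T'.Z n}
    {z' : ∀ n, T'.Z n ⟶ T''.Z n} (h : IsHom T T' z) (h' : IsHom T' T'' z') :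
    IsHom T T'' (fun n ↦ z n ≫ z' n) := fun n ↦ by
  obtain ⟨φ, h₁, h₃⟩ := h n
  obtain ⟨φ', h₁', h₃'⟩ := h' n
  exact ⟨φ ≫ φ', by simp [h₁, h₁'], by simp [h₃, h₃']⟩

lemma isHom_id (T : M.SplicedTower) : IsHom T T (fun _ ↦ 𝟙 _) := fun _ ↦ ⟨𝟙 _, rfl, rfl⟩

lemma IsHom.sub {T T' : M.SplicedTower} {z z' : ∀ n, T.Z n ⟶ T'.Z n} (h : IsHom T T' z)
    (h' : IsHom T T' z') : IsHom T T' (fun n ↦ z n - z' n) := fun n ↦ by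
  obtain ⟨φ, h₁, h₃⟩ := h n
  obtain ⟨φ', h₁', h₃'⟩ := h' n
  exact ⟨φ - φ', by simp [h₁, h₁'], by simp [h₃, h₃']⟩

/-- The comparison theorem for towers: to the right of `0` one extends into the trivially fibrant
terms of `T'`, to the left one lifts from the trivially cofibrant terms of `T`. -/
lemma exists_isHom (T T' : M.SplicedTower) (f : T.Z 0 ⟶ T'.Z 0) :
    ∃ z, IsHom T T' z ∧ z 0 = f := by
  obtain ⟨z, hz, h⟩ := exists_int_family (X := fun n ↦ T.Z n ⟶ T'.Z n)
    (fun n z z' ↦ ∃ φ : T.sc n ⟶ T'.sc n, φ.τ₁ = z ∧ φ.τ₃ = z') f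
    (fun n hn z ↦ by
      obtain ⟨φ, hφ⟩ := exists_shortComplex_hom_of_τ₁ (M := M) (S := T.sc n) (T := T'.sc n)
        (T.shortExact n) (T.cofibrant_Z _ (by lia)) (T'.trivFibrant_P n hn) z
      exact ⟨_, φ, hφ, rfl⟩)
    (fun n hn z ↦ by
      obtain ⟨φ, hφ⟩ := exists_shortComplex_hom_of_τ₃ (M := M) (S := T.sc n) (T := T'.sc n)
        (T'.shortExact n) (T.trivCofibrant_P n hn) (T'.fibrant_Z n hn) z
      exact ⟨_, φ, rfl, hφ⟩)
  exact ⟨z, h, hz⟩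

/-- The uniqueness half of the comparison theorem, with stable vanishing in place of chain
homotopies: it spreads from position `0` in both directions, one short exact sequence at a time. -/
lemma IsHom.stablyZero {T T' : M.SplicedTower} {z : ∀ n, T.Z n ⟶ T'.Z n} (h : IsHom T T' z)
    (h₀ : M.StablyZero (z 0)) (n : ℤ) : M.StablyZero (z n) := by
  obtain hn | hn := le_total 0 n
  · induction n, hn using Int.leInduction with
    | base => exact h₀
    | succ n hn ih =>
      obtain ⟨φ, h₁, h₃⟩ := h n
      rw [← h₃]
      exact stablyZero_τ₃ (T.shortExact n) φ (T.cofibrant_Z _ (by lia)) (T'.trivFibrant_P n hn)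
        (h₁ ▸ ih)
  · induction n, hn using Int.leInductionDown with
    | base => exact h₀
    | pred n hn ih =>
      obtain ⟨m, rfl⟩ : ∃ m, n = m + 1 := ⟨n - 1, by lia⟩
      rw [add_sub_cancel_right]
      obtain ⟨φ, h₁, h₃⟩ := h m
      rw [← h₁]
      exact stablyZero_τ₁ (T'.shortExact m) φ (T.trivCofibrant_P m (by lia))
        (T'.fibrant_Z m (by lia)) (h₃ ▸ ih)

/-- The family `z` extends the morphism `f` between the bases of two towers. -/
structure IsLift (T T' : M.SplicedTower) (f : T.base ⟶ T'.base) (z : ∀ n, T.Z n ⟶ T'.Z n) :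
    Prop where
  isHom : IsHom T T' z
  comm : z 0 ≫ T'.iso.hom = T.iso.hom ≫ f

lemma exists_isLift (T T' : M.SplicedTower) (f : T.base ⟶ T'.base) : ∃ z, IsLift T T' f z := by
  obtain ⟨z, hz, h⟩ := exists_isHom T T' (T.iso.hom ≫ f ≫ T'.iso.inv)
  exact ⟨z, hz, by simp [h]⟩

lemma IsLift.stable_map_eq {T T' : M.SplicedTower} {f f' : T.base ⟶ T'.base}
    {z z' : ∀ n, T.Z n ⟶ T'.Z n} (h : IsLift T T' f z) (h' : IsLift T T' f' z')
    (hf : M.stable.map f = M.stable.map f') (n : ℤ) :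
    M.stable.map (z n) = M.stable.map (z' n) := by
  rw [stable_map_eq_iff] at hf ⊢
  refine (h.isHom.sub h'.isHom).stablyZero ?_ n
  have : z 0 - z' 0 = T.iso.hom ≫ (f - f') ≫ T'.iso.inv := by
    simp [← reassoc_of% h.comm, ← reassoc_of% h'.comm]
  rw [this]
  exact (hf.postcomp _).precomp _

variable {ι : Type*} (t : ι → M.SplicedTower)

/-- A family of towers, with the stable morphisms between their bases. -/
abbrev Cat := InducedCategory M.Stable (fun j ↦ (⟨(t j).base⟩ : M.Stable))

/-- A single stable morphism works for all representatives and all lifts simultaneously. This is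
what makes `Z n` a functor although its action is defined by choice. -/
lemma exists_functor_map {j j' : Cat t} (x : j ⟶ j') (n : ℤ) :
    ∃ y : M.stable.obj ((t j).Z n) ⟶ M.stable.obj ((t j').Z n),
      ∀ (f : (t j).base ⟶ (t j').base) (z : ∀ n, (t j).Z n ⟶ (t j').Z n),
        x.hom = M.stable.map f → IsLift (t j) (t j') f z → y = M.stable.map (z n) := by
  obtain ⟨f, hf⟩ := M.stable.map_surjective x.hom
  obtain ⟨z, hz⟩ := exists_isLift (t j) (t j') f
  exact ⟨M.stable.map (z n), fun f' z' hf' hz' ↦ hz.stable_map_eq hz' (hf.trans hf') n⟩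

/-- The functor which sends a tower to `Z n` in the stable category. -/
def functor (n : ℤ) : Cat t ⥤ M.Stable where
  obj j := M.stable.obj ((t j).Z n)
  map x := (exists_functor_map t x n).choose
  map_id j := (exists_functor_map t (𝟙 j) n).choose_spec (𝟙 _) _ (by simp; rfl)
    ⟨isHom_id _, by simp⟩
  map_comp {j₁ j₂ j₃} x y := by
    obtain ⟨f, hf⟩ := M.stable.map_surjective x.hom
    obtain ⟨z, hz⟩ := exists_isLift (t j₁) (t j₂) f
    obtain ⟨g, hg⟩ := M.stable.map_surjective y.hom
    obtain ⟨w, hw⟩ := exists_isLift (t j₂) (t j₃) g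
    rw [(exists_functor_map t x n).choose_spec f z hf.symm hz,
      (exists_functor_map t y n).choose_spec g w hg.symm hw, ← M.stable.map_comp]
    refine (exists_functor_map t (x ≫ y) n).choose_spec (f ≫ g) _ ?_
      ⟨hz.isHom.comp hw.isHom, ?_⟩
    · rw [InducedCategory.comp_hom, M.stable.map_comp, hf, hg]
    · rw [Category.assoc, hw.comm, reassoc_of% hz.comm]

variable {t} in
lemma functor_map {j j' : Cat t} (x : j ⟶ j') {f : (t j).base ⟶ (t j').base}
    {z : ∀ n, (t j).Z n ⟶ (t j').Z n} (hf : x.hom = M.stable.map f)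
    (hz : IsLift (t j) (t j') f z) (n : ℤ) : (functor t n).map x = M.stable.map (z n) :=
  (exists_functor_map t x n).choose_spec f z hf hz

/-- The functor for `n = 0` is the one which sends a tower to its base. -/
def functorZeroIso : functor t 0 ≅ inducedFunctor _ :=
  NatIso.ofComponents (fun j ↦ M.stable.mapIso (t j).iso) (fun {j j'} x ↦ by
    obtain ⟨f, hf⟩ := M.stable.map_surjective x.hom
    obtain ⟨z, hz⟩ := exists_isLift (t j) (t j') f
    rw [functor_map x hf.symm hz]
    have := congrArg M.stable.map hz.comm
    rw [M.stable.map_comp, M.stable.map_comp, hf] at this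
    exact this)

end SplicedTower

end AbelianModelStructure

end HoExt

end

/-! ### Dimension shifting and the balance of the two forms of Ext -/

noncomputable section

namespace HoExt

/-- Two quotients of one group by the same kernel. The equivalence comes with its value on
representatives, and all later naturality proofs rely on that formula. -/
lemma exists_addEquiv_of_surjective {G H K : Type*} [AddCommGroup G] [AddCommGroup H]
    [AddCommGroup K] (f : G →+ H) (g : G →+ K) (hf : Function.Surjective f)
    (hg : Function.Surjective g) (h : ∀ x, f x = 0 ↔ g x = 0) :
    ∃ e : H ≃+ K, ∀ x, e (f x) = g x := by
  have hk : f.ker = g.ker := by ext x; exact h x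
  let e₁ := QuotientAddGroup.quotientKerEquivOfSurjective f hf
  let e₂ := QuotientAddGroup.quotientKerEquivOfSurjective g hg
  refine ⟨e₁.symm.trans ((QuotientAddGroup.quotientAddEquivOfEq hk).trans e₂), fun x ↦ ?_⟩
  have : e₁.symm (f x) = QuotientAddGroup.mk x := e₁.symm_apply_eq.2 rfl
  simp only [AddEquiv.trans_apply, this]
  rfl

section Bifunctor

variable {D₁ D₂ E : Type*} [Category* D₁] [Category* D₂] [Category* E]

/-- Isomorphic bifunctors, from isomorphisms compatible with morphisms in both variables. -/
def bifunctorIso {F G : D₁ᵒᵖ ⥤ D₂ ⥤ E}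
    (e : ∀ X Y, (F.obj (op X)).obj Y ≅ (G.obj (op X)).obj Y)
    (he : ∀ {X X' Y Y'} (f : X' ⟶ X) (g : Y ⟶ Y'),
      ((F.map f.op).app Y ≫ (F.obj (op X')).map g) ≫ (e X' Y').hom =
        (e X Y).hom ≫ (G.map f.op).app Y ≫ (G.obj (op X')).map g) : F ≅ G :=
  NatIso.ofComponents
    (fun X ↦ NatIso.ofComponents (fun Y ↦ e X.unop Y) (fun {Y Y'} g ↦ by
      simpa using he (𝟙 X.unop) g))
    (fun {X X'} f ↦ by
      ext Y
      simpa using he f.unop (𝟙 Y))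

variable [Preadditive E]

/-- The bifunctor `(X, Y) ↦ Hom(a(X), b(Y))`. -/
def homBifunctor (a : D₁ ⥤ E) (b : D₂ ⥤ E) : D₁ᵒᵖ ⥤ D₂ ⥤ AddCommGrpCat :=
  a.op ⋙ preadditiveCoyoneda ⋙ (Functor.whiskeringLeft _ _ _).obj b

/-- Natural additive bijections between groups of morphisms. -/
def homBifunctorIso {a a' : D₁ ⥤ E} {b b' : D₂ ⥤ E}
    (e : ∀ X Y, (a.obj X ⟶ b.obj Y) ≃+ (a'.obj X ⟶ b'.obj Y))
    (he : ∀ {X X' Y Y'} (x : X' ⟶ X) (y : Y ⟶ Y') (w : a.obj X ⟶ b.obj Y),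
      e X' Y' ((a.map x ≫ w) ≫ b.map y) = (a'.map x ≫ e X Y w) ≫ b'.map y) :
    homBifunctor a b ≅ homBifunctor a' b' :=
  bifunctorIso (fun X Y ↦ (e X Y).toAddCommGrpIso) (fun {X X' Y Y'} f g ↦ by
    ext w
    exact he f g w)

/-- `homBifunctor` preserves isomorphisms of functors. -/
def homBifunctorCongr {a a' : D₁ ⥤ E} {b b' : D₂ ⥤ E} (α : a ≅ a') (β : b ≅ b') :
    homBifunctor a b ≅ homBifunctor a' b' :=
  Functor.isoWhiskerRight (NatIso.op α.symm) _ ≪≫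
    Functor.isoWhiskerLeft a'.op
      (Functor.isoWhiskerLeft preadditiveCoyoneda ((Functor.whiskeringLeft _ _ _).mapIso β))

instance additive_homBifunctor_obj [Preadditive D₂] (a : D₁ ⥤ E) (b : D₂ ⥤ E) [b.Additive]
    (X : D₁ᵒᵖ) : ((homBifunctor a b).obj X).Additive where
  map_add {Y Y' f g} := by
    ext w
    change a.obj X.unop ⟶ b.obj Y at w
    change w ≫ b.map (f + g) = w ≫ b.map f + w ≫ b.map g
    simp

instance additive_homBifunctor_flip_obj [Preadditive D₁] (a : D₁ ⥤ E) (b : D₂ ⥤ E) [a.Additive]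
    (Y : D₂) : ((homBifunctor a b).flip.obj Y).Additive where
  map_add {X X' f g} := by
    ext w
    change a.obj X.unop ⟶ b.obj Y at w
    change a.map (f.unop + g.unop) ≫ w = a.map f.unop ≫ w + a.map g.unop ≫ w
    simp

end Bifunctor

variable {C : Type u} [Category.{v} C] [Abelian C]

namespace AbelianModelStructure

variable {M : AbelianModelStructure C}

namespace SplicedTower

/-- Towers whose middle terms are trivially cofibrant and whose cycles are cofibrant. -/
def IsLeft (T : M.SplicedTower) : Prop :=
  ∀ n, M.trivCofibrant (T.P n) ∧ M.cofibrant (T.Z n)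

/-- Towers whose middle terms are trivially fibrant and whose cycles are fibrant. -/
def IsRight (T : M.SplicedTower) : Prop :=
  ∀ n, M.trivFibrant (T.P n) ∧ M.fibrant (T.Z n)

/-- Going down from the base, each `Z n` is the kernel of an epimorphism between cofibrant objects,
so it is cofibrant by heredity. -/
lemma isLeft (hM : M.IsHereditary) (T : M.SplicedTower) (hT : M.cofibrant T.base) :
    T.IsLeft := by
  have hZ (n : ℤ) : M.cofibrant (T.Z n) := by
    obtain hn | hn := lt_or_ge 0 n
    · exact T.cofibrant_Z n hn
    · induction n, hn using Int.leInductionDown with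
      | base => exact M.cofibrant.prop_of_iso T.iso.symm hT
      | pred n hn ih =>
        obtain ⟨m, rfl⟩ : ∃ m, n = m + 1 := ⟨n - 1, by lia⟩
        rw [add_sub_cancel_right]
        exact M.left_cotorsionPair.left_X₁ hM.1 (T.shortExact m)
          (T.trivCofibrant_P m (by lia)).1 ih
  refine fun n ↦ ⟨?_, hZ n⟩
  -- Terms at nonnegative positions are given as trivially fibrant. They are also cofibrant, as
  -- extensions of cofibrant objects.
  obtain hn | hn := lt_or_ge n 0
  · exact T.trivCofibrant_P n hn
  · exact ⟨M.left_cotorsionPair.left_X₂ (T.shortExact n) (hZ n) (hZ (n + 1)),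
      (T.trivFibrant_P n hn).1⟩

lemma isRight (hM : M.IsHereditary) (T : M.SplicedTower) (hT : M.fibrant T.base) :
    T.IsRight := by
  have hZ (n : ℤ) : M.fibrant (T.Z n) := by
    obtain hn | hn := lt_or_ge n 0
    · exact T.fibrant_Z n hn
    · induction n, hn using Int.leInduction with
      | base => exact M.fibrant.prop_of_iso T.iso.symm hT
      | succ n hn ih =>
        exact M.right_cotorsionPair.right_X₃ hM.2 (T.shortExact n) ih (T.trivFibrant_P n hn).2
  refine fun n ↦ ⟨?_, hZ n⟩
  obtain hn | hn := lt_or_ge n 0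
  · exact ⟨(T.trivCofibrant_P n hn).2,
      M.right_cotorsionPair.right_X₂ (T.shortExact n) (hZ n) (hZ (n + 1))⟩
  · exact T.trivFibrant_P n hn

/-- Dimension shifting. -/
lemma exists_shift {T U : M.SplicedTower} (hT : T.IsLeft) (hU : U.IsRight) (m k : ℤ) :
    ∃ e : (M.stable.obj (T.Z m) ⟶ M.stable.obj (U.Z k)) ≃+
        (M.stable.obj (T.Z (m + 1)) ⟶ M.stable.obj (U.Z (k + 1))),
      ∀ φ : T.sc m ⟶ U.sc k, e (M.stable.map φ.τ₁) = M.stable.map φ.τ₃ := by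
  -- Both groups are quotients of the group of morphisms between the two short exact sequences, by
  -- the same subgroup.
  refine exists_addEquiv_of_surjective
    (AddMonoidHom.mk' (fun φ : T.sc m ⟶ U.sc k ↦ M.stable.map φ.τ₁) fun φ ψ ↦ by simp)
    (AddMonoidHom.mk' (fun φ : T.sc m ⟶ U.sc k ↦ M.stable.map φ.τ₃) fun φ ψ ↦ by simp)
    (fun y ↦ ?_) (fun y ↦ ?_) fun φ ↦ ?_
  · obtain ⟨f, rfl⟩ := M.stable.map_surjective y
    obtain ⟨φ, rfl⟩ := exists_shortComplex_hom_of_τ₁ (S := T.sc m) (T := U.sc k) (T.shortExact m)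
      (hT (m + 1)).2 (hU k).1 f
    exact ⟨φ, rfl⟩
  · obtain ⟨f, rfl⟩ := M.stable.map_surjective y
    obtain ⟨φ, rfl⟩ := exists_shortComplex_hom_of_τ₃ (S := T.sc m) (T := U.sc k) (U.shortExact k)
      (hT m).1 (hU k).2 f
    exact ⟨φ, rfl⟩
  · simp only [AddMonoidHom.mk'_apply, stable_map_eq_zero_iff]
    exact ⟨stablyZero_τ₃ (T.shortExact m) φ (hT (m + 1)).2 (hU k).1,
      stablyZero_τ₁ (U.shortExact k) φ (hT m).1 (hU k).2⟩

variable (M) in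
/-- The category of left towers, with the stable morphisms between their bases. -/
abbrev Left := Cat (Subtype.val : {T : M.SplicedTower // T.IsLeft} → M.SplicedTower)

variable (M) in
/-- The category of right towers, with the stable morphisms between their bases. -/
abbrev Right := Cat (Subtype.val : {T : M.SplicedTower // T.IsRight} → M.SplicedTower)

variable (M) in
/-- The functor `Z n` on left towers. -/
abbrev leftZ (n : ℤ) : Left M ⥤ M.Stable := functor _ n

variable (M) in
/-- The functor `Z n` on right towers. -/
abbrev rightZ (n : ℤ) : Right M ⥤ M.Stable := functor _ n

variable (M) in
/-- The base of a left tower. -/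
abbrev leftBase : Left M ⥤ M.Stable := inducedFunctor _

variable (M) in
/-- The base of a right tower. -/
abbrev rightBase : Right M ⥤ M.Stable := inducedFunctor _

variable (M) in
/-- Dimension shifting, as an isomorphism of bifunctors. -/
def shiftIso (m k : ℤ) :
    homBifunctor (leftZ M m) (rightZ M k) ≅ homBifunctor (leftZ M (m + 1)) (rightZ M (k + 1)) :=
  homBifunctorIso (fun T U ↦ (exists_shift T.2 U.2 m k).choose) (fun {T T' U U'} x y w ↦ by
    obtain ⟨w, rfl⟩ := M.stable.map_surjective w
    obtain ⟨φ, rfl⟩ := exists_shortComplex_hom_of_τ₁ (S := T.1.sc m) (T := U.1.sc k)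
      (T.1.shortExact m) (T.2 (m + 1)).2 (U.2 k).1 w
    obtain ⟨f, hf⟩ := M.stable.map_surjective x.hom
    obtain ⟨z, hz⟩ := exists_isLift T'.1 T.1 f
    obtain ⟨g, hg⟩ := M.stable.map_surjective y.hom
    obtain ⟨z', hz'⟩ := exists_isLift U.1 U'.1 g
    obtain ⟨α, h₁, h₃⟩ := hz.isHom m
    obtain ⟨β, h₁', h₃'⟩ := hz'.isHom k
    simp only [leftZ, rightZ, functor_map x hf.symm hz, functor_map y hg.symm hz', ← h₁, ← h₁',
      ← h₃, ← h₃']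
    -- The shift is known on ends of morphisms of short exact sequences, and `φ` composed with the
    -- tower maps `α` and `β` is again such a morphism.
    have h := (exists_shift T.2 U.2 m k).choose_spec φ
    have h' := (exists_shift T'.2 U'.2 m k).choose_spec ((α ≫ φ) ≫ β)
    simp only [ShortComplex.comp_τ₁, ShortComplex.comp_τ₃, M.stable.map_comp] at h'
    exact h'.trans
      (congrArg (fun t ↦ (M.stable.map α.τ₃ ≫ t) ≫ M.stable.map β.τ₃) h.symm))

/-- Iteration of the one-step shift, upwards or downwards. Only the existence of a natural
isomorphism is recorded, so that the indices can be rewritten freely; its formula is not needed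
later. -/
lemma nonempty_shiftIso (m k : ℤ) (h : k = -m) :
    Nonempty (homBifunctor (leftZ M m) (rightZ M 0) ≅ homBifunctor (leftZ M 0) (rightZ M k)) := by
  suffices ∀ l i, i = m + l →
      Nonempty (homBifunctor (leftZ M m) (rightZ M 0) ≅ homBifunctor (leftZ M i) (rightZ M l)) from
    this k 0 (by lia)
  intro l
  induction l using Int.induction_on with
  | zero => rintro i rfl; rw [add_zero]; exact ⟨Iso.refl _⟩
  | succ l ih =>
    rintro i rfl
    obtain ⟨e⟩ := ih _ rfl
    rw [← add_assoc]
    exact ⟨e ≪≫ shiftIso M _ _⟩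
  | pred l ih =>
    intro i hi
    obtain ⟨e⟩ := ih (i + 1) (by lia)
    have e' := shiftIso M i (-(l : ℤ) - 1)
    rw [sub_add_cancel] at e'
    exact ⟨e ≪≫ e'.symm⟩

variable (M) in
/-- `Hom(Z m(T), U) ≅ Hom(T, Z k(U))` in the stable category, for `k = -m`. -/
def balanceIso (m k : ℤ) (h : k = -m) :
    homBifunctor (leftZ M m) (rightBase M) ≅ homBifunctor (leftBase M) (rightZ M k) :=
  homBifunctorCongr (Iso.refl _) (functorZeroIso _).symm ≪≫ (nonempty_shiftIso m k h).some ≪≫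
    homBifunctorCongr (functorZeroIso _) (Iso.refl _)

end SplicedTower

end AbelianModelStructure

end HoExt

end

noncomputable section

namespace HoExt

variable {C : Type u} [Category.{v} C] [Abelian C]

/-! ### Short exact sequences of an acyclic complex -/

section Acyclic

variable {ι : Type*} {c : ComplexShape ι} {K : HomologicalComplex C c}

/-- The kernel is the homology object, which vanishes. -/
lemma mono_fromOpcycles (hK : K.Acyclic) {i j : ι} (h : c.Rel i j) : Mono (K.fromOpcycles i j) := by
  have hS : (ShortComplex.mk _ _ (K.homologyι_comp_fromOpcycles i j)).Exact :=
    ShortComplex.exact_of_f_is_kernel _ (K.homologyIsKernel i j (c.next_eq' h))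
  exact hS.mono_g ((hK i).isZero_homology.eq_of_src _ _)

lemma epi_toCycles (hK : K.Acyclic) {i j : ι} (h : c.Rel i j) : Epi (K.toCycles i j) := by
  have hS : (ShortComplex.mk _ _ (K.toCycles_comp_homologyπ i j)).Exact :=
    ShortComplex.exact_of_g_is_cokernel _ (K.homologyIsCokernel i j (c.prev_eq' h))
  exact hS.epi_f ((hK j).isZero_homology.eq_of_tgt _ _)

lemma fromOpcycles_pOpcycles (i j : ι) : K.fromOpcycles i j ≫ K.pOpcycles j = 0 := by
  rw [← cancel_epi (K.pOpcycles i), K.p_fromOpcycles_assoc, K.d_pOpcycles, comp_zero]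

lemma iCycles_toCycles (i j : ι) : K.iCycles i ≫ K.toCycles i j = 0 := by
  rw [← cancel_mono (K.iCycles j), Category.assoc, K.toCycles_i, K.iCycles_d, zero_comp]

/-- Exactness of `X i ⟶ X j ⟶ opcycles j` is unaffected by replacing `X i` with its quotient
`opcycles i`, through which the differential factors. -/
lemma shortExact_opcycles (hK : K.Acyclic) {i j : ι} (h : c.Rel i j) :
    (ShortComplex.mk (K.fromOpcycles i j) (K.pOpcycles j)
      (fromOpcycles_pOpcycles i j)).ShortExact where
  mono_f := mono_fromOpcycles hK h
  epi_g := inferInstanceAs (Epi (K.pOpcycles j))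
  exact := by
    have hS : (ShortComplex.mk _ _ (K.d_pOpcycles i j)).Exact :=
      ShortComplex.exact_of_g_is_cokernel _ (K.opcyclesIsCokernel i j (c.prev_eq' h))
    refine (ShortComplex.exact_iff_of_epi_of_isIso_of_mono
      (S₁ := ShortComplex.mk _ _ (K.d_pOpcycles i j))
      (S₂ := ShortComplex.mk _ _ (fromOpcycles_pOpcycles i j))
      { τ₁ := K.pOpcycles i, τ₂ := 𝟙 _, τ₃ := 𝟙 _ }).1 hS

lemma shortExact_cycles (hK : K.Acyclic) {i j : ι} (h : c.Rel i j) :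
    (ShortComplex.mk (K.iCycles i) (K.toCycles i j) (iCycles_toCycles i j)).ShortExact where
  mono_f := inferInstanceAs (Mono (K.iCycles i))
  epi_g := epi_toCycles hK h
  exact := by
    have hS : (ShortComplex.mk _ _ (K.iCycles_d i j)).Exact :=
      ShortComplex.exact_of_f_is_kernel _ (K.cyclesIsKernel i j (c.next_eq' h))
    refine (ShortComplex.exact_iff_of_epi_of_isIso_of_mono
      (S₁ := ShortComplex.mk _ _ (iCycles_toCycles i j))
      (S₂ := ShortComplex.mk _ _ (K.iCycles_d i j))
      { τ₁ := 𝟙 _, τ₂ := 𝟙 _, τ₃ := K.iCycles j }).2 hS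

/-- `opcycles` as a cokernel. -/
def opcyclesIsoCokernel {i j : ι} (h : c.Rel i j) : K.opcycles j ≅ cokernel (K.d i j) :=
  (K.opcyclesIsCokernel i j (c.prev_eq' h)).coconePointUniqueUpToIso (colimit.isColimit _)

/-- `cycles` as a kernel. -/
def cyclesIsoKernel {i j : ι} (h : c.Rel i j) : K.cycles i ≅ kernel (K.d i j) :=
  (K.cyclesIsKernel i j (c.next_eq' h)).conePointUniqueUpToIso (limit.isLimit _)

/-- `opcycles` as `cycles` in an acyclic complex. -/
def opcyclesIsoCycles (hK : K.Acyclic) {i j k : ι} (h : c.Rel i j) (h' : c.Rel j k) :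
    K.opcycles i ≅ K.cycles j := by
  have e := (shortExact_opcycles hK h).fIsKernel
  have := mono_fromOpcycles hK h'
  -- Both objects are kernels of the projection from `K.X j` to its opcycles.
  refine e.conePointUniqueUpToIso (KernelFork.IsLimit.ofι (K.iCycles j)
    (by rw [← cancel_mono (K.fromOpcycles j k)]; simp) (fun {A} a ha ↦ K.liftCycles a k
      (c.next_eq' h') (by rw [← K.p_fromOpcycles, reassoc_of% ha, zero_comp])) ?_ ?_)
  · simp
  · intro A a ha b hb
    rw [← cancel_mono (K.iCycles j), hb]
    simp

end Acyclic

/-- The kernel of the second map of a composition with a monomorphism. -/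
def kernelIsoOfCompMono {A B D : C} (f : A ⟶ B) (g : B ⟶ D) [Mono g] {k : A ⟶ D}
    (h : f ≫ g = k) : kernel k ≅ kernel f :=
  eqToIso (by subst h; rfl) ≪≫ kernelCompMono f g

/-- The cokernel of the second map of a composition with an epimorphism. -/
def cokernelIsoOfEpiComp {A B D : C} (f : A ⟶ B) (g : B ⟶ D) [Epi f] {k : A ⟶ D}
    (h : f ≫ g = k) : cokernel k ≅ cokernel g :=
  eqToIso (by subst h; rfl) ≪≫ cokernelEpiComp f g

/-! ### Resolutions and coresolutions as spliced towers -/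

namespace AbelianModelStructure

variable {M : AbelianModelStructure C}

namespace Resolution

variable {A : C} (W : M.Resolution A)

lemma rel (n : ℤ) : (ComplexShape.down ℤ).Rel (-n) (-(n + 1)) := by
  rw [ComplexShape.down_Rel]; lia

/-- The object `A` as the group of opcycles of an `M`-resolution of `A`. -/
def opcyclesIso : W.complex.opcycles 0 ≅ A := by
  have := W.epi_ε
  have := W.mono_η
  let f := W.complex.descOpcycles W.ε 1 (by simp) (by
    rw [← cancel_mono W.η, Category.assoc, W.ε_η]; simp)
  have hf : W.complex.pOpcycles 0 ≫ f = W.ε := by simp [f]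
  have hf' : f ≫ W.η = W.complex.fromOpcycles 0 (-1) := by
    rw [← cancel_epi (W.complex.pOpcycles 0), reassoc_of% hf]
    simp [W.ε_η]
  -- The comparison `f` is epi because `ε` factors through it, and mono because the inclusion of
  -- opcycles, mono by acyclicity, factors through it.
  have : Mono (W.complex.fromOpcycles 0 (-1)) := mono_fromOpcycles W.acyclic (by simp)
  have : Epi f := epi_of_epi_fac hf
  have : Mono f := mono_of_mono_fac hf'
  have := isIso_of_mono_of_epi f
  exact asIso f

@[simp]
lemma pOpcycles_opcyclesIso_hom : W.complex.pOpcycles 0 ≫ W.opcyclesIso.hom = W.ε := by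
  simp [opcyclesIso]

@[simp]
lemma opcyclesIso_hom_η : W.opcyclesIso.hom ≫ W.η = W.complex.fromOpcycles 0 (-1) := by
  rw [← cancel_epi (W.complex.pOpcycles 0), reassoc_of% W.pOpcycles_opcyclesIso_hom]
  simp [W.ε_η]

/-- By acyclicity the opcycles in degree `j + 1` are the kernel of the differential out of degree
`j`. For `j = 0` that kernel is `kernel ε`, since `η` is mono. -/
lemma fibrant_opcycles (k : ℤ) (hk : 0 < k) : M.fibrant (W.complex.opcycles k) := by
  obtain ⟨j, rfl⟩ : ∃ j, k = j + 1 := ⟨k - 1, by lia⟩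
  have e := opcyclesIsoCycles (i := j + 1) (j := j) (k := j - 1) W.acyclic (by simp) (by simp) ≪≫
    cyclesIsoKernel (K := W.complex) (i := j) (j := j - 1) (by simp)
  refine M.fibrant.prop_of_iso e.symm ?_
  obtain rfl | hj := (show 0 ≤ j by lia).eq_or_lt
  · have := W.mono_η
    exact M.fibrant.prop_of_iso (kernelIsoOfCompMono _ _ W.ε_η).symm W.fibrant_kernel_ε
  · exact W.fibrant_kernel_d j hj

/-- The opcycles in degree `j - 1` are the cokernel of the differential out of degree `j`. For `j =
0` this is `cokernel η`, since `ε` is epi. -/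
lemma cofibrant_opcycles (k : ℤ) (hk : k < 0) : M.cofibrant (W.complex.opcycles k) := by
  obtain ⟨j, rfl⟩ : ∃ j, k = j - 1 := ⟨k + 1, by lia⟩
  refine M.cofibrant.prop_of_iso
    (opcyclesIsoCokernel (K := W.complex) (i := j) (j := j - 1) (by simp)).symm ?_
  obtain rfl | hj := (show j ≤ 0 by lia).eq_or_lt
  · have := W.epi_ε
    exact M.cofibrant.prop_of_iso (cokernelIsoOfEpiComp _ _ W.ε_η).symm W.cofibrant_cokernel_η
  · exact W.cofibrant_cokernel_d j (by lia)

/-- The short exact sequences of an `M`-resolution. -/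
def tower : M.SplicedTower where
  -- Towers are indexed cohomologically, hence the negated chain degrees; `P n` lies one chain
  -- degree below `Z n`.
  Z n := W.complex.opcycles (-n)
  P n := W.complex.X (-(n + 1))
  i n := W.complex.fromOpcycles (-n) (-(n + 1))
  p n := W.complex.pOpcycles (-(n + 1))
  i_p n := fromOpcycles_pOpcycles _ _
  shortExact n := shortExact_opcycles W.acyclic (rel n)
  base := A
  iso := W.opcyclesIso
  trivCofibrant_P n hn := W.trivCofibrant_X _ (by lia)
  fibrant_Z n hn := W.fibrant_opcycles _ (by lia)
  trivFibrant_P n hn := W.trivFibrant_X _ (by lia)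
  cofibrant_Z n hn := W.cofibrant_opcycles _ (by lia)

variable {W} {A' : C} {W' : M.Resolution A'}

lemma IsLift.tower {f : A ⟶ A'} {φ : W.complex ⟶ W'.complex} (h : W.IsLift W' f φ) :
    SplicedTower.IsLift W.tower W'.tower f
      (fun n ↦ HomologicalComplex.opcyclesMap φ (-n)) where
  isHom n := ⟨{ τ₁ := HomologicalComplex.opcyclesMap φ (-n)
                τ₂ := φ.f (-(n + 1))
                τ₃ := HomologicalComplex.opcyclesMap φ (-(n + 1))
                comm₁₂ := by
                  change HomologicalComplex.opcyclesMap φ (-n) ≫ W'.complex.fromOpcycles _ _ =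
                    W.complex.fromOpcycles _ _ ≫ _
                  rw [← cancel_epi (W.complex.pOpcycles _)]
                  simp
                comm₂₃ := (HomologicalComplex.p_opcyclesMap φ _).symm }, rfl, rfl⟩
  comm := by
    change HomologicalComplex.opcyclesMap φ 0 ≫ W'.opcyclesIso.hom = W.opcyclesIso.hom ≫ f
    rw [← cancel_epi (W.complex.pOpcycles _)]
    simp [h.1, reassoc_of% W.pOpcycles_opcyclesIso_hom]

variable (W W') in
-- The middle components of a morphism of towers form the chain map: each differential is a
-- projection to opcycles followed by an inclusion, and both squares commute.
lemma exists_isLift (f : A ⟶ A') : ∃ φ, W.IsLift W' f φ := by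
  obtain ⟨z, hz⟩ := SplicedTower.exists_isLift W.tower W'.tower f
  obtain ⟨y, hy⟩ : ∃ y : ∀ k, W.complex.opcycles k ⟶ W'.complex.opcycles k,
      ∀ n, y (-n) = z n := by
    -- The tower family is indexed by the negated degree, and `-(-k) = k` is only propositional, so
    -- the components are transported.
    refine ⟨fun k ↦ neg_neg k ▸ z (-k), fun n ↦ ?_⟩
    have (m : ℤ) (e : -m = -n) :
        (e ▸ (z m : W.complex.opcycles (-m) ⟶ W'.complex.opcycles (-m)) :
          W.complex.opcycles (-n) ⟶ W'.complex.opcycles (-n)) = z n := by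
      obtain rfl := neg_inj.1 e
      rfl
    exact this _ _
  have (k j : ℤ) (h : k + 1 = j) : ∃ g : W.complex.X k ⟶ W'.complex.X k,
      g ≫ W'.complex.pOpcycles k = W.complex.pOpcycles k ≫ y k ∧
      W.complex.fromOpcycles j k ≫ g = y j ≫ W'.complex.fromOpcycles j k := by
    obtain ⟨n, rfl⟩ : ∃ n, j = -n := ⟨-j, by simp⟩
    obtain rfl : k = -(n + 1) := by lia
    obtain ⟨φ, h₁, h₃⟩ := hz.isHom n
    rw [hy, hy, ← h₁, ← h₃]
    exact ⟨φ.τ₂, φ.comm₂₃, φ.comm₁₂.symm⟩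
  choose g hg hg' using fun k ↦ this k (k + 1) rfl
  have h₀ : y 0 ≫ W'.opcyclesIso.hom = W.opcyclesIso.hom ≫ f := by
    have h : y 0 = z 0 := hy 0
    rw [h]
    exact hz.comm
  refine ⟨{ f := g, comm' := ?_ }, ?_, ?_⟩
  · rintro _ k rfl
    rw [← W.complex.p_fromOpcycles, ← W'.complex.p_fromOpcycles, reassoc_of% hg, Category.assoc,
      hg']
  · dsimp
    rw [← W'.pOpcycles_opcyclesIso_hom, reassoc_of% hg, h₀, reassoc_of% W.pOpcycles_opcyclesIso_hom]
  · have := hg' (-1)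
    rw [neg_add_cancel] at this
    dsimp
    rw [← cancel_epi W.opcyclesIso.hom, reassoc_of% W.opcyclesIso_hom_η, this, ← reassoc_of% h₀,
      opcyclesIso_hom_η]

end Resolution

namespace Coresolution

variable {A : C} (W : M.Coresolution A)

/-- The object `A` as the group of cycles of an `M`-coresolution of `A`. -/
def cyclesIso : W.complex.cycles 0 ≅ A := by
  have := W.epi_ε
  have := W.mono_η
  let f := W.complex.liftCycles W.η 1 (by simp) (by
    rw [← cancel_epi W.ε, reassoc_of% W.ε_η]; simp)
  have hf : f ≫ W.complex.iCycles 0 = W.η := by simp [f]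
  have hf' : W.ε ≫ f = W.complex.toCycles (-1) 0 := by
    rw [← cancel_mono (W.complex.iCycles 0), Category.assoc, hf]
    simp [W.ε_η]
  have : Epi (W.complex.toCycles (-1) 0) := epi_toCycles W.acyclic (by simp)
  have : Mono f := mono_of_mono_fac hf
  have : Epi f := epi_of_epi_fac hf'
  have := isIso_of_mono_of_epi f
  exact (asIso f).symm

@[simp]
lemma cyclesIso_inv_iCycles : W.cyclesIso.inv ≫ W.complex.iCycles 0 = W.η := by
  simp [cyclesIso]

@[simp]
lemma cyclesIso_hom_η : W.cyclesIso.hom ≫ W.η = W.complex.iCycles 0 := by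
  rw [← cyclesIso_inv_iCycles, Iso.hom_inv_id_assoc]

@[simp]
lemma toCycles_cyclesIso_hom : W.complex.toCycles (-1) 0 ≫ W.cyclesIso.hom = W.ε := by
  rw [← cancel_mono W.cyclesIso.inv, Category.assoc, Iso.hom_inv_id, Category.comp_id,
    ← cancel_mono (W.complex.iCycles 0)]
  simp [W.ε_η]

lemma fibrant_cycles (k : ℤ) (hk : k < 0) : M.fibrant (W.complex.cycles k) := by
  refine M.fibrant.prop_of_iso
    (cyclesIsoKernel (K := W.complex) (i := k) (j := k + 1) (by simp)).symm ?_
  obtain rfl | hj := (show k ≤ -1 by lia).eq_or_lt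
  · have := W.mono_η
    exact M.fibrant.prop_of_iso (kernelIsoOfCompMono _ _ W.ε_η).symm W.fibrant_kernel_ε
  · exact W.fibrant_kernel_d k (by lia)

lemma cofibrant_cycles (k : ℤ) (hk : 0 < k) : M.cofibrant (W.complex.cycles k) := by
  -- Cycles in degree `j + 2` are opcycles in degree `j + 1`, that is, the cokernel of the
  -- differential out of degree `j`. The boundary case `j = -1` gives `cokernel η`.
  obtain ⟨j, rfl⟩ : ∃ j, k = j + 1 + 1 := ⟨k - 2, by lia⟩
  have e := (opcyclesIsoCycles (i := j + 1) (j := j + 1 + 1) (k := j + 1 + 1 + 1) W.acyclic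
    (by simp) (by simp)).symm ≪≫
      opcyclesIsoCokernel (K := W.complex) (i := j) (j := j + 1) (by simp)
  refine M.cofibrant.prop_of_iso e.symm ?_
  obtain rfl | hj := (show -1 ≤ j by lia).eq_or_lt
  · have := W.epi_ε
    exact M.cofibrant.prop_of_iso (cokernelIsoOfEpiComp _ _ W.ε_η).symm W.cofibrant_cokernel_η
  · exact W.cofibrant_cokernel_d j (by lia)

/-- The short exact sequences of an `M`-coresolution. -/
def tower : M.SplicedTower where
  Z n := W.complex.cycles n
  P n := W.complex.X n
  i n := W.complex.iCycles n
  p n := W.complex.toCycles n (n + 1)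
  i_p n := iCycles_toCycles _ _
  shortExact n := shortExact_cycles W.acyclic (by simp)
  base := A
  iso := W.cyclesIso
  trivCofibrant_P n hn := W.trivCofibrant_X _ (by lia)
  fibrant_Z n hn := W.fibrant_cycles _ (by lia)
  trivFibrant_P n hn := W.trivFibrant_X _ (by lia)
  cofibrant_Z n hn := W.cofibrant_cycles _ (by lia)

variable {W} {A' : C} {W' : M.Coresolution A'}

lemma IsLift.tower {f : A ⟶ A'} {φ : W.complex ⟶ W'.complex} (h : W.IsLift W' f φ) :
    SplicedTower.IsLift W.tower W'.tower f (fun n ↦ HomologicalComplex.cyclesMap φ n) where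
  isHom n := ⟨{ τ₁ := HomologicalComplex.cyclesMap φ n
                τ₂ := φ.f n
                τ₃ := HomologicalComplex.cyclesMap φ (n + 1)
                comm₁₂ := HomologicalComplex.cyclesMap_i φ _
                comm₂₃ := by
                  change φ.f n ≫ W'.complex.toCycles _ _ = W.complex.toCycles _ _ ≫
                    HomologicalComplex.cyclesMap φ (n + 1)
                  rw [← cancel_mono (W'.complex.iCycles _)]
                  simp }, rfl, rfl⟩
  comm := by
    change HomologicalComplex.cyclesMap φ 0 ≫ W'.cyclesIso.hom = W.cyclesIso.hom ≫ f
    have := W'.mono_η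
    rw [← cancel_mono W'.η]
    simp [← h.2, reassoc_of% W.cyclesIso_hom_η]

variable (W W') in
lemma exists_isLift (f : A ⟶ A') : ∃ φ, W.IsLift W' f φ := by
  obtain ⟨z, hz⟩ : ∃ z : ∀ n, W.complex.cycles n ⟶ W'.complex.cycles n,
      SplicedTower.IsLift W.tower W'.tower f z := SplicedTower.exists_isLift W.tower W'.tower f
  have h (n : ℤ) : ∃ g : W.complex.X n ⟶ W'.complex.X n,
      W.complex.iCycles n ≫ g = z n ≫ W'.complex.iCycles n ∧
      g ≫ W'.complex.toCycles n (n + 1) = W.complex.toCycles n (n + 1) ≫ z (n + 1) := by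
    obtain ⟨φ, h₁, h₃⟩ := hz.isHom n
    rw [← h₁, ← h₃]
    exact ⟨φ.τ₂, φ.comm₁₂.symm, φ.comm₂₃⟩
  choose g hg hg' using h
  have h₀ : z 0 ≫ W'.cyclesIso.hom = W.cyclesIso.hom ≫ f := hz.comm
  refine ⟨{ f := g, comm' := ?_ }, ?_, ?_⟩
  · rintro n _ rfl
    rw [← W.complex.toCycles_i, ← W'.complex.toCycles_i, reassoc_of% hg', Category.assoc, hg]
  · have := hg' (-1)
    rw [neg_add_cancel] at this
    dsimp
    rw [← W'.toCycles_cyclesIso_hom, ← W.toCycles_cyclesIso_hom, Category.assoc, ← h₀,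
      reassoc_of% this]
  · dsimp
    rw [← cancel_epi W.cyclesIso.hom, reassoc_of% W.cyclesIso_hom_η, hg, ← reassoc_of% h₀,
      cyclesIso_hom_η]

end Coresolution

end AbelianModelStructure

end HoExt

end

noncomputable section

namespace HoExt

variable {C : Type u} [Category.{v} C] [Abelian C]

/-! ### Existence of `M`-resolutions and `M`-coresolutions -/

/-- Exactness in the middle is insensitive to precomposing the first map with an epimorphism and
postcomposing the second with a monomorphism. -/
lemma exact_splice {P₀ K P Z P₁ : C} (p₀ : P₀ ⟶ K) [Epi p₀] {i : K ⟶ P} {p : P ⟶ Z} {w : i ≫ p = 0}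
    (h : (ShortComplex.mk i p w).Exact) (i₁ : Z ⟶ P₁) [Mono i₁] :
    (ShortComplex.mk (p₀ ≫ i) (p ≫ i₁) (by simp [reassoc_of% w])).Exact := by
  have h₁ : (ShortComplex.mk (p₀ ≫ i) p (by simp [w])).Exact :=
    (ShortComplex.exact_iff_of_epi_of_isIso_of_mono
      (S₁ := ShortComplex.mk (p₀ ≫ i) p (by simp [w])) (S₂ := ShortComplex.mk i p w)
      { τ₁ := p₀, τ₂ := 𝟙 _, τ₃ := 𝟙 _ }).2 h
  exact (ShortComplex.exact_iff_of_epi_of_isIso_of_mono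
    (S₁ := ShortComplex.mk (p₀ ≫ i) p (by simp [w]))
    (S₂ := ShortComplex.mk (p₀ ≫ i) (p ≫ i₁) (by simp [reassoc_of% w]))
    { τ₁ := 𝟙 _, τ₂ := 𝟙 _, τ₃ := i₁ }).1 h₁

/-- The subobject in a short exact sequence as a kernel. -/
def kernelIsoOfShortExact {K P Z : C} {i : K ⟶ P} {p : P ⟶ Z} {w : i ≫ p = 0}
    (h : (ShortComplex.mk i p w).ShortExact) : kernel p ≅ K :=
  (limit.isLimit _).conePointUniqueUpToIso h.fIsKernel

/-- The quotient in a short exact sequence as a cokernel. -/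
def cokernelIsoOfShortExact {K P Z : C} {i : K ⟶ P} {p : P ⟶ Z} {w : i ≫ p = 0}
    (h : (ShortComplex.mk i p w).ShortExact) : cokernel i ≅ Z :=
  (colimit.isColimit _).coconePointUniqueUpToIso h.gIsCokernel

namespace AbelianModelStructure

variable (M : AbelianModelStructure C)

/-- Completeness of each pair is used in one direction: to the right, embed into a trivially fibrant
object with cofibrant cokernel; to the left, cover by a trivially cofibrant object with fibrant
kernel. -/
lemma exists_splicing (A : C) : ∃ Z : ℤ → C, Z 0 = A ∧ ∀ n,
    ∃ (P : C) (i : Z n ⟶ P) (p : P ⟶ Z (n + 1)) (w : i ≫ p = 0),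
      (ShortComplex.mk i p w).ShortExact ∧ (n < 0 → M.trivCofibrant P ∧ M.fibrant (Z n)) ∧
        (0 ≤ n → M.trivFibrant P ∧ M.cofibrant (Z (n + 1))) := by
  refine exists_int_family (X := fun _ ↦ C) (fun n K Z ↦ ∃ (P : C) (i : K ⟶ P) (p : P ⟶ Z)
    (w : i ≫ p = 0), (ShortComplex.mk i p w).ShortExact ∧
      (n < 0 → M.trivCofibrant P ∧ M.fibrant K) ∧ (0 ≤ n → M.trivFibrant P ∧ M.cofibrant Z)) A
    (fun n hn K ↦ ?_) (fun n hn Z ↦ ?_)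
  · obtain ⟨P, i, _, hP, hi⟩ := M.left_pair.enough_injectives K
    exact ⟨cokernel i, P, i, cokernel.π i, cokernel.condition i, shortExact_of_mono i, by lia,
      fun _ ↦ ⟨hP, hi⟩⟩
  · obtain ⟨P, p, _, hP, hp⟩ := M.right_pair.enough_projectives Z
    exact ⟨kernel p, P, kernel.ι p, p, kernel.condition p, shortExact_of_epi p,
      fun _ ↦ ⟨hP, hp⟩, by lia⟩

lemma nonempty_coresolution (A : C) : Nonempty (M.Coresolution A) := by
  obtain ⟨Z, rfl, h⟩ := M.exists_splicing A
  choose P i p w hS hneg hpos using h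
  have hi (n : ℤ) : Mono (i n) := (hS n).mono_f
  have hp (n : ℤ) : Epi (p n) := (hS n).epi_g
  let K : CochainComplex C ℤ := CochainComplex.of P (fun n ↦ p n ≫ i (n + 1))
    (fun n ↦ by simp [reassoc_of% (w (n + 1))])
  have hd (n : ℤ) : K.d n (n + 1) = p n ≫ i (n + 1) :=
    CochainComplex.of_d P (fun n ↦ p n ≫ i (n + 1)) n
  exact ⟨{
    complex := K
    ε := p (-1)
    η := i 0
    ε_η := (hd (-1)).symm
    epi_ε := hp (-1)
    mono_η := hi 0
    acyclic := fun n ↦ by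
      obtain ⟨n, rfl⟩ : ∃ m, n = m + 1 := ⟨n - 1, by lia⟩
      rw [HomologicalComplex.exactAt_iff' K n (n + 1) (n + 1 + 1) (by simp) (by simp)]
      have h := exact_splice (p n) (hS (n + 1)).exact (i (n + 1 + 1))
      simp only [← hd] at h
      exact h
    trivCofibrant_X := fun n hn ↦ (hneg n (by lia)).1
    fibrant_kernel_ε := M.fibrant.prop_of_iso (kernelIsoOfShortExact (hS (-1))).symm
      (hneg (-1) (by lia)).2
    fibrant_kernel_d := fun n hn ↦ M.fibrant.prop_of_iso
      (kernelIsoOfCompMono _ _ (hd n).symm ≪≫ kernelIsoOfShortExact (hS n)).symm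
      (hneg n (by lia)).2
    trivFibrant_X := fun n hn ↦ (hpos n hn).1
    cofibrant_cokernel_η := M.cofibrant.prop_of_iso (cokernelIsoOfShortExact (hS 0)).symm
      (hpos 0 (by lia)).2
    cofibrant_cokernel_d := fun n hn ↦ M.cofibrant.prop_of_iso
      (cokernelIsoOfEpiComp _ _ (hd n).symm ≪≫ cokernelIsoOfShortExact (hS (n + 1))).symm
      (hpos (n + 1) (by lia)).2 }⟩

lemma nonempty_resolution (A : C) : Nonempty (M.Resolution A) := by
  obtain ⟨Z, rfl, h⟩ := M.exists_splicing A
  -- Reverse the indexing, so that the short exact sequences follow homological degrees.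
  obtain ⟨Y, hY, h⟩ : ∃ Y : ℤ → C, Y 0 = Z 0 ∧ ∀ n, ∃ (P : C) (i : Y (n + 1) ⟶ P) (p : P ⟶ Y n)
      (w : i ≫ p = 0), (ShortComplex.mk i p w).ShortExact ∧
        (0 ≤ n → M.trivCofibrant P ∧ M.fibrant (Y (n + 1))) ∧
        (n < 0 → M.trivFibrant P ∧ M.cofibrant (Y n)) := by
    refine ⟨fun n ↦ Z (-n), rfl, fun n ↦ ?_⟩
    have := h (-(n + 1))
    rw [show -(n + 1) + 1 = -n by lia] at this
    obtain ⟨P, i, p, w, hS, hneg, hpos⟩ := this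
    exact ⟨P, i, p, w, hS, fun hn ↦ hneg (by lia), fun hn ↦ hpos (by lia)⟩
  rw [← hY]
  choose P i p w hS hpos hneg using h
  have hi (n : ℤ) : Mono (i n) := (hS n).mono_f
  have hp (n : ℤ) : Epi (p n) := (hS n).epi_g
  let K : ChainComplex C ℤ := ChainComplex.of P (fun n ↦ p (n + 1) ≫ i n)
    (fun n ↦ by simp [reassoc_of% (w (n + 1))])
  -- For `m = n - 1` the index `m + 1` equals `n` only propositionally; the existential over `q`
  -- spares a cast.
  have hd (n m : ℤ) (h : m + 1 = n) : ∃ q : P n ⟶ Y (m + 1), Epi q ∧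
      K.d n m = q ≫ i m ∧ Nonempty (kernel q ≅ Y (n + 1)) := by
    subst h
    exact ⟨p (m + 1), hp _, ChainComplex.of_d P (fun n ↦ p (n + 1) ≫ i n) m,
      ⟨kernelIsoOfShortExact (hS (m + 1))⟩⟩
  have hd' (n : ℤ) : K.d (n + 1) n = p (n + 1) ≫ i n :=
    ChainComplex.of_d P (fun n ↦ p (n + 1) ≫ i n) n
  -- `-1 + 1` reduces to `0`, so this map also serves as a morphism out of `Y 0`.
  let i₀ : Y (-1 + 1) ⟶ P (-1) := i (-1)
  have hε : p (-1 + 1) ≫ i₀ = K.d (-1 + 1) (-1) := (hd' (-1)).symm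
  exact ⟨{
    complex := K
    ε := p 0
    η := i₀
    ε_η := hε
    epi_ε := hp 0
    mono_η := hi (-1)
    acyclic := fun n ↦ by
      obtain ⟨n, rfl⟩ : ∃ m, n = m + 1 := ⟨n - 1, by lia⟩
      rw [HomologicalComplex.exactAt_iff' K (n + 1 + 1) (n + 1) n (by simp) (by simp)]
      have h := exact_splice (p (n + 1 + 1)) (hS (n + 1)).exact (i n)
      simp only [← hd'] at h
      exact h
    trivCofibrant_X := fun n hn ↦ (hpos n hn).1
    fibrant_kernel_ε := M.fibrant.prop_of_iso (kernelIsoOfShortExact (hS 0)).symm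
      (hpos 0 (by lia)).2
    fibrant_kernel_d := fun n hn ↦ by
      obtain ⟨q, _, hq, ⟨e⟩⟩ := hd n (n - 1) (by lia)
      exact M.fibrant.prop_of_iso (kernelIsoOfCompMono _ _ hq.symm ≪≫ e).symm
        (hpos n (by lia)).2
    trivFibrant_X := fun n hn ↦ (hneg n (by lia)).1
    cofibrant_cokernel_η := M.cofibrant.prop_of_iso (cokernelIsoOfShortExact (hS (-1))).symm
      (hneg (-1) (by lia)).2
    cofibrant_cokernel_d := fun n hn ↦ by
      obtain ⟨q, _, hq, _⟩ := hd n (n - 1) (by lia)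
      exact M.cofibrant.prop_of_iso
        (cokernelIsoOfEpiComp _ _ hq.symm ≪≫ cokernelIsoOfShortExact (hS (n - 1))).symm
        (hneg (n - 1) (by lia)).2 }⟩

/-! ### Cohomology of Hom complexes in terms of stable morphisms -/

variable {M}

section lExt

variable (W : ChainComplex C ℤ) (n : ℤ) (B : C)

/-- A morphism `opcycles n ⟶ B` defines a cocycle in degree `n` of `Hom(W, B)`. -/
def lExtCocycle : AddCommGrpCat.of (W.opcycles n ⟶ B) ⟶ (homFrom W B).cycles n :=
  (homFrom W B).liftCycles ((preadditiveYoneda.obj B).map (W.pOpcycles n).op) (n + 1)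
    (ComplexShape.next_eq' _ (by simp)) (by
      ext h
      change W.opcycles n ⟶ B at h
      change W.d (n + 1) n ≫ W.pOpcycles n ≫ h = 0
      rw [W.d_pOpcycles_assoc, zero_comp])

lemma lExtCocycle_i : lExtCocycle W n B ≫ (homFrom W B).iCycles n =
    (preadditiveYoneda.obj B).map (W.pOpcycles n).op :=
  HomologicalComplex.liftCycles_i _ _ _ _ _

lemma iCycles_lExtCocycle_apply (h : W.opcycles n ⟶ B) :
    (homFrom W B).iCycles n (lExtCocycle W n B h) = W.pOpcycles n ≫ h :=
  congrArg (fun f ↦ f.hom h) (lExtCocycle_i W n B)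

/-- A morphism `opcycles n ⟶ B` defines a cohomology class in degree `n` of `Hom(W, B)`. -/
def lExtClass : AddCommGrpCat.of (W.opcycles n ⟶ B) ⟶ lExt n W B :=
  lExtCocycle W n B ≫ (homFrom W B).homologyπ n

lemma lExtClass_naturality {W' : ChainComplex C ℤ} {B' : C} (φ : W' ⟶ W) (g : B ⟶ B')
    (h : W.opcycles n ⟶ B) :
    lExt.map n φ g (lExtClass W n B h) =
      lExtClass W' n B' (HomologicalComplex.opcyclesMap φ n ≫ h ≫ g) := by
  have h₁ : HomologicalComplex.cyclesMap (homFromMap φ g) n (lExtCocycle W n B h) =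
      lExtCocycle W' n B' (HomologicalComplex.opcyclesMap φ n ≫ h ≫ g) := by
    apply (AddCommGrpCat.mono_iff_injective ((homFrom W' B').iCycles n)).1 inferInstance
    rw [iCycles_lExtCocycle_apply, ← ConcreteCategory.comp_apply, HomologicalComplex.cyclesMap_i,
      ConcreteCategory.comp_apply, iCycles_lExtCocycle_apply]
    change (φ.f n ≫ W.pOpcycles n ≫ h) ≫ g = _
    simp
  rw [lExtClass, lExtClass, ConcreteCategory.comp_apply, ConcreteCategory.comp_apply, ← h₁,
    ← ConcreteCategory.comp_apply, ← ConcreteCategory.comp_apply,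
    HomologicalComplex.homologyπ_naturality]
  rfl

/-- A cocycle is a morphism `W.X n ⟶ B` killed by the incoming differential, so it descends to
opcycles. -/
lemma lExtClass_surjective : Function.Surjective (lExtClass W n B) := by
  intro x
  obtain ⟨c, rfl⟩ := (AddCommGrpCat.epi_iff_surjective ((homFrom W B).homologyπ n)).1
    inferInstance x
  let b : W.X n ⟶ B := (homFrom W B).iCycles n c
  have hb : W.d (n + 1) n ≫ b = 0 := by
    have := (homFrom W B).iCycles_d n (n + 1)
    exact congrArg (fun f ↦ f.hom c) this
  refine ⟨W.descOpcycles b (n + 1) (by simp) hb, ?_⟩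
  rw [lExtClass, ConcreteCategory.comp_apply]
  congr 1
  apply (AddCommGrpCat.mono_iff_injective ((homFrom W B).iCycles n)).1 inferInstance
  rw [iCycles_lExtCocycle_apply]
  exact W.p_descOpcycles b (n + 1) (by simp) hb

/-- Coboundaries are composites with `W.d n j`, which factors through the opcycles; cancelling the
projection leaves an extension problem along `fromOpcycles`. -/
lemma lExtClass_eq_zero_iff {j : ℤ} (hj : j + 1 = n) (h : W.opcycles n ⟶ B) :
    lExtClass W n B h = 0 ↔ ∃ b : W.X j ⟶ B, W.fromOpcycles n j ≫ b = h := by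
  have hS : (ShortComplex.mk _ _ ((homFrom W B).toCycles_comp_homologyπ j n)).Exact :=
    ShortComplex.exact_of_g_is_cokernel _ ((homFrom W B).homologyIsCokernel j n
      (ComplexShape.prev_eq' _ (by simpa using hj)))
  rw [ShortComplex.ab_exact_iff_function_exact] at hS
  refine (hS (lExtCocycle W n B h)).trans (exists_congr fun (b : W.X j ⟶ B) ↦ ?_)
  rw [← ((AddCommGrpCat.mono_iff_injective ((homFrom W B).iCycles n)).1 inferInstance).eq_iff,
    iCycles_lExtCocycle_apply, ← cancel_epi (W.pOpcycles n)]
  have hb : (homFrom W B).iCycles n ((homFrom W B).toCycles j n b) = W.d n j ≫ b :=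
    congrArg (fun f ↦ f.hom b) ((homFrom W B).toCycles_i j n)
  refine (Eq.congr_left hb).trans ?_
  rw [W.p_fromOpcycles_assoc]
  exact Iff.rfl

end lExt

section rExt

variable (A : C) (W : CochainComplex C ℤ) (n : ℤ)

/-- A morphism `A ⟶ cycles n` defines a cocycle in degree `n` of `Hom(A, W)`. -/
def rExtCocycle : AddCommGrpCat.of (A ⟶ W.cycles n) ⟶ (homTo A W).cycles n :=
  (homTo A W).liftCycles ((preadditiveCoyoneda.obj (op A)).map (W.iCycles n)) (n + 1)
    (ComplexShape.next_eq' _ (by simp)) (by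
      change (preadditiveCoyoneda.obj (op A)).map _ ≫ (preadditiveCoyoneda.obj (op A)).map _ = 0
      rw [← Functor.map_comp]
      simp)

lemma rExtCocycle_i : rExtCocycle A W n ≫ (homTo A W).iCycles n =
    (preadditiveCoyoneda.obj (op A)).map (W.iCycles n) :=
  HomologicalComplex.liftCycles_i _ _ _ _ _

lemma iCycles_rExtCocycle_apply (h : A ⟶ W.cycles n) :
    (homTo A W).iCycles n (rExtCocycle A W n h) = h ≫ W.iCycles n :=
  congrArg (fun f ↦ f.hom h) (rExtCocycle_i A W n)

/-- A morphism `A ⟶ cycles n` defines a cohomology class in degree `n` of `Hom(A, W)`. -/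
def rExtClass : AddCommGrpCat.of (A ⟶ W.cycles n) ⟶ rExt n A W :=
  rExtCocycle A W n ≫ (homTo A W).homologyπ n

lemma rExtClass_naturality {A' : C} {W' : CochainComplex C ℤ} (f : A' ⟶ A) (φ : W ⟶ W')
    (h : A ⟶ W.cycles n) :
    rExt.map n f φ (rExtClass A W n h) =
      rExtClass A' W' n ((f ≫ h) ≫ HomologicalComplex.cyclesMap φ n) := by
  have h₁ : HomologicalComplex.cyclesMap (homToMap f φ) n (rExtCocycle A W n h) =
      rExtCocycle A' W' n ((f ≫ h) ≫ HomologicalComplex.cyclesMap φ n) := by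
    apply (AddCommGrpCat.mono_iff_injective ((homTo A' W').iCycles n)).1 inferInstance
    rw [iCycles_rExtCocycle_apply, ← ConcreteCategory.comp_apply, HomologicalComplex.cyclesMap_i,
      ConcreteCategory.comp_apply, iCycles_rExtCocycle_apply]
    change f ≫ (h ≫ W.iCycles n) ≫ φ.f n = _
    simp
  rw [rExtClass, rExtClass, ConcreteCategory.comp_apply, ConcreteCategory.comp_apply, ← h₁,
    ← ConcreteCategory.comp_apply, ← ConcreteCategory.comp_apply,
    HomologicalComplex.homologyπ_naturality]
  rfl

lemma rExtClass_surjective : Function.Surjective (rExtClass A W n) := by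
  intro x
  obtain ⟨c, rfl⟩ := (AddCommGrpCat.epi_iff_surjective ((homTo A W).homologyπ n)).1
    inferInstance x
  let b : A ⟶ W.X n := (homTo A W).iCycles n c
  have hb : b ≫ W.d n (n + 1) = 0 := by
    have := (homTo A W).iCycles_d n (n + 1)
    exact congrArg (fun f ↦ f.hom c) this
  refine ⟨W.liftCycles b (n + 1) (by simp) hb, ?_⟩
  rw [rExtClass, ConcreteCategory.comp_apply]
  congr 1
  apply (AddCommGrpCat.mono_iff_injective ((homTo A W).iCycles n)).1 inferInstance
  rw [iCycles_rExtCocycle_apply]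
  exact W.liftCycles_i b (n + 1) (by simp) hb

lemma rExtClass_eq_zero_iff {j : ℤ} (hj : j + 1 = n) (h : A ⟶ W.cycles n) :
    rExtClass A W n h = 0 ↔ ∃ b : A ⟶ W.X j, b ≫ W.toCycles j n = h := by
  have hS : (ShortComplex.mk _ _ ((homTo A W).toCycles_comp_homologyπ j n)).Exact :=
    ShortComplex.exact_of_g_is_cokernel _ ((homTo A W).homologyIsCokernel j n
      (ComplexShape.prev_eq' _ (by simpa using hj)))
  rw [ShortComplex.ab_exact_iff_function_exact] at hS
  refine (hS (rExtCocycle A W n h)).trans (exists_congr fun (b : A ⟶ W.X j) ↦ ?_)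
  rw [← ((AddCommGrpCat.mono_iff_injective ((homTo A W).iCycles n)).1 inferInstance).eq_iff,
    iCycles_rExtCocycle_apply, ← cancel_mono (W.iCycles n)]
  have hb : (homTo A W).iCycles n ((homTo A W).toCycles j n b) = b ≫ W.d j n :=
    congrArg (fun f ↦ f.hom b) ((homTo A W).toCycles_i j n)
  refine (Eq.congr_left hb).trans ?_
  rw [Category.assoc, W.toCycles_i]
  exact Iff.rfl

end rExt

end AbelianModelStructure

end HoExt

end

/-! ### Cohomology of Hom complexes as natural groups of stable morphisms -/

noncomputable section

namespace HoExt

section Bifunctor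

variable {D₁ D₂ E : Type*} [Category* D₁] [Category* D₂] [Category* E]

/-- The action of a bifunctor on morphisms in both variables. -/
def biMap (F : D₁ᵒᵖ ⥤ D₂ ⥤ E) {X X' : D₁} {Y Y' : D₂} (f : X' ⟶ X) (g : Y ⟶ Y') :
    (F.obj (op X)).obj Y ⟶ (F.obj (op X')).obj Y' :=
  (F.map f.op).app Y ≫ (F.obj (op X')).map g

lemma biMap_comp (F : D₁ᵒᵖ ⥤ D₂ ⥤ E) {X X' X'' : D₁} {Y Y' Y'' : D₂} (f : X' ⟶ X) (g : Y ⟶ Y')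
    (f' : X'' ⟶ X') (g' : Y' ⟶ Y'') :
    biMap F f g ≫ biMap F f' g' = biMap F (f' ≫ f) (g ≫ g') := by
  simp [biMap]

lemma biMap_naturality {F G : D₁ᵒᵖ ⥤ D₂ ⥤ E} (α : F ⟶ G) {X X' : D₁} {Y Y' : D₂} (f : X' ⟶ X)
    (g : Y ⟶ Y') :
    biMap F f g ≫ (α.app (op X')).app Y' = (α.app (op X)).app Y ≫ biMap G f g := by
  have := NatTrans.congr_app (α.naturality f.op) Y
  simp only [NatTrans.comp_app] at this
  simp [biMap, reassoc_of% this]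

end Bifunctor

variable {C : Type u} [Category.{v} C] [Abelian C]

namespace AbelianModelStructure

variable {M : AbelianModelStructure C}

open SplicedTower

/-- A morphism extending over the next term factors through a trivially cofibrant object into the
fibrant `B`, hence is stably zero. Conversely, a morphism through the core extends because the next
opcycles object is cofibrant. -/
lemma exists_lExtEquiv (hM : M.IsHereditary) {A B : C} (W : M.Resolution A)
    (hA : M.cofibrant A) (hB : M.fibrant B) (n m : ℤ) (h : n = -m) :
    ∃ e : lExt n W.complex B ≃+ (M.stable.obj (W.complex.opcycles n) ⟶ M.stable.obj B),
      ∀ h, e (lExtClass W.complex n B h) = M.stable.map h := by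
  subst h
  refine exists_addEquiv_of_surjective (lExtClass W.complex (-m) B).hom
    (M.stable.mapAddHom (X := W.complex.opcycles (-m)) (Y := B))
    (lExtClass_surjective _ _ _) M.stable.map_surjective fun h ↦ ?_
  refine (lExtClass_eq_zero_iff W.complex (-m) B (j := -(m + 1)) (by lia) h).trans ?_
  refine Iff.trans ?_ (stable_map_eq_zero_iff h).symm
  constructor
  · rintro ⟨b, rfl⟩
    exact stablyZero_of_trivCofibrant (W.tower.isLeft hM hA m).1 hB _ _
  · intro h
    exact h.exists_extension (W.tower.shortExact m) (W.tower.isLeft hM hA (m + 1)).2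

/-- Dually, coboundaries factor through the trivially fibrant term in the preceding degree, and
stably zero morphisms lift to it because the preceding cycles are fibrant. -/
lemma exists_rExtEquiv (hM : M.IsHereditary) {A B : C} (V : M.Coresolution B)
    (hA : M.cofibrant A) (hB : M.fibrant B) (n : ℤ) :
    ∃ e : rExt n A V.complex ≃+ (M.stable.obj A ⟶ M.stable.obj (V.complex.cycles n)),
      ∀ h, e (rExtClass A V.complex n h) = M.stable.map h := by
  obtain ⟨n, rfl⟩ : ∃ m, n = m + 1 := ⟨n - 1, by lia⟩
  refine exists_addEquiv_of_surjective (rExtClass A V.complex (n + 1)).hom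
    (M.stable.mapAddHom (X := A) (Y := V.complex.cycles (n + 1)))
    (rExtClass_surjective _ _ _) M.stable.map_surjective fun h ↦ ?_
  refine (rExtClass_eq_zero_iff A V.complex (n + 1) rfl h).trans ?_
  refine Iff.trans ?_ (stable_map_eq_zero_iff h).symm
  constructor
  · rintro ⟨b, rfl⟩
    exact stablyZero_of_trivFibrant hA (V.tower.isRight hM hB n).1 _ _
  · intro h
    exact h.exists_lift (V.tower.shortExact n) (V.tower.isRight hM hB n).2

section

variable (hM : M.IsHereditary)

/-- The left tower of an `M`-resolution of a cofibrant object. -/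
def leftObj {A : C} (W : M.Resolution A) (hA : M.cofibrant A) : Left M :=
  (⟨W.tower, W.tower.isLeft hM hA⟩ : {T : M.SplicedTower // T.IsLeft})

/-- The right tower of an `M`-coresolution of a fibrant object. -/
def rightObj {B : C} (V : M.Coresolution B) (hB : M.fibrant B) : Right M :=
  (⟨V.tower, V.tower.isRight hM hB⟩ : {T : M.SplicedTower // T.IsRight})

/-- A stable morphism, as a morphism of left towers. -/
def leftHom {A A' : C} {W : M.Resolution A} {hA : M.cofibrant A} {W' : M.Resolution A'}
    {hA' : M.cofibrant A'} (x : M.stable.obj A ⟶ M.stable.obj A') :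
    leftObj hM W hA ⟶ leftObj hM W' hA' :=
  InducedCategory.homMk x

/-- A stable morphism, as a morphism of right towers. -/
def rightHom {B B' : C} {V : M.Coresolution B} {hB : M.fibrant B} {V' : M.Coresolution B'}
    {hB' : M.fibrant B'} (y : M.stable.obj B ⟶ M.stable.obj B') :
    rightObj hM V hB ⟶ rightObj hM V' hB' :=
  InducedCategory.homMk y

/-- The bifunctor `(T, U) ↦ Hom(Z m(T), U)`. -/
abbrev leftBif (M : AbelianModelStructure C) (m : ℤ) : (Left M)ᵒᵖ ⥤ Right M ⥤ AddCommGrpCat.{v} :=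
  homBifunctor (leftZ M m) (rightBase M)

/-- The bifunctor `(T, U) ↦ Hom(T, Z n(U))`. -/
abbrev rightBif (M : AbelianModelStructure C) (n : ℤ) : (Left M)ᵒᵖ ⥤ Right M ⥤ AddCommGrpCat.{v} :=
  homBifunctor (leftBase M) (rightZ M n)

/-- `Hⁿ[Hom(W, B)]` in terms of stable morphisms. -/
def lExtIso {A B : C} (W : M.Resolution A) (hA : M.cofibrant A) (V : M.Coresolution B)
    (hB : M.fibrant B) (m : ℤ) :
    lExt (-m) W.complex B ≅
      ((leftBif M m).obj (op (leftObj hM W hA))).obj (rightObj hM V hB) :=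
  AddEquiv.toAddCommGrpIso (exists_lExtEquiv hM W hA hB (-m) m rfl).choose

/-- A chain map extending `f` acts on opcycles by a representative of the stable action of `f` on `Z
m`. The coresolutions `V` and `V'` only serve to regard `B` and `B'` as objects of `Right M`. -/
lemma lExtIso_naturality {A B A' B' : C} (W : M.Resolution A) (hA : M.cofibrant A)
    (V : M.Coresolution B) (hB : M.fibrant B) (W' : M.Resolution A') (hA' : M.cofibrant A')
    (V' : M.Coresolution B') (hB' : M.fibrant B') (m : ℤ) {f : A' ⟶ A} (g : B ⟶ B')
    {φ : W'.complex ⟶ W.complex} (hφ : W'.IsLift W f φ) :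
    lExt.map (-m) φ g ≫ (lExtIso hM W' hA' V' hB' m).hom = (lExtIso hM W hA V hB m).hom ≫
      biMap (leftBif M m) (leftHom hM (M.stable.map f)) (rightHom hM (M.stable.map g)) := by
  ext x
  obtain ⟨h, rfl⟩ := lExtClass_surjective _ _ _ x
  have h₁ := (exists_lExtEquiv hM W hA hB (-m) m rfl).choose_spec h
  have h₂ := (exists_lExtEquiv hM W' hA' hB' (-m) m rfl).choose_spec
    (HomologicalComplex.opcyclesMap φ (-m) ≫ h ≫ g)
  have h₃ : (leftZ M m).map (leftHom hM (W := W') (hA := hA') (W' := W) (hA' := hA)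
      (M.stable.map f)) = M.stable.map (HomologicalComplex.opcyclesMap φ (-m)) :=
    functor_map (t := Subtype.val) (leftHom hM (W := W') (hA := hA') (W' := W) (hA' := hA)
      (M.stable.map f)) rfl hφ.tower m
  refine (congrArg (lExtIso hM W' hA' V' hB' m).hom
    (lExtClass_naturality W.complex (-m) B φ g h)).trans (h₂.trans ?_)
  refine Eq.trans ?_ (congrArg (biMap (leftBif M m) (leftHom hM (M.stable.map f))
    (rightHom hM (M.stable.map g))) h₁.symm)
  change W.complex.opcycles (-m) ⟶ B at h
  refine Eq.trans ?_ (congrArg (fun (t : M.stable.obj (W'.complex.opcycles (-m)) ⟶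
    M.stable.obj (W.complex.opcycles (-m))) ↦ (t ≫ M.stable.map h) ≫ M.stable.map g) h₃.symm)
  simp

/-- `Hⁿ[Hom(A, V)]` in terms of stable morphisms. -/
def rExtIso {A B : C} (W : M.Resolution A) (hA : M.cofibrant A) (V : M.Coresolution B)
    (hB : M.fibrant B) (n : ℤ) :
    rExt n A V.complex ≅ ((rightBif M n).obj (op (leftObj hM W hA))).obj (rightObj hM V hB) :=
  AddEquiv.toAddCommGrpIso (exists_rExtEquiv hM V hA hB n).choose

lemma rExtIso_naturality {A B A' B' : C} (W : M.Resolution A) (hA : M.cofibrant A)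
    (V : M.Coresolution B) (hB : M.fibrant B) (W' : M.Resolution A') (hA' : M.cofibrant A')
    (V' : M.Coresolution B') (hB' : M.fibrant B') (n : ℤ) (f : A' ⟶ A) {g : B ⟶ B'}
    {φ : V.complex ⟶ V'.complex} (hφ : V.IsLift V' g φ) :
    rExt.map n f φ ≫ (rExtIso hM W' hA' V' hB' n).hom = (rExtIso hM W hA V hB n).hom ≫
      biMap (rightBif M n) (leftHom hM (M.stable.map f)) (rightHom hM (M.stable.map g)) := by
  ext x
  obtain ⟨h, rfl⟩ := rExtClass_surjective _ _ _ x
  have h₁ := (exists_rExtEquiv hM V hA hB n).choose_spec h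
  have h₂ := (exists_rExtEquiv hM V' hA' hB' n).choose_spec
    ((f ≫ h) ≫ HomologicalComplex.cyclesMap φ n)
  have h₃ : (rightZ M n).map (rightHom hM (V := V) (hB := hB) (V' := V') (hB' := hB')
      (M.stable.map g)) = M.stable.map (HomologicalComplex.cyclesMap φ n) :=
    functor_map (t := Subtype.val) (rightHom hM (V := V) (hB := hB) (V' := V') (hB' := hB')
      (M.stable.map g)) rfl hφ.tower n
  refine (congrArg (rExtIso hM W' hA' V' hB' n).hom
    (rExtClass_naturality A V.complex n f φ h)).trans (h₂.trans ?_)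
  refine Eq.trans ?_ (congrArg (biMap (rightBif M n) (leftHom hM (M.stable.map f))
    (rightHom hM (M.stable.map g))) h₁.symm)
  change A ⟶ V.complex.cycles n at h
  refine Eq.trans ?_ (congrArg (fun (t : M.stable.obj (V.complex.cycles n) ⟶
    M.stable.obj (V'.complex.cycles n)) ↦ (M.stable.map f ≫ M.stable.map h) ≫ t) h₃.symm)
  simp

/-- `Hⁿ[Hom(W, B)]` as a value of `rightBif`. -/
def lExtIsoRight {A B : C} (W : M.Resolution A) (hA : M.cofibrant A) (V : M.Coresolution B)
    (hB : M.fibrant B) (m n : ℤ) (h : n = -m) :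
    lExt n W.complex B ≅ ((rightBif M n).obj (op (leftObj hM W hA))).obj (rightObj hM V hB) :=
  eqToIso (by rw [h]) ≪≫ lExtIso hM W hA V hB m ≪≫ ((balanceIso M m n h).app _).app _

lemma lExtIsoRight_naturality {A B A' B' : C} (W : M.Resolution A) (hA : M.cofibrant A)
    (V : M.Coresolution B) (hB : M.fibrant B) (W' : M.Resolution A') (hA' : M.cofibrant A')
    (V' : M.Coresolution B') (hB' : M.fibrant B') (m n : ℤ) (h : n = -m) {f : A' ⟶ A} (g : B ⟶ B')
    {φ : W'.complex ⟶ W.complex} (hφ : W'.IsLift W f φ) :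
    lExt.map n φ g ≫ (lExtIsoRight hM W' hA' V' hB' m n h).hom =
      (lExtIsoRight hM W hA V hB m n h).hom ≫
        biMap (rightBif M n) (leftHom hM (M.stable.map f)) (rightHom hM (M.stable.map g)) := by
  subst h
  have h₁ := lExtIso_naturality hM W hA V hB W' hA' V' hB' m g hφ
  have h₂ := biMap_naturality (balanceIso M m (-m) rfl).hom
    (leftHom hM (W := W') (hA := hA') (W' := W) (hA' := hA) (M.stable.map f))
    (rightHom hM (V := V) (hB := hB) (V' := V') (hB' := hB') (M.stable.map g))
  simp only [lExtIsoRight, eqToIso_refl, Iso.refl_trans, Iso.trans_hom, Iso.app_hom,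
    Category.assoc]
  rw [reassoc_of% h₁, h₂]

end

end AbelianModelStructure

end HoExt

end

noncomputable section

namespace HoExt

variable {C : Type u} [Category.{v} C] [Abelian C]

namespace AbelianModelStructure

variable {M : AbelianModelStructure C}

open SplicedTower

/-! ### Stable morphisms which become invertible in the homotopy category -/

/-- Stable morphisms which are inverted by `Hom(-, Y)` for `Y` fibrant. -/
def IsLeftWeq {X X' : M.Stable} (κ : X ⟶ X') : Prop :=
  ∀ Y : C, M.fibrant Y → Function.Bijective (fun w : X' ⟶ M.stable.obj Y ↦ κ ≫ w)

/-- Stable morphisms which are inverted by `Hom(X, -)` for `X` cofibrant. -/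
def IsRightWeq {Y Y' : M.Stable} (κ : Y ⟶ Y') : Prop :=
  ∀ X : C, M.cofibrant X → Function.Bijective (fun w : M.stable.obj X ⟶ Y ↦ w ≫ κ)

lemma isLeftWeq_of_isIso {X X' : M.Stable} (κ : X ⟶ X') [IsIso κ] : IsLeftWeq κ :=
  fun _ _ ↦ ⟨fun _ _ h ↦ (cancel_epi κ).1 h, fun w ↦ ⟨inv κ ≫ w, by simp⟩⟩

lemma isRightWeq_of_isIso {X X' : M.Stable} (κ : X ⟶ X') [IsIso κ] : IsRightWeq κ :=
  fun _ _ ↦ ⟨fun _ _ h ↦ (cancel_mono κ).1 h, fun w ↦ ⟨w ≫ inv κ, by simp⟩⟩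

lemma IsLeftWeq.comp {X X' X'' : M.Stable} {κ : X ⟶ X'} {κ' : X' ⟶ X''} (h : IsLeftWeq κ)
    (h' : IsLeftWeq κ') : IsLeftWeq (κ ≫ κ') := fun Y hY ↦ by
  simp only [Category.assoc]
  exact (h Y hY).comp (h' Y hY)

lemma IsRightWeq.comp {X X' X'' : M.Stable} {κ : X ⟶ X'} {κ' : X' ⟶ X''} (h : IsRightWeq κ)
    (h' : IsRightWeq κ') : IsRightWeq (κ ≫ κ') := fun Y hY ↦ by
  simp only [← Category.assoc]
  exact (h' Y hY).comp (h Y hY)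

/-- Each variable is treated in the form of the bifunctor where it occurs without syzygies:
precomposition with `x` meets the fibrant cosyzygies of `U`, postcomposition with `y` meets the
cofibrant syzygies of `L'`. -/
lemma isIso_biMap {L L' : Left M} {U U' : Right M} (x : L' ⟶ L) (y : U ⟶ U')
    (hx : IsLeftWeq x.hom) (hy : IsRightWeq y.hom) (n : ℤ) :
    IsIso (biMap (rightBif M n) x y) := by
  have h₁ : IsIso (((rightBif M n).map x.op).app U) :=
    (ConcreteCategory.isIso_iff_bijective _).2 (hx _ (U.2 n).2)
  -- Here `y` acts through its effect on cosyzygies, about which `hy` says nothing; balance moves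
  -- the shift to `L'`.
  have h₂ : IsIso (((rightBif M n).obj (op L')).map y) :=
    (NatIso.isIso_map_iff ((balanceIso M (-n) n (by simp)).app (op L')) y).1
      ((ConcreteCategory.isIso_iff_bijective _).2 (hy _ (L'.2 (-n)).2))
  exact IsIso.comp_isIso' h₁ h₂

lemma comp_eq_of_squares {D : Type*} [Category* D] {P P' Q Q' R R' : D} {b : P ⟶ P'} {c : P ⟶ Q}
    {c' : P' ⟶ Q'} {d : Q ⟶ Q'} {x : Q ⟶ R} {x' : Q' ⟶ R'} {r : R ⟶ R'} (h : b ≫ c' = c ≫ d)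
    (h' : d ≫ x' = x ≫ r) : b ≫ c' ≫ x' = (c ≫ x) ≫ r := by
  rw [reassoc_of% h, h', Category.assoc]

/-! ### The Ext bifunctor and its computation by models -/

section

variable (hM : M.IsHereditary) (ρ : ∀ A : C, M.BifibrantReplacement A)

lemma BifibrantReplacement.cofibrant_obj {A : C} (P : M.BifibrantReplacement A) :
    M.cofibrant P.obj :=
  have := P.fib.mono_ι
  M.left_cotorsionPair.left_X₂ (shortExact_of_mono P.fib.ι) P.cof.cofibrant_obj
    P.fib.trivCofibrant_cokernel.1

/-- The left tower of the bifibrant replacement. -/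
def leftFunctor : Ho ρ ⥤ Left M where
  obj A := leftObj hM (M.nonempty_resolution (ρ A).obj).some (ρ A).cofibrant_obj
  map x := leftHom hM x.hom
  map_id _ := rfl
  map_comp _ _ := rfl

/-- The right tower of the bifibrant replacement. -/
def rightFunctor : Ho ρ ⥤ Right M where
  obj B := rightObj hM (M.nonempty_coresolution (ρ B).obj).some (ρ B).fib.fibrant_obj
  map y := rightHom hM y.hom
  map_id _ := rfl
  map_comp _ _ := rfl

/-- The bifunctor `Extⁿ` on the homotopy category. -/
def extHo (n : ℤ) : (Ho ρ)ᵒᵖ ⥤ Ho ρ ⥤ AddCommGrpCat.{v} :=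
  (leftFunctor hM ρ).op ⋙ rightBif M n ⋙ (Functor.whiskeringLeft _ _ _).obj (rightFunctor hM ρ)

/-- The bifunctor `(A, B) ↦ Extⁿ(RQA, RQB)`. -/
def ext (n : ℤ) : Cᵒᵖ ⥤ C ⥤ AddCommGrpCat.{v} :=
  (toHo ρ).op ⋙ extHo hM ρ n ⋙ (Functor.whiskeringLeft _ _ _).obj (toHo ρ)

/-- A cofibrant object which is identified with `A` in the homotopy category. -/
structure LeftModel (A : C) where
  obj : C
  cofibrant_obj : M.cofibrant obj
  κ : M.stable.obj obj ⟶ M.stable.obj (ρ A).obj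
  weq : IsLeftWeq κ

/-- A fibrant object which is identified with `B` in the homotopy category. -/
structure RightModel (B : C) where
  obj : C
  fibrant_obj : M.fibrant obj
  κ : M.stable.obj (ρ B).obj ⟶ M.stable.obj obj
  weq : IsRightWeq κ

variable {ρ} {n : ℤ} {E : Cᵒᵖ ⥤ C ⥤ AddCommGrpCat.{v}} (β : E ≅ ext hM ρ n)

/-- `f' : X' ⟶ X` corresponds to `f : A' ⟶ A` in the homotopy category. -/
def LeftModel.IsLift {A A' : C} (X' : LeftModel ρ A') (X : LeftModel ρ A) (f : A' ⟶ A)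
    (f' : X'.obj ⟶ X.obj) : Prop :=
  M.stable.map f' ≫ X.κ = X'.κ ≫ ((toHo ρ).map f).hom

/-- `g' : Y ⟶ Y'` corresponds to `g : B ⟶ B'` in the homotopy category. -/
def RightModel.IsLift {B B' : C} (Y : RightModel ρ B) (Y' : RightModel ρ B') (g : B ⟶ B')
    (g' : Y.obj ⟶ Y'.obj) : Prop :=
  Y.κ ≫ M.stable.map g' = ((toHo ρ).map g).hom ≫ Y'.κ

/-- The morphism of left towers given by a left model. -/
def LeftModel.hom {A : C} (X : LeftModel ρ A) (W : M.Resolution X.obj) :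
    leftObj hM W X.cofibrant_obj ⟶ (leftFunctor hM ρ).obj A :=
  leftHom hM (hA' := (ρ A).cofibrant_obj) X.κ

/-- The morphism of right towers given by a right model. -/
def RightModel.hom {B : C} (Y : RightModel ρ B) (V : M.Coresolution Y.obj) :
    (rightFunctor hM ρ).obj B ⟶ rightObj hM V Y.fibrant_obj :=
  rightHom hM (hB := (ρ B).fib.fibrant_obj) Y.κ

/-- The values of `Extⁿ` in terms of arbitrary models. -/
def compIso {A B : C} (X : LeftModel ρ A) (Y : RightModel ρ B) (W : M.Resolution X.obj)
    (V : M.Coresolution Y.obj) : (E.obj (op A)).obj B ≅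
      ((rightBif M n).obj (op (leftObj hM W X.cofibrant_obj))).obj (rightObj hM V Y.fibrant_obj) :=
  (β.app (op A)).app B ≪≫ @asIso _ _ _ _ (biMap (rightBif M n) (X.hom hM W) (Y.hom hM V))
    (isIso_biMap _ _ X.weq Y.weq n)

lemma compIso_naturality {A B A' B' : C} {X : LeftModel ρ A} {Y : RightModel ρ B}
    (W : M.Resolution X.obj) (V : M.Coresolution Y.obj) {X' : LeftModel ρ A'}
    {Y' : RightModel ρ B'} (W' : M.Resolution X'.obj) (V' : M.Coresolution Y'.obj) {f : A' ⟶ A}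
    {g : B ⟶ B'} {f' : X'.obj ⟶ X.obj} {g' : Y.obj ⟶ Y'.obj} (hf : X'.IsLift X f f')
    (hg : Y.IsLift Y' g g') :
    bifunctorMap E f g ≫ (compIso hM β X' Y' W' V').hom = (compIso hM β X Y W V).hom ≫
      biMap (rightBif M n) (leftHom hM (M.stable.map f')) (rightHom hM (M.stable.map g')) := by
  have hx : X'.hom hM W' ≫ (leftFunctor hM ρ).map ((toHo ρ).map f) =
      leftHom hM (M.stable.map f') ≫ X.hom hM W := by
    ext
    exact hf.symm
  have hy : (rightFunctor hM ρ).map ((toHo ρ).map g) ≫ Y'.hom hM V' =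
      Y.hom hM V ≫ rightHom hM (M.stable.map g') := by
    ext
    exact hg.symm
  have h₁ : biMap E f g ≫ (β.hom.app (op A')).app B' = (β.hom.app (op A)).app B ≫
      biMap (rightBif M n) ((leftFunctor hM ρ).map ((toHo ρ).map f))
        ((rightFunctor hM ρ).map ((toHo ρ).map g)) := biMap_naturality β.hom f g
  change biMap E f g ≫ (β.hom.app (op A')).app B' ≫
      biMap (rightBif M n) (X'.hom hM W') (Y'.hom hM V') =
    ((β.hom.app (op A)).app B ≫
      biMap (rightBif M n) (X.hom hM W) (Y.hom hM V)) ≫ _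
  refine comp_eq_of_squares h₁ ((biMap_comp (rightBif M n) _ _ _ _).trans
    (Eq.trans ?_ (biMap_comp (rightBif M n) _ _ _ _).symm))
  exact congrArg₂ (fun a b ↦ biMap (rightBif M n) a b) hx hy

/-- `Extⁿ` computed by an `M`-resolution of a left model. -/
def lExtComp {A B : C} (X : LeftModel ρ A) (Y : RightModel ρ B) (W : M.Resolution X.obj) :
    (E.obj (op A)).obj B ≅ lExt n W.complex Y.obj :=
  compIso hM β X Y W (M.nonempty_coresolution Y.obj).some ≪≫
    (lExtIsoRight hM W X.cofibrant_obj _ Y.fibrant_obj (-n) n (by simp)).symm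

/-- The right-hand side involves only `f` and `g`, so this is at once naturality and independence of
all lifts and chain maps. -/
lemma lExtComp_naturality {A B A' B' : C} {X : LeftModel ρ A} {Y : RightModel ρ B}
    (W : M.Resolution X.obj) {X' : LeftModel ρ A'} {Y' : RightModel ρ B'}
    (W' : M.Resolution X'.obj) {f : A' ⟶ A} {g : B ⟶ B'} {f' : X'.obj ⟶ X.obj}
    {g' : Y.obj ⟶ Y'.obj} (hf : X'.IsLift X f f') (hg : Y.IsLift Y' g g')
    {φ : W'.complex ⟶ W.complex} (hφ : W'.IsLift W f' φ) :
    lExt.map n φ g' =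
      (lExtComp hM β X Y W).inv ≫ bifunctorMap E f g ≫ (lExtComp hM β X' Y' W').hom := by
  rw [Iso.eq_inv_comp, ← Iso.comp_inv_eq, Category.assoc]
  have h₁ := compIso_naturality hM β W (M.nonempty_coresolution Y.obj).some W'
    (M.nonempty_coresolution Y'.obj).some hf hg
  have h₂ := lExtIsoRight_naturality hM W X.cofibrant_obj (M.nonempty_coresolution Y.obj).some
    Y.fibrant_obj W' X'.cofibrant_obj (M.nonempty_coresolution Y'.obj).some Y'.fibrant_obj (-n) n
    (by simp) g' hφ
  simp only [lExtComp, Iso.trans_hom, Iso.trans_inv, Iso.symm_hom, Iso.symm_inv, Category.assoc]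
  rw [reassoc_of% h₂, Iso.inv_hom_id_assoc, ← reassoc_of% h₁, Iso.hom_inv_id, Category.comp_id]

/-- `Extⁿ` computed by an `M`-coresolution of a right model. -/
def rExtComp {A B : C} (X : LeftModel ρ A) (Y : RightModel ρ B) (V : M.Coresolution Y.obj) :
    (E.obj (op A)).obj B ≅ rExt n X.obj V.complex :=
  compIso hM β X Y (M.nonempty_resolution X.obj).some V ≪≫
    (rExtIso hM _ X.cofibrant_obj V Y.fibrant_obj n).symm

lemma rExtComp_naturality {A B A' B' : C} {X : LeftModel ρ A} {Y : RightModel ρ B}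
    (V : M.Coresolution Y.obj) {X' : LeftModel ρ A'} {Y' : RightModel ρ B'}
    (V' : M.Coresolution Y'.obj) {f : A' ⟶ A} {g : B ⟶ B'} {f' : X'.obj ⟶ X.obj}
    {g' : Y.obj ⟶ Y'.obj} (hf : X'.IsLift X f f') (hg : Y.IsLift Y' g g')
    {φ : V.complex ⟶ V'.complex} (hφ : V.IsLift V' g' φ) :
    rExt.map n f' φ =
      (rExtComp hM β X Y V).inv ≫ bifunctorMap E f g ≫ (rExtComp hM β X' Y' V').hom := by
  rw [Iso.eq_inv_comp, ← Iso.comp_inv_eq, Category.assoc]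
  have h₁ := compIso_naturality hM β (M.nonempty_resolution X.obj).some V
    (M.nonempty_resolution X'.obj).some V' hf hg
  have h₂ := rExtIso_naturality hM (M.nonempty_resolution X.obj).some X.cofibrant_obj V
    Y.fibrant_obj (M.nonempty_resolution X'.obj).some X'.cofibrant_obj V' Y'.fibrant_obj n f' hφ
  simp only [rExtComp, Iso.trans_hom, Iso.trans_inv, Iso.symm_hom, Iso.symm_inv, Category.assoc]
  rw [reassoc_of% h₂, Iso.inv_hom_id_assoc, ← reassoc_of% h₁, Iso.hom_inv_id, Category.comp_id]

variable (ρ) in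
/-- The bifibrant replacement as a left model. -/
def LeftModel.self (A : C) : LeftModel ρ A where
  obj := (ρ A).obj
  cofibrant_obj := (ρ A).cofibrant_obj
  κ := 𝟙 _
  weq := isLeftWeq_of_isIso _

variable (ρ) in
/-- The bifibrant replacement as a right model. -/
def RightModel.self (B : C) : RightModel ρ B where
  obj := (ρ B).obj
  fibrant_obj := (ρ B).fib.fibrant_obj
  κ := 𝟙 _
  weq := isRightWeq_of_isIso _

lemma LeftModel.self_isLift {A A' : C} {f : A' ⟶ A} {f' : (ρ A').obj ⟶ (ρ A).obj}
    (h : (ρ A').IsLift (ρ A) f f') : (self ρ A').IsLift (self ρ A) f f' := by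
  change M.stable.map f' ≫ 𝟙 _ = 𝟙 _ ≫ ((toHo ρ).map f).hom
  rw [toHo_map_hom ρ f f' h]
  exact (Category.comp_id _).trans (Category.id_comp _).symm

lemma RightModel.self_isLift {B B' : C} {g : B ⟶ B'} {g' : (ρ B).obj ⟶ (ρ B').obj}
    (h : (ρ B).IsLift (ρ B') g g') : (self ρ B).IsLift (self ρ B') g g' := by
  change 𝟙 _ ≫ M.stable.map g' = ((toHo ρ).map g).hom ≫ 𝟙 _
  rw [toHo_map_hom ρ g g' h]
  exact (Category.id_comp _).trans (Category.comp_id _).symm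

/-- The bifibrant replacement is itself a left and a right model, with identity comparison. In each
equivalence, one direction is naturality and the other is the existence of lifts. -/
lemma isExtHo_of_iso (β : E ≅ ext hM ρ n) : IsExtHo ρ n E where
  left := by
    have key {A A' B B' : C} {f : A' ⟶ A} {g : B ⟶ B'} (W : M.Resolution (ρ A).obj)
        (W' : M.Resolution (ρ A').obj) {f' : (ρ A').obj ⟶ (ρ A).obj}
        {g' : (ρ B).obj ⟶ (ρ B').obj} (hf : (ρ A').IsLift (ρ A) f f')
        (hg : (ρ B).IsLift (ρ B') g g') {φ : W'.complex ⟶ W.complex} (hφ : W'.IsLift W f' φ) :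
        lExt.map n φ g' = (lExtComp hM β (LeftModel.self ρ A) (RightModel.self ρ B) W).inv ≫
          bifunctorMap E f g ≫
            (lExtComp hM β (LeftModel.self ρ A') (RightModel.self ρ B') W').hom :=
      lExtComp_naturality hM β (X := LeftModel.self ρ A) (Y := RightModel.self ρ B) W
        (X' := LeftModel.self ρ A') (Y' := RightModel.self ρ B') W' (LeftModel.self_isLift hf)
        (RightModel.self_isLift hg) hφ
    refine ⟨fun A B W ↦ lExtComp hM β (LeftModel.self ρ A) (RightModel.self ρ B) W,
      fun {A A' B B'} f g W W' m ↦ ⟨?_, ?_⟩⟩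
    · rintro ⟨f', g', φ, hf, hg, hφ, rfl⟩
      exact key W W' hf hg hφ
    · intro hm
      obtain ⟨f', hf⟩ := (ρ A').exists_isLift (ρ A) f
      obtain ⟨g', hg⟩ := (ρ B).exists_isLift (ρ B') g
      obtain ⟨φ, hφ⟩ := W'.exists_isLift W f'
      exact ⟨f', g', φ, hf, hg, hφ, hm.trans (key W W' hf hg hφ).symm⟩
  right := by
    have key {A A' B B' : C} {f : A' ⟶ A} {g : B ⟶ B'} (W : M.Coresolution (ρ B).obj)
        (W' : M.Coresolution (ρ B').obj) {f' : (ρ A').obj ⟶ (ρ A).obj}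
        {g' : (ρ B).obj ⟶ (ρ B').obj} (hf : (ρ A').IsLift (ρ A) f f')
        (hg : (ρ B).IsLift (ρ B') g g') {φ : W.complex ⟶ W'.complex} (hφ : W.IsLift W' g' φ) :
        rExt.map n f' φ = (rExtComp hM β (LeftModel.self ρ A) (RightModel.self ρ B) W).inv ≫
          bifunctorMap E f g ≫
            (rExtComp hM β (LeftModel.self ρ A') (RightModel.self ρ B') W').hom :=
      rExtComp_naturality hM β (X := LeftModel.self ρ A) (Y := RightModel.self ρ B) W
        (X' := LeftModel.self ρ A') (Y' := RightModel.self ρ B') W' (LeftModel.self_isLift hf)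
        (RightModel.self_isLift hg) hφ
    refine ⟨fun A B W ↦ rExtComp hM β (LeftModel.self ρ A) (RightModel.self ρ B) W,
      fun {A A' B B'} f g W W' m ↦ ⟨?_, ?_⟩⟩
    · rintro ⟨f', g', φ, hf, hg, hφ, rfl⟩
      exact key W W' hf hg hφ
    · intro hm
      obtain ⟨f', hf⟩ := (ρ A').exists_isLift (ρ A) f
      obtain ⟨g', hg⟩ := (ρ B).exists_isLift (ρ B') g
      obtain ⟨φ, hφ⟩ := W.exists_isLift W' g'
      exact ⟨f', g', φ, hf, hg, hφ, hm.trans (key W W' hf hg hφ).symm⟩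

end

/-- The characterization determines the bifunctor: with one resolution fixed per object, both
bifunctors act by the same maps on the same cohomology groups. -/
lemma IsExtHo.nonempty_iso {ρ : ∀ A : C, M.BifibrantReplacement A} {n : ℤ}
    {E E' : Cᵒᵖ ⥤ C ⥤ AddCommGrpCat.{v}} (h : IsExtHo ρ n E) (h' : IsExtHo ρ n E') :
    Nonempty (E ≅ E') := by
  obtain ⟨e, he⟩ := h.left
  obtain ⟨e', he'⟩ := h'.left
  let W (A : C) := (M.nonempty_resolution (ρ A).obj).some
  refine ⟨bifunctorIso (fun A B ↦ e A B (W A) ≪≫ (e' A B (W A)).symm) fun {A A' B B'} f g ↦ ?_⟩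
  -- The action of `E` is induced by some lifts; feeding those same lifts to `he'` identifies it
  -- with the action of `E'`.
  have := (he' f g (W A) (W A') _).1 ((he f g (W A) (W A') _).2 rfl)
  rw [Iso.inv_comp_eq] at this
  change bifunctorMap E f g ≫ (e A' B' (W A')).hom ≫ (e' A' B' (W A')).inv =
    ((e A B (W A)).hom ≫ (e' A B (W A)).inv) ≫ bifunctorMap E' f g
  refine (Category.assoc _ _ _).symm.trans ?_
  rw [this]
  simp only [Iso.hom_inv_id, Category.comp_id, Category.assoc]

end AbelianModelStructure

end HoExt

end

noncomputable section

namespace HoExt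

variable {C : Type u} [Category.{v} C] [Abelian C]

/-! ### Constructions of short exact sequences -/

/-- The short exact sequences obtained from a composition of two monomorphisms. -/
lemma exists_shortExact_of_mono {S : ShortComplex C} (hS : S.ShortExact) {E : C} (j : S.X₂ ⟶ E)
    [Mono j] : ∃ (T : C) (p : E ⟶ T) (m : S.X₃ ⟶ T) (q : T ⟶ cokernel j) (w : (S.f ≫ j) ≫ p = 0)
      (w' : m ≫ q = 0), S.g ≫ m = j ≫ p ∧ (ShortComplex.mk (S.f ≫ j) p w).ShortExact ∧
        (ShortComplex.mk m q w').ShortExact := by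
  have := hS.mono_f
  have := hS.epi_g
  -- With `T = E / X₁`, the second sequence is that of the third isomorphism theorem, `X₂ / X₁ ⟶ E /
  -- X₁ ⟶ E / X₂`.
  let p := cokernel.π (S.f ≫ j)
  let m : S.X₃ ⟶ cokernel (S.f ≫ j) := hS.exact.desc (j ≫ p) (by
    rw [← Category.assoc]; exact cokernel.condition _)
  have hm : S.g ≫ m = j ≫ p := hS.exact.g_desc _ _
  let q : cokernel (S.f ≫ j) ⟶ cokernel j := cokernel.desc _ (cokernel.π j) (by simp)
  have hq : p ≫ q = cokernel.π j := cokernel.π_desc _ _ _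
  have w : (S.f ≫ j) ≫ p = 0 := cokernel.condition _
  have w' : m ≫ q = 0 := by
    rw [← cancel_epi S.g, reassoc_of% hm, hq, cokernel.condition, comp_zero]
  have h₁ : (ShortComplex.mk (S.f ≫ j) p w).ShortExact := shortExact_of_mono (S.f ≫ j)
  refine ⟨_, p, m, q, w, w', hm, h₁, ?_⟩
  have : Epi q := epi_of_epi_fac hq
  have : Mono m := Preadditive.mono_of_cancel_zero _ fun {T} x hx ↦ by
    obtain ⟨T', a, _, y, hy⟩ := surjective_up_to_refinements_of_epi S.g x
    obtain ⟨T'', b, _, z, hz⟩ := h₁.exact.exact_up_to_refinements (y ≫ j) (by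
      change (y ≫ j) ≫ p = 0
      rw [Category.assoc, ← hm, ← reassoc_of% hy, hx, comp_zero])
    change T'' ⟶ S.X₁ at z
    change b ≫ y ≫ j = z ≫ S.f ≫ j at hz
    have : b ≫ y = z ≫ S.f := by
      rw [← cancel_mono j, Category.assoc, hz, Category.assoc]
    rw [← cancel_epi a, hy, ← cancel_epi b, reassoc_of% this, S.zero]
    simp
  refine { exact := (ShortComplex.exact_iff_exact_up_to_refinements _).2 fun T t ht ↦ ?_ }
  change T ⟶ cokernel (S.f ≫ j) at t
  change t ≫ q = 0 at ht
  obtain ⟨T', a, _, e, he⟩ := surjective_up_to_refinements_of_epi p t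
  obtain ⟨T'', b, _, x, hx⟩ := (ShortComplex.exact_cokernel j).exact_up_to_refinements e (by
    change e ≫ cokernel.π j = 0
    rw [← hq, ← reassoc_of% he, ht, comp_zero])
  change T'' ⟶ S.X₂ at x
  change b ≫ e = x ≫ j at hx
  exact ⟨T'', b ≫ a, epi_comp _ _, x ≫ S.g, by
    rw [Category.assoc, he, reassoc_of% hx, Category.assoc]
    exact congrArg (fun f ↦ x ≫ f) hm.symm⟩

/-- The short exact sequences obtained from a composition of two epimorphisms. -/
lemma exists_shortExact_of_epi {S : ShortComplex C} (hS : S.ShortExact) {E : C} (j : E ⟶ S.X₂)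
    [Epi j] : ∃ (K : C) (i : K ⟶ E) (m : K ⟶ S.X₁) (q : kernel j ⟶ K) (w : i ≫ j ≫ S.g = 0)
      (w' : q ≫ m = 0), i ≫ j = m ≫ S.f ∧ (ShortComplex.mk i (j ≫ S.g) w).ShortExact ∧
        (ShortComplex.mk q m w').ShortExact := by
  have := hS.mono_f
  have := hS.epi_g
  -- With `K` the preimage of `X₁` in `E`, the second sequence is the restriction of `j` to `K ⟶
  -- X₁`, with the same kernel as `j`.
  let i := kernel.ι (j ≫ S.g)
  have w : i ≫ j ≫ S.g = 0 := kernel.condition _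
  let m : kernel (j ≫ S.g) ⟶ S.X₁ := hS.exact.lift (i ≫ j) (by rw [Category.assoc]; exact w)
  have hm : m ≫ S.f = i ≫ j := hS.exact.lift_f _ _
  let q : kernel j ⟶ kernel (j ≫ S.g) := kernel.lift _ (kernel.ι j) (by simp)
  have hq : q ≫ i = kernel.ι j := kernel.lift_ι _ _ _
  have w' : q ≫ m = 0 := by
    rw [← cancel_mono S.f, Category.assoc, hm, reassoc_of% hq, kernel.condition, zero_comp]
  have h₁ : (ShortComplex.mk i (j ≫ S.g) w).ShortExact := shortExact_of_epi (j ≫ S.g)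
  refine ⟨_, i, m, q, w, w', hm.symm, h₁, ?_⟩
  have : Mono q := mono_of_mono_fac hq
  have : Epi m := (epi_iff_surjective_up_to_refinements m).2 fun T x ↦ by
    obtain ⟨T', a, _, y, hy⟩ := surjective_up_to_refinements_of_epi j (x ≫ S.f)
    refine ⟨T', a, ‹_›, kernel.lift _ y (by rw [← reassoc_of% hy, S.zero]; simp), ?_⟩
    rw [← cancel_mono S.f, Category.assoc, Category.assoc, hm, kernel.lift_ι_assoc, hy]
  refine .mk' (ShortComplex.exact_of_f_is_kernel _
    (KernelFork.IsLimit.ofι q w' (fun a ha ↦ kernel.lift j (a ≫ i) ?_) ?_ ?_)) ‹_› ‹_›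
  · rw [Category.assoc, ← hm, reassoc_of% ha, zero_comp]
  · intro T a ha
    rw [← cancel_mono i, Category.assoc, hq, kernel.lift_ι]
  · intro T a ha b hb
    rw [← cancel_mono q, hb, ← cancel_mono i, Category.assoc, hq, kernel.lift_ι]

/-- A pushout of a monomorphism is a monomorphism with the same cokernel. -/
lemma shortExact_of_isPushout {S : ShortComplex C} (hS : S.ShortExact) {E P : C} {i : S.X₁ ⟶ E}
    {inl : S.X₂ ⟶ P} {inr : E ⟶ P} (sq : IsPushout S.f i inl inr) :
    ∃ (p : P ⟶ S.X₃) (w : inr ≫ p = 0), inl ≫ p = S.g ∧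
      (ShortComplex.mk inr p w).ShortExact := by
  have := hS.mono_f
  have := hS.epi_g
  let p : P ⟶ S.X₃ := sq.desc S.g 0 (by simp)
  have hp : inl ≫ p = S.g := sq.inl_desc _ _ _
  have w : inr ≫ p = 0 := sq.inr_desc _ _ _
  have : Mono inr := (MorphismProperty.monomorphisms C).of_isPushout sq.flip
    (MorphismProperty.monomorphisms.infer_property S.f)
  have : Epi p := epi_of_epi_fac hp
  refine ⟨p, w, hp, .mk' (ShortComplex.exact_of_g_is_cokernel _
    (CokernelCofork.IsColimit.ofπ p w (fun a ha ↦ hS.exact.desc (inl ≫ a) ?_) ?_ ?_)) ‹_› ‹_›⟩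
  · rw [reassoc_of% sq.w, ha, comp_zero]
  · intro T a ha
    refine sq.hom_ext ?_ ?_
    · rw [reassoc_of% hp, hS.exact.g_desc]
    · rw [reassoc_of% w, zero_comp, ha]
  · intro T a ha b hb
    rw [← cancel_epi S.g, hS.exact.g_desc, ← hb, reassoc_of% hp]

lemma shortExact_of_isPullback {S : ShortComplex C} (hS : S.ShortExact) {E P : C} {j : E ⟶ S.X₃}
    {fst : P ⟶ S.X₂} {snd : P ⟶ E} (sq : IsPullback fst snd S.g j) :
    ∃ (i : S.X₁ ⟶ P) (w : i ≫ snd = 0), i ≫ fst = S.f ∧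
      (ShortComplex.mk i snd w).ShortExact := by
  have := hS.mono_f
  have := hS.epi_g
  let i : S.X₁ ⟶ P := sq.lift S.f 0 (by simp)
  have hi : i ≫ fst = S.f := sq.lift_fst _ _ _
  have w : i ≫ snd = 0 := sq.lift_snd _ _ _
  have : Epi snd := (MorphismProperty.epimorphisms C).of_isPullback sq
    (MorphismProperty.epimorphisms.infer_property S.g)
  have : Mono i := mono_of_mono_fac hi
  refine ⟨i, w, hi, .mk' (ShortComplex.exact_of_f_is_kernel _
    (KernelFork.IsLimit.ofι i w (fun a ha ↦ hS.exact.lift (a ≫ fst) ?_) ?_ ?_)) ‹_› ‹_›⟩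
  · rw [Category.assoc, sq.w, reassoc_of% ha, zero_comp]
  · intro T a ha
    refine sq.hom_ext ?_ ?_
    · rw [Category.assoc, hi, hS.exact.lift_f]
    · rw [Category.assoc, w, comp_zero, ha]
  · intro T a ha b hb
    rw [← cancel_mono S.f, hS.exact.lift_f, ← hb, Category.assoc, hi]

namespace AbelianModelStructure

variable {M : AbelianModelStructure C}

/-! ### Models obtained from replacements -/

/-- Surjectivity is extension along `S.f`. For injectivity, a core factorization of the restricted
difference extends to `S.X₂`; after subtracting it, the difference factors through the trivially
cofibrant `S.X₃`. -/
lemma isLeftWeq_of_shortExact {S : ShortComplex C} (hS : S.ShortExact)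
    (h₃ : M.trivCofibrant S.X₃) : IsLeftWeq (M.stable.map S.f) := fun Y hY ↦ by
  constructor
  · intro w w' h
    obtain ⟨w, rfl⟩ := M.stable.map_surjective w
    obtain ⟨w', rfl⟩ := M.stable.map_surjective w'
    simp only [← Functor.map_comp] at h
    rw [stable_map_eq_iff] at h ⊢
    obtain ⟨W, α, β, hW, e⟩ := h
    obtain ⟨l, hl⟩ := M.right_cotorsionPair.exists_extension hS h₃ hW.2 α
    have := hS.epi_g
    let d := hS.exact.desc (w - w' - l ≫ β) (by
      rw [Preadditive.comp_sub, reassoc_of% hl, e, Preadditive.comp_sub, sub_self])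
    have hd : S.g ≫ d = w - w' - l ≫ β := hS.exact.g_desc _ _
    rw [← stable_map_eq_zero_iff, ← sub_add_cancel (w - w') (l ≫ β), ← hd, Functor.map_add,
      (stable_map_eq_zero_iff _).2 (stablyZero_of_trivCofibrant h₃ hY S.g d), zero_add,
      stable_map_eq_zero_iff]
    exact ⟨W, l, β, hW, rfl⟩
  · intro w
    obtain ⟨w, rfl⟩ := M.stable.map_surjective w
    obtain ⟨l, rfl⟩ := M.right_cotorsionPair.exists_extension hS h₃ hY w
    exact ⟨M.stable.map l, (M.stable.map_comp _ _).symm⟩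

lemma isRightWeq_of_shortExact {S : ShortComplex C} (hS : S.ShortExact)
    (h₁ : M.trivFibrant S.X₁) : IsRightWeq (M.stable.map S.g) := fun X hX ↦ by
  constructor
  · intro w w' h
    obtain ⟨w, rfl⟩ := M.stable.map_surjective w
    obtain ⟨w', rfl⟩ := M.stable.map_surjective w'
    simp only [← Functor.map_comp] at h
    rw [stable_map_eq_iff] at h ⊢
    obtain ⟨W, α, β, hW, e⟩ := h
    obtain ⟨l, hl⟩ := M.left_cotorsionPair.exists_lift hS hW.1.1 h₁ β
    have := hS.mono_f
    let d := hS.exact.lift (w - w' - α ≫ l) (by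
      rw [Preadditive.sub_comp, Category.assoc, hl, e, Preadditive.sub_comp, sub_self])
    have hd : d ≫ S.f = w - w' - α ≫ l := hS.exact.lift_f _ _
    rw [← stable_map_eq_zero_iff, ← sub_add_cancel (w - w') (α ≫ l), ← hd, Functor.map_add,
      (stable_map_eq_zero_iff _).2 (stablyZero_of_trivFibrant hX h₁ d S.f), zero_add,
      stable_map_eq_zero_iff]
    exact ⟨W, α, l, hW, rfl⟩
  · intro w
    obtain ⟨w, rfl⟩ := M.stable.map_surjective w
    obtain ⟨l, rfl⟩ := M.left_cotorsionPair.exists_lift hS hX h₁ w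
    exact ⟨M.stable.map l, (M.stable.map_comp _ _).symm⟩

/-- Morphisms from a cofibrant object which agree after a cofibrant replacement are stably equal. -/
lemma CofibrantReplacement.stable_map_eq {X A : C} (P : M.CofibrantReplacement A)
    (hX : M.cofibrant X) {q q' : X ⟶ P.obj} (h : q ≫ P.π = q' ≫ P.π) :
    M.stable.map q = M.stable.map q' := by
  have := P.epi_π
  refine (isRightWeq_of_shortExact (shortExact_of_epi P.π) P.trivFibrant_kernel X hX).1 ?_
  exact (M.stable.map_comp _ _).symm.trans ((congrArg M.stable.map h).trans (M.stable.map_comp _ _))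

/-- Morphisms to a fibrant object which agree on a fibrant replacement are stably equal. -/
lemma FibrantReplacement.stable_map_eq {B Y : C} (T : M.FibrantReplacement B)
    (hY : M.fibrant Y) {r r' : T.obj ⟶ Y} (h : T.ι ≫ r = T.ι ≫ r') :
    M.stable.map r = M.stable.map r' := by
  have := T.mono_ι
  refine (isLeftWeq_of_shortExact (shortExact_of_mono T.ι) T.trivCofibrant_cokernel Y hY).1 ?_
  exact (M.stable.map_comp _ _).symm.trans ((congrArg M.stable.map h).trans (M.stable.map_comp _ _))

lemma CofibrantReplacement.exists_lift {X A : C} (P : M.CofibrantReplacement A)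
    (hX : M.cofibrant X) (f : X ⟶ A) : ∃ q : X ⟶ P.obj, q ≫ P.π = f :=
  have := P.epi_π
  M.left_cotorsionPair.exists_lift (shortExact_of_epi P.π) hX P.trivFibrant_kernel f

lemma FibrantReplacement.exists_extension {B Y : C} (T : M.FibrantReplacement B)
    (hY : M.fibrant Y) (f : B ⟶ Y) : ∃ r : T.obj ⟶ Y, T.ι ≫ r = f :=
  have := T.mono_ι
  M.right_cotorsionPair.exists_extension (shortExact_of_mono T.ι) T.trivCofibrant_cokernel hY f

lemma CofibrantReplacement.isIso_stable_map {A : C} (P P' : M.CofibrantReplacement A)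
    {q : P.obj ⟶ P'.obj} (hq : q ≫ P'.π = P.π) : IsIso (M.stable.map q) := by
  obtain ⟨q', hq'⟩ := P.exists_lift P'.cofibrant_obj P'.π
  refine ⟨M.stable.map q', ?_, ?_⟩
  · rw [← Functor.map_comp, P.stable_map_eq P.cofibrant_obj (q := q ≫ q') (q' := 𝟙 _)
      (by rw [Category.assoc, hq', hq, Category.id_comp]), M.stable.map_id]
  · rw [← Functor.map_comp, P'.stable_map_eq P'.cofibrant_obj (q := q' ≫ q) (q' := 𝟙 _)
      (by rw [Category.assoc, hq, hq', Category.id_comp]), M.stable.map_id]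

lemma FibrantReplacement.isIso_stable_map {B : C} (T T' : M.FibrantReplacement B)
    {r : T.obj ⟶ T'.obj} (hr : T.ι ≫ r = T'.ι) : IsIso (M.stable.map r) := by
  obtain ⟨r', hr'⟩ := T'.exists_extension T.fibrant_obj T.ι
  refine ⟨M.stable.map r', ?_, ?_⟩
  · rw [← Functor.map_comp, T.stable_map_eq T.fibrant_obj (r := r ≫ r') (r' := 𝟙 _)
      (by rw [reassoc_of% hr, hr', Category.comp_id]), M.stable.map_id]
  · rw [← Functor.map_comp, T'.stable_map_eq T'.fibrant_obj (r := r' ≫ r) (r' := 𝟙 _)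
      (by rw [reassoc_of% hr', hr, Category.comp_id]), M.stable.map_id]

/-- A monomorphism to a fibrant object, with trivially cofibrant cokernel. -/
def FibrantReplacement.ofShortExact {B R T : C} {i : B ⟶ R} {p : R ⟶ T} {w : i ≫ p = 0}
    (h : (ShortComplex.mk i p w).ShortExact) (hR : M.fibrant R) (hT : M.trivCofibrant T) :
    M.FibrantReplacement B where
  obj := R
  ι := i
  mono_ι := h.mono_f
  fibrant_obj := hR
  trivCofibrant_cokernel := M.trivCofibrant.prop_of_iso (cokernelIsoOfShortExact h).symm hT

/-- An epimorphism from a cofibrant object, with trivially fibrant kernel. -/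
def CofibrantReplacement.ofShortExact {A K Q : C} {i : K ⟶ Q} {p : Q ⟶ A} {w : i ≫ p = 0}
    (h : (ShortComplex.mk i p w).ShortExact) (hQ : M.cofibrant Q) (hK : M.trivFibrant K) :
    M.CofibrantReplacement A where
  obj := Q
  π := p
  epi_π := h.epi_g
  cofibrant_obj := hQ
  trivFibrant_kernel := M.trivFibrant.prop_of_iso (kernelIsoOfShortExact h).symm hK

variable {ρ : ∀ A : C, M.BifibrantReplacement A}

/-- A cofibrant replacement is a left model. -/
def LeftModel.ofCofibrant {A : C} (P : M.CofibrantReplacement A) : LeftModel ρ A where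
  obj := P.obj
  cofibrant_obj := P.cofibrant_obj
  κ := M.stable.map (((ρ A).cof.exists_lift P.cofibrant_obj P.π).choose ≫ (ρ A).fib.ι)
  weq := by
    have := (ρ A).fib.mono_ι
    have := P.isIso_stable_map _ ((ρ A).cof.exists_lift P.cofibrant_obj P.π).choose_spec
    rw [Functor.map_comp]
    exact (isLeftWeq_of_isIso _).comp (isLeftWeq_of_shortExact (shortExact_of_mono (ρ A).fib.ι)
      (ρ A).fib.trivCofibrant_cokernel)

lemma LeftModel.ofCofibrant_isLift {A A' : C} {P' : M.CofibrantReplacement A'}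
    {P : M.CofibrantReplacement A} {f : A' ⟶ A} {q : P'.obj ⟶ P.obj} (h : P'.IsLift P f q) :
    (ofCofibrant (ρ := ρ) P').IsLift (ofCofibrant P) f q := by
  obtain ⟨r, c, hc, hr⟩ := (ρ A').exists_isLift (ρ A) f
  have key {a : P.obj ⟶ (ρ A).cof.obj} {a' : P'.obj ⟶ (ρ A').cof.obj} (ha : a ≫ (ρ A).cof.π = P.π)
      (ha' : a' ≫ (ρ A').cof.π = P'.π) :
      M.stable.map (q ≫ a ≫ (ρ A).fib.ι) = M.stable.map ((a' ≫ (ρ A').fib.ι) ≫ r) := by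
    dsimp only [FibrantReplacement.IsLift, CofibrantReplacement.IsLift] at hc hr h
    rw [Category.assoc, hr, ← Category.assoc, ← Category.assoc, Functor.map_comp,
      M.stable.map_comp (a' ≫ c)]
    refine congrArg (· ≫ M.stable.map (ρ A).fib.ι) ?_
    refine CofibrantReplacement.stable_map_eq _ P'.cofibrant_obj ?_
    rw [Category.assoc, Category.assoc, hc, ha, h, reassoc_of% ha']
  change M.stable.map q ≫ M.stable.map _ = M.stable.map _ ≫ ((toHo ρ).map f).hom
  rw [toHo_map_hom ρ f r ⟨c, hc, hr⟩]
  exact (M.stable.map_comp _ _).symm.trans ((key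
    ((ρ A).cof.exists_lift P.cofibrant_obj P.π).choose_spec
    ((ρ A').cof.exists_lift P'.cofibrant_obj P'.π).choose_spec).trans (M.stable.map_comp _ _))

/-- A fibrant replacement `T₀` of `B`, with an epimorphism `RQB ⟶ T₀` extending `QB ⟶ B`. -/
lemma BifibrantReplacement.exists_fibrantReplacement (hM : M.IsHereditary) {B : C}
    (P : M.BifibrantReplacement B) : ∃ (T : M.FibrantReplacement B) (s : P.obj ⟶ T.obj),
      P.fib.ι ≫ s = P.cof.π ≫ T.ι ∧ IsRightWeq (M.stable.map s) := by
  have := P.cof.epi_π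
  have := P.fib.mono_ι
  -- Divide `RQB` by the kernel of `QB ⟶ B`. The quotient is fibrant by heredity, contains `B` with
  -- cokernel that of `QB ⟶ RQB`, and the quotient map has trivially fibrant kernel.
  obtain ⟨T, p, m, q, w, w', h, h₁, h₂⟩ :=
    exists_shortExact_of_mono (shortExact_of_epi P.cof.π) P.fib.ι
  exact ⟨.ofShortExact h₂ (M.right_cotorsionPair.right_X₃ hM.2 h₁ P.cof.trivFibrant_kernel.2
    P.fib.fibrant_obj) P.fib.trivCofibrant_cokernel, p, h.symm,
    isRightWeq_of_shortExact h₁ P.cof.trivFibrant_kernel⟩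

/-- A fibrant replacement is a right model. -/
def RightModel.ofFibrant (hM : M.IsHereditary) {B : C} (T : M.FibrantReplacement B) :
    RightModel ρ B where
  obj := T.obj
  fibrant_obj := T.fibrant_obj
  κ := M.stable.map ((ρ B).fib.exists_extension T.fibrant_obj ((ρ B).cof.π ≫ T.ι)).choose
  weq := by
    -- The map from `RQB` to an arbitrary `RB` need not be epi, so it is compared with the special
    -- replacement `T₀`; any two fibrant replacements are stably isomorphic.
    obtain ⟨T₀, s, hs, h⟩ := (ρ B).exists_fibrantReplacement hM
    obtain ⟨r, hr⟩ := T₀.exists_extension T.fibrant_obj T.ι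
    have := T₀.isIso_stable_map _ hr
    rw [(ρ B).fib.stable_map_eq T.fibrant_obj (r' := s ≫ r) (by
      rw [((ρ B).fib.exists_extension T.fibrant_obj ((ρ B).cof.π ≫ T.ι)).choose_spec,
        reassoc_of% hs, hr]), Functor.map_comp]
    exact h.comp (isRightWeq_of_isIso _)

lemma RightModel.ofFibrant_isLift (hM : M.IsHereditary) {B B' : C} {T : M.FibrantReplacement B}
    {T' : M.FibrantReplacement B'} {g : B ⟶ B'} {r : T.obj ⟶ T'.obj} (h : T.IsLift T' g r) :
    (ofFibrant (ρ := ρ) hM T).IsLift (ofFibrant hM T') g r := by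
  obtain ⟨r', c, hc, hr⟩ := (ρ B).exists_isLift (ρ B') g
  have key {a : (ρ B).obj ⟶ T.obj} {a' : (ρ B').obj ⟶ T'.obj}
      (ha : (ρ B).fib.ι ≫ a = (ρ B).cof.π ≫ T.ι) (ha' : (ρ B').fib.ι ≫ a' = (ρ B').cof.π ≫ T'.ι) :
      M.stable.map (a ≫ r) = M.stable.map (r' ≫ a') := by
    dsimp only [FibrantReplacement.IsLift, CofibrantReplacement.IsLift] at hc hr h
    refine FibrantReplacement.stable_map_eq _ T'.fibrant_obj ?_
    rw [reassoc_of% ha, h, reassoc_of% hr, ha', reassoc_of% hc]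
  change M.stable.map _ ≫ M.stable.map r = ((toHo ρ).map g).hom ≫ M.stable.map _
  rw [toHo_map_hom ρ g r' ⟨c, hc, hr⟩]
  exact (M.stable.map_comp _ _).symm.trans ((key
    ((ρ B).fib.exists_extension T.fibrant_obj ((ρ B).cof.π ≫ T.ι)).choose_spec
    ((ρ B').fib.exists_extension T'.fibrant_obj ((ρ B').cof.π ≫ T'.ι)).choose_spec).trans
    (M.stable.map_comp _ _))

end AbelianModelStructure

end HoExt

end

noncomputable section

namespace HoExt

variable {C : Type u} [Category.{v} C] [Abelian C]

namespace AbelianModelStructure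

variable {M : AbelianModelStructure C}

/-! ### Functors on the homotopy category -/

lemma IsLeftWeq.of_comp {X X' X'' : M.Stable} {κ : X ⟶ X'} {κ' : X' ⟶ X''} (h : IsLeftWeq κ)
    (h' : IsLeftWeq (κ ≫ κ')) : IsLeftWeq κ' := fun Y hY ↦
  (Function.Bijective.of_comp_iff' (h Y hY) _).1 (by
    have := h' Y hY
    simp only [Category.assoc] at this
    exact this)

/-- The Yoneda argument, tested on the two fibrant objects `X` and `X'`. -/
lemma IsLeftWeq.isIso {X X' : C} {κ : M.stable.obj X ⟶ M.stable.obj X'} (h : IsLeftWeq κ)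
    (hX : M.fibrant X) (hX' : M.fibrant X') : IsIso κ := by
  obtain ⟨l, hl⟩ := (h X hX).2 (𝟙 _)
  dsimp only at hl
  refine ⟨l, hl, (h X' hX').1 ?_⟩
  dsimp only
  rw [← Category.assoc, hl, Category.id_comp, Category.comp_id]

lemma CofibrantReplacement.isIso_stable_map_π {A : C} (P : M.CofibrantReplacement A)
    (hA : M.cofibrant A) : IsIso (M.stable.map P.π) := by
  obtain ⟨q, hq⟩ := P.exists_lift hA (𝟙 A)
  refine ⟨M.stable.map q, ?_, ?_⟩
  · rw [← Functor.map_comp, P.stable_map_eq P.cofibrant_obj (q := P.π ≫ q) (q' := 𝟙 _)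
      (by rw [Category.assoc, hq, Category.id_comp, Category.comp_id]), M.stable.map_id]
  · rw [← Functor.map_comp, hq, M.stable.map_id]

lemma FibrantReplacement.isLeftWeq_stable_map_ι {B : C} (T : M.FibrantReplacement B) :
    IsLeftWeq (M.stable.map T.ι) :=
  have := T.mono_ι
  isLeftWeq_of_shortExact (shortExact_of_mono T.ι) T.trivCofibrant_cokernel

section

variable (ρ : ∀ A : C, M.BifibrantReplacement A)

/-- On a bifibrant object `π` is a stable isomorphism and `ι` is inverted by Hom into fibrant
objects, so `t` is inverted as well. -/
lemma exists_stable_inverse {X : C} (hX : M.cofibrant X) (hX' : M.fibrant X) :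
    ∃ t : (ρ X).obj ⟶ X, (ρ X).fib.ι ≫ t = (ρ X).cof.π ∧ IsIso (M.stable.map t) := by
  obtain ⟨t, ht⟩ := (ρ X).fib.exists_extension hX' (ρ X).cof.π
  refine ⟨t, ht, IsLeftWeq.isIso ?_ (ρ X).fib.fibrant_obj hX'⟩
  have := (ρ X).cof.isIso_stable_map_π hX
  refine (ρ X).fib.isLeftWeq_stable_map_ι.of_comp ?_
  rw [← Functor.map_comp, ht]
  exact isLeftWeq_of_isIso _

lemma isIso_toHo_map_of_isIso {A B : C} {f : A ⟶ B} {h : (ρ A).obj ⟶ (ρ B).obj}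
    (H : (ρ A).IsLift (ρ B) f h) (hh : IsIso (M.stable.map h)) : IsIso ((toHo ρ).map f) := by
  have : IsIso ((inducedFunctor _).map ((toHo ρ).map f)) := by
    rw [← toHo_map_hom ρ f h H] at hh
    exact hh
  exact isIso_of_reflects_iso _ (inducedFunctor _)

lemma isIso_toHo_map_π (A : C) : IsIso ((toHo ρ).map (ρ A).cof.π) := by
  -- As `Q(π)` one may take the replacement map `Q(QA) ⟶ QA` itself, which is stably invertible
  -- because `QA` is cofibrant.
  obtain ⟨r, hr⟩ := (ρ (ρ A).cof.obj).fib.exists_extension (ρ A).fib.fibrant_obj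
    ((ρ (ρ A).cof.obj).cof.π ≫ (ρ A).fib.ι)
  refine isIso_toHo_map_of_isIso ρ (h := r) ⟨(ρ (ρ A).cof.obj).cof.π, rfl, hr⟩ ?_
  refine IsLeftWeq.isIso ?_ (ρ (ρ A).cof.obj).fib.fibrant_obj (ρ A).fib.fibrant_obj
  refine (ρ (ρ A).cof.obj).fib.isLeftWeq_stable_map_ι.of_comp ?_
  have := (ρ (ρ A).cof.obj).cof.isIso_stable_map_π (ρ A).cof.cofibrant_obj
  rw [← Functor.map_comp, hr, Functor.map_comp]
  exact (isLeftWeq_of_isIso _).comp (ρ A).fib.isLeftWeq_stable_map_ι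

/-- The morphism from `RQA` to `A` in the homotopy category. -/
def fromBifibrant (A : C) : (toHo ρ).obj (ρ A).obj ⟶ (toHo ρ).obj A :=
  InducedCategory.homMk (M.stable.map
    (exists_stable_inverse ρ (ρ A).cofibrant_obj (ρ A).fib.fibrant_obj).choose)

lemma isIso_fromBifibrant (A : C) : IsIso (fromBifibrant ρ A) := by
  have : IsIso ((inducedFunctor _).map (fromBifibrant ρ A)) :=
    (exists_stable_inverse ρ (ρ A).cofibrant_obj (ρ A).fib.fibrant_obj).choose_spec.2
  exact isIso_of_reflects_iso _ (inducedFunctor _)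

/-- This exhibits `fromBifibrant` as a zigzag of images of `γ` through `QA`. -/
lemma toHo_map_ι_fromBifibrant (A : C) :
    (toHo ρ).map (ρ A).fib.ι ≫ fromBifibrant ρ A = (toHo ρ).map (ρ A).cof.π := by
  obtain ⟨h, q, hq, hh⟩ := (ρ (ρ A).cof.obj).exists_isLift (ρ (ρ A).obj) (ρ A).fib.ι
  obtain ⟨ht, _⟩ :=
    (exists_stable_inverse ρ (ρ A).cofibrant_obj (ρ A).fib.fibrant_obj).choose_spec
  have H := toHo_map_hom ρ (ρ A).cof.π _ ⟨(ρ (ρ A).cof.obj).cof.π, rfl, show _ = _ by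
    rw [reassoc_of% hh, ht, hq]⟩
  ext
  refine Eq.trans ?_ H.symm
  refine (congrArg (· ≫ M.stable.map _) (toHo_map_hom ρ (ρ A).fib.ι h ⟨q, hq, hh⟩)).trans ?_
  exact (M.stable.map_comp _ _).symm

/-- An arbitrary morphism of the homotopy category is thus conjugate to the image under `γ` of one
of its representatives `RQA ⟶ RQB`. -/
lemma fromBifibrant_naturality {A B : C} {x : (toHo ρ).obj A ⟶ (toHo ρ).obj B}
    {h : (ρ A).obj ⟶ (ρ B).obj} (hx : x.hom = M.stable.map h) :
    fromBifibrant ρ A ≫ x = (toHo ρ).map h ≫ fromBifibrant ρ B := by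
  obtain ⟨k, q, hq, hk⟩ := (ρ (ρ A).obj).exists_isLift (ρ (ρ B).obj) h
  have key {t : (ρ (ρ A).obj).obj ⟶ (ρ A).obj} {t' : (ρ (ρ B).obj).obj ⟶ (ρ B).obj}
      (ht : (ρ (ρ A).obj).fib.ι ≫ t = (ρ (ρ A).obj).cof.π)
      (ht' : (ρ (ρ B).obj).fib.ι ≫ t' = (ρ (ρ B).obj).cof.π) :
      M.stable.map (t ≫ h) = M.stable.map (k ≫ t') := by
    dsimp only [FibrantReplacement.IsLift, CofibrantReplacement.IsLift] at hq hk
    refine FibrantReplacement.stable_map_eq _ (ρ B).fib.fibrant_obj ?_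
    rw [reassoc_of% ht, reassoc_of% hk, ht', hq]
  ext
  refine Eq.trans (congrArg (M.stable.map _ ≫ ·) hx) ?_
  refine Eq.trans ?_ (congrArg (· ≫ M.stable.map _) (toHo_map_hom ρ h k ⟨q, hq, hk⟩)).symm
  exact (M.stable.map_comp _ _).symm.trans ((key
    (exists_stable_inverse ρ (ρ A).cofibrant_obj (ρ A).fib.fibrant_obj).choose_spec.1
    (exists_stable_inverse ρ (ρ B).cofibrant_obj (ρ B).fib.fibrant_obj).choose_spec.1).trans
    (M.stable.map_comp _ _))

/-- Every morphism of the homotopy category is a composition of morphisms of the form `γ(f)` and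
inverses of such morphisms. -/
lemma toHo_induction (P : MorphismProperty (Ho ρ)) [P.IsStableUnderComposition]
    (hP : P.StableUnderInverse) (hP' : ∀ {A B : C} (f : A ⟶ B), P ((toHo ρ).map f)) {A B : Ho ρ}
    (x : A ⟶ B) : P x := by
  have hθ (A : C) : P (fromBifibrant ρ A) ∧ P (@inv _ _ _ _ (fromBifibrant ρ A)
      (isIso_fromBifibrant ρ A)) := by
    have := isIso_fromBifibrant ρ A
    have := isIso_toHo_map_π ρ A
    have h := toHo_map_ι_fromBifibrant ρ A
    have : IsIso ((toHo ρ).map (ρ A).fib.ι) := by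
      have : IsIso ((toHo ρ).map (ρ A).fib.ι ≫ fromBifibrant ρ A) := by rw [h]; infer_instance
      exact IsIso.of_isIso_comp_right _ (fromBifibrant ρ A)
    have h₁ : P (fromBifibrant ρ A) := by
      rw [← IsIso.eq_inv_comp] at h
      rw [h]
      exact P.comp_mem _ _ (hP (asIso ((toHo ρ).map (ρ A).fib.ι)) (hP' _)) (hP' _)
    exact ⟨h₁, hP (asIso (fromBifibrant ρ A)) h₁⟩
  obtain ⟨h, hh⟩ := M.stable.map_surjective x.hom
  have e := fromBifibrant_naturality ρ hh.symm
  have := isIso_fromBifibrant ρ A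
  have e' : x = inv (fromBifibrant ρ A) ≫ (toHo ρ).map h ≫ fromBifibrant ρ B :=
    (IsIso.eq_inv_comp (fromBifibrant ρ A)).2 e
  rw [e']
  exact P.comp_mem _ _ (hθ A).2 (P.comp_mem _ _ (hP' h) (hθ B).1)

/-- The functors agree on objects. Compatibility of the resulting `eqToHom`s with morphisms passes
to composites and inverses, so it suffices to have it on the image of `γ`. -/
lemma toHo_comp_injective {D : Type*} [Category* D] {F F' : Ho ρ ⥤ D}
    (h : toHo ρ ⋙ F = toHo ρ ⋙ F') : F = F' := by
  have hobj (A : Ho ρ) : F.obj A = F'.obj A := Functor.congr_obj h A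
  have (A B : Ho ρ) (x : A ⟶ B) :
      MorphismProperty.naturalityProperty (fun A ↦ eqToHom (hobj A)) x := by
    refine toHo_induction ρ _ (MorphismProperty.naturalityProperty.stableUnderInverse _)
      (fun {A B} f ↦ ?_) x
    have := Functor.congr_hom h f
    change F.map _ = eqToHom _ ≫ F'.map _ ≫ eqToHom _ at this
    change F.map _ ≫ eqToHom _ = eqToHom _ ≫ F'.map _
    rw [this]
    simp
  refine CategoryTheory.Functor.ext hobj fun A B x ↦ ?_
  have := this A B x
  change F.map _ ≫ eqToHom _ = eqToHom _ ≫ F'.map _ at this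
  rw [← reassoc_of% this]
  simp

/-- A functor which is isomorphic to one that factors through `γ` factors uniquely through `γ`. -/
lemma existsUnique_toHo_comp_eq {D : Type*} [Category* D] {G : C ⥤ D} {F : Ho ρ ⥤ D}
    (α : G ≅ toHo ρ ⋙ F) : ∃! F' : Ho ρ ⥤ D, toHo ρ ⋙ F' = G := by
  have h : ∃ F' : Ho ρ ⥤ D, toHo ρ ⋙ F' = G := by
    obtain ⟨e, he⟩ : ∃ e : ∀ A : Ho ρ, G.obj A ≅ F.obj A,
      ∀ {A B : C} (f : A ⟶ B), (e A).hom ≫ F.map ((toHo ρ).map f) ≫ (e B).inv = G.map f :=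
      ⟨fun A ↦ α.app A, fun f ↦ (NatIso.naturality_2 α f)⟩
    -- Since `γ` is the identity on objects, conjugating `F` by the isomorphism gives a functor with
    -- the objects of `G`, and the factorization is a strict equality.
    refine ⟨{ obj := G.obj
              map := fun {A B} x ↦ (e A).hom ≫ F.map x ≫ (e B).inv }, ?_⟩
    refine CategoryTheory.Functor.ext (fun _ ↦ rfl) fun A B f ↦ ?_
    refine Eq.trans ?_ (Eq.trans (Category.comp_id (G.map f)).symm (Category.id_comp _).symm)
    exact he f
  obtain ⟨F', hF'⟩ := h
  exact ⟨F', hF', fun F'' hF'' ↦ toHo_comp_injective ρ (hF''.trans hF'.symm)⟩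

lemma existsUnique_toHo_op_comp_eq {D : Type*} [Category* D] {G : Cᵒᵖ ⥤ D} {F : (Ho ρ)ᵒᵖ ⥤ D}
    (α : G ≅ (toHo ρ).op ⋙ F) : ∃! F' : (Ho ρ)ᵒᵖ ⥤ D, (toHo ρ).op ⋙ F' = G := by
  obtain ⟨F', hF', h⟩ := existsUnique_toHo_comp_eq ρ (G := G.rightOp) (F := F.rightOp)
    (NatIso.ofComponents (fun A ↦ (α.app (op A)).symm.op) fun f ↦
      Quiver.Hom.unop_inj (α.inv.naturality f.op).symm)
  refine ⟨F'.leftOp, congrArg Functor.leftOp hF', fun F'' hF'' ↦ ?_⟩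
  exact congrArg Functor.leftOp (h F''.rightOp (congrArg Functor.rightOp hF''))

end

end AbelianModelStructure

end HoExt

end

noncomputable section

namespace HoExt

variable {C : Type u} [Category.{v} C] [Abelian C]

namespace AbelianModelStructure

variable {M : AbelianModelStructure C}

open SplicedTower

/-! ### Additivity -/

lemma BifibrantReplacement.IsLift.add {A B : C} {P : M.BifibrantReplacement A}
    {P' : M.BifibrantReplacement B} {f f' : A ⟶ B} {h h' : P.obj ⟶ P'.obj} (H : P.IsLift P' f h)
    (H' : P.IsLift P' f' h') : P.IsLift P' (f + f') (h + h') := by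
  obtain ⟨q, hq, hh⟩ := H
  obtain ⟨q', hq', hh'⟩ := H'
  dsimp only [CofibrantReplacement.IsLift, FibrantReplacement.IsLift] at hq hh hq' hh'
  exact ⟨q + q', by simp [CofibrantReplacement.IsLift, hq, hq'],
    by simp [FibrantReplacement.IsLift, hh, hh']⟩

section

variable (hM : M.IsHereditary) (ρ : ∀ A : C, M.BifibrantReplacement A)

lemma toHo_map_add_hom {A B : C} (f g : A ⟶ B) :
    (show M.stable.obj (ρ A).obj ⟶ M.stable.obj (ρ B).obj from ((toHo ρ).map (f + g)).hom) =
      ((toHo ρ).map f).hom + ((toHo ρ).map g).hom := by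
  obtain ⟨h, hh⟩ := (ρ A).exists_isLift (ρ B) f
  obtain ⟨h', hh'⟩ := (ρ A).exists_isLift (ρ B) g
  rw [toHo_map_hom ρ f h hh, toHo_map_hom ρ g h' hh', toHo_map_hom ρ _ _ (hh.add hh')]
  exact M.stable.map_add

instance : (toHo ρ ⋙ leftFunctor hM ρ ⋙ leftBase M).Additive where
  map_add := toHo_map_add_hom ρ _ _

instance : (toHo ρ ⋙ rightFunctor hM ρ ⋙ rightBase M).Additive where
  map_add := toHo_map_add_hom ρ _ _

variable {ρ} {n : ℤ} {E : Cᵒᵖ ⥤ C ⥤ AddCommGrpCat.{v}}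

/-- After balancing, the second variable enters only through `RQB` in the stable category, so no
additivity of cosyzygy functors is needed. For the first variable the unbalanced form already has
this shape. -/
lemma additive_obj_of_iso (β : E ≅ ext hM ρ n) (A : C) : (E.obj (op A)).Additive := by
  let L := (leftFunctor hM ρ).obj ((toHo ρ).obj A)
  have e : E.obj (op A) ≅
      (homBifunctor (leftZ M (-n)) (toHo ρ ⋙ rightFunctor hM ρ ⋙ rightBase M)).obj (op L) :=
    β.app (op A) ≪≫ Functor.isoWhiskerLeft (toHo ρ ⋙ rightFunctor hM ρ)
      ((balanceIso M (-n) n (by simp)).app (op L)).symm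
  exact Functor.additive_of_iso e.symm

lemma additive_flip_obj_of_iso (β : E ≅ ext hM ρ n) (B : C) : (E.flip.obj B).Additive := by
  let U := (rightFunctor hM ρ).obj ((toHo ρ).obj B)
  have e : E.flip.obj B ≅
      (homBifunctor (toHo ρ ⋙ leftFunctor hM ρ ⋙ leftBase M) (rightZ M n)).flip.obj U :=
    Functor.isoWhiskerRight β ((evaluation _ _).obj B)
  exact Functor.additive_of_iso e.symm

lemma existsUnique_obj_of_iso (β : E ≅ ext hM ρ n) (A : C) :
    ∃! F : Ho ρ ⥤ AddCommGrpCat.{v}, toHo ρ ⋙ F = E.obj (op A) :=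
  existsUnique_toHo_comp_eq ρ (F := (extHo hM ρ n).obj (op ((toHo ρ).obj A))) (β.app (op A))

lemma existsUnique_flip_obj_of_iso (β : E ≅ ext hM ρ n) (B : C) :
    ∃! F : (Ho ρ)ᵒᵖ ⥤ AddCommGrpCat.{v}, (toHo ρ).op ⋙ F = E.flip.obj B :=
  existsUnique_toHo_op_comp_eq ρ (F := (extHo hM ρ n).flip.obj ((toHo ρ).obj B))
    (Functor.isoWhiskerRight β ((evaluation _ _).obj B))

end

end AbelianModelStructure

end HoExt

end

noncomputable section

namespace HoExt

variable {C : Type u} [Category.{v} C] [Abelian C]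

namespace AbelianModelStructure

variable {M : AbelianModelStructure C}

/-! ### Short exact sequences of replacements -/

lemma nonempty_cofibrantReplacement (M : AbelianModelStructure C) (A : C) :
    Nonempty (M.CofibrantReplacement A) := by
  obtain ⟨Q, p, hp, hQ, hK⟩ := M.left_pair.enough_projectives A
  exact ⟨⟨Q, p, hp, hQ, hK⟩⟩

lemma nonempty_fibrantReplacement (M : AbelianModelStructure C) (B : C) :
    Nonempty (M.FibrantReplacement B) := by
  obtain ⟨R, i, hi, hR, hK⟩ := M.right_pair.enough_injectives B
  exact ⟨⟨R, i, hi, hR, hK⟩⟩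

/-- Push `X₁ ⟶ X₂` out along `X₁ ⟶ RX₁` and take a fibrant replacement of the pushout. It is a
replacement of `X₂`, since its cokernel over `X₂` is an extension of trivially cofibrant objects.
Its quotient by `RX₁` is a replacement of `X₃`, fibrant by heredity. -/
lemma exists_shortExact_fibrantReplacement (hM : M.IsHereditary) {S : ShortComplex C}
    (hS : S.ShortExact) : ∃ (T₁ : M.FibrantReplacement S.X₁) (T₂ : M.FibrantReplacement S.X₂)
      (T₃ : M.FibrantReplacement S.X₃) (f : T₁.obj ⟶ T₂.obj) (g : T₂.obj ⟶ T₃.obj)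
      (w : f ≫ g = 0), T₁.IsLift T₂ S.f f ∧ T₂.IsLift T₃ S.g g ∧
        (ShortComplex.mk f g w).ShortExact := by
  obtain ⟨T₁⟩ := M.nonempty_fibrantReplacement S.X₁
  have := T₁.mono_ι
  have sq := IsPushout.of_hasPushout S.f T₁.ι
  obtain ⟨p, w, hp, h⟩ := shortExact_of_isPushout hS sq
  obtain ⟨p', w', _, h'⟩ := shortExact_of_isPushout (shortExact_of_mono T₁.ι) sq.flip
  obtain ⟨T⟩ := M.nonempty_fibrantReplacement (pushout S.f T₁.ι)
  have := T.mono_ι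
  obtain ⟨R₃, g, m, q, hg, hq, e, hfg, hmq⟩ := exists_shortExact_of_mono h T.ι
  obtain ⟨R₂, r, m', q', hr, hq', _, h₂, hmq'⟩ := exists_shortExact_of_mono h' T.ι
  refine ⟨T₁, .ofShortExact h₂ T.fibrant_obj (M.right_cotorsionPair.left_X₂ hmq'
    T₁.trivCofibrant_cokernel T.trivCofibrant_cokernel), .ofShortExact hmq
      (M.right_cotorsionPair.right_X₃ hM.2 hfg T₁.fibrant_obj T.fibrant_obj)
      T.trivCofibrant_cokernel, _, g, hg, ?_, ?_, hfg⟩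
  · change T₁.ι ≫ pushout.inr _ _ ≫ T.ι = S.f ≫ pushout.inl _ _ ≫ T.ι
    rw [reassoc_of% sq.w]
  · change (pushout.inl _ _ ≫ T.ι) ≫ g = S.g ≫ m
    dsimp only at e
    rw [Category.assoc, ← e, reassoc_of% hp]

/-- Dually, pull `X₂ ⟶ X₃` back along `QX₃ ⟶ X₃` and take a cofibrant replacement of the pullback;
heredity makes the kernel of its map to `QX₃` cofibrant. -/
lemma exists_shortExact_cofibrantReplacement (hM : M.IsHereditary) {S : ShortComplex C}
    (hS : S.ShortExact) : ∃ (P₁ : M.CofibrantReplacement S.X₁) (P₂ : M.CofibrantReplacement S.X₂)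
      (P₃ : M.CofibrantReplacement S.X₃) (f : P₁.obj ⟶ P₂.obj) (g : P₂.obj ⟶ P₃.obj)
      (w : f ≫ g = 0), P₁.IsLift P₂ S.f f ∧ P₂.IsLift P₃ S.g g ∧
        (ShortComplex.mk f g w).ShortExact := by
  obtain ⟨P₃⟩ := M.nonempty_cofibrantReplacement S.X₃
  have := P₃.epi_π
  have sq := IsPullback.of_hasPullback S.g P₃.π
  obtain ⟨i, w, hi, h⟩ := shortExact_of_isPullback hS sq
  obtain ⟨i', w', _, h'⟩ := shortExact_of_isPullback (shortExact_of_epi P₃.π) sq.flip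
  obtain ⟨P⟩ := M.nonempty_cofibrantReplacement (pullback S.g P₃.π)
  have := P.epi_π
  obtain ⟨Q₁, f, m, q, hf, hq, e, hfg, hmq⟩ := exists_shortExact_of_epi h P.π
  obtain ⟨Q₂, r, m', q', hr, hq', _, h₂, hmq'⟩ := exists_shortExact_of_epi h' P.π
  refine ⟨.ofShortExact hmq
      (M.left_cotorsionPair.left_X₁ hM.1 hfg P.cofibrant_obj P₃.cofibrant_obj)
      P.trivFibrant_kernel, .ofShortExact h₂ P.cofibrant_obj (M.left_cotorsionPair.right_X₂ hmq'
    P.trivFibrant_kernel P₃.trivFibrant_kernel), P₃, f, _, hf, ?_, ?_, hfg⟩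
  · change f ≫ P.π ≫ pullback.fst _ _ = m ≫ S.f
    dsimp only at e
    rw [reassoc_of% e, hi]
  · change (P.π ≫ pullback.snd _ _) ≫ P₃.π = (P.π ≫ pullback.fst _ _) ≫ S.g
    rw [Category.assoc, Category.assoc, sq.w]

/-! ### Long exact sequences -/

/-- Left exactness of Hom is automatic; the lifting hypothesis supplies surjectivity in each degree.
-/
lemma shortExact_homFrom (W : ChainComplex C ℤ) {S : ShortComplex C} (hS : S.ShortExact)
    (h : ∀ (n : ℤ) (g : W.X n ⟶ S.X₃), ∃ l, l ≫ S.g = g) :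
    ∃ w, (ShortComplex.mk (homFromMap (𝟙 W) S.f) (homFromMap (𝟙 W) S.g) w).ShortExact := by
  have := hS.mono_f
  have w : homFromMap (𝟙 W) S.f ≫ homFromMap (𝟙 W) S.g = 0 := by
    ext n x
    change W.X n ⟶ S.X₁ at x
    change (𝟙 (W.X n) ≫ (𝟙 (W.X n) ≫ x) ≫ S.f) ≫ S.g = 0
    simp
  refine ⟨w, HomologicalComplex.shortExact_of_degreewise_shortExact _ fun n ↦ ?_⟩
  refine .mk' ((ShortComplex.ab_exact_iff _).2 fun x hx ↦ ?_)
    ((AddCommGrpCat.mono_iff_injective _).2 ?_) ((AddCommGrpCat.epi_iff_surjective _).2 ?_)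
  · change W.X n ⟶ S.X₂ at x
    change (𝟙 (W.X n) ≫ x) ≫ S.g = 0 at hx
    rw [Category.id_comp] at hx
    refine ⟨hS.exact.lift x hx, ?_⟩
    change (𝟙 (W.X n) ≫ hS.exact.lift x hx) ≫ S.f = x
    rw [Category.id_comp, hS.exact.lift_f]
  · intro x y hxy
    change W.X n ⟶ S.X₁ at x y
    change (𝟙 (W.X n) ≫ x) ≫ S.f = (𝟙 (W.X n) ≫ y) ≫ S.f at hxy
    rwa [cancel_mono, Category.id_comp, Category.id_comp] at hxy
  · intro x
    obtain ⟨l, hl⟩ := h n x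
    refine ⟨l, ?_⟩
    change (𝟙 (W.X n) ≫ l) ≫ S.g = x
    rw [Category.id_comp, hl]

lemma shortExact_homTo (V : CochainComplex C ℤ) {S : ShortComplex C} (hS : S.ShortExact)
    (h : ∀ (n : ℤ) (g : S.X₁ ⟶ V.X n), ∃ l, S.f ≫ l = g) :
    ∃ w, (ShortComplex.mk (homToMap S.g (𝟙 V)) (homToMap S.f (𝟙 V)) w).ShortExact := by
  have := hS.epi_g
  have w : homToMap S.g (𝟙 V) ≫ homToMap S.f (𝟙 V) = 0 := by
    ext n x
    change S.X₃ ⟶ V.X n at x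
    change S.f ≫ (S.g ≫ x ≫ 𝟙 (V.X n)) ≫ 𝟙 (V.X n) = 0
    simp
  refine ⟨w, HomologicalComplex.shortExact_of_degreewise_shortExact _ fun n ↦ ?_⟩
  refine .mk' ((ShortComplex.ab_exact_iff _).2 fun x hx ↦ ?_)
    ((AddCommGrpCat.mono_iff_injective _).2 ?_) ((AddCommGrpCat.epi_iff_surjective _).2 ?_)
  · change S.X₂ ⟶ V.X n at x
    change S.f ≫ x ≫ 𝟙 (V.X n) = 0 at hx
    rw [Category.comp_id] at hx
    refine ⟨hS.exact.desc x hx, ?_⟩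
    change S.g ≫ hS.exact.desc x hx ≫ 𝟙 (V.X n) = x
    rw [Category.comp_id, hS.exact.g_desc]
  · intro x y hxy
    change S.X₃ ⟶ V.X n at x y
    change S.g ≫ x ≫ 𝟙 (V.X n) = S.g ≫ y ≫ 𝟙 (V.X n) at hxy
    rwa [cancel_epi, Category.comp_id, Category.comp_id] at hxy
  · intro x
    obtain ⟨l, hl⟩ := h n x
    refine ⟨l, ?_⟩
    change S.f ≫ l ≫ 𝟙 (V.X n) = x
    rw [Category.comp_id, hl]

end AbelianModelStructure

/-- Exactness is invariant under isomorphisms. -/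
lemma exact_of_isos {X Y Z X' Y' Z' : AddCommGrpCat.{v}} (e₁ : X ≅ X') (e₂ : Y ≅ Y') (e₃ : Z ≅ Z')
    {f : X ⟶ Y} {g : Y ⟶ Z} {f' : X' ⟶ Y'} {g' : Y' ⟶ Z'} (h : f' = e₁.inv ≫ f ≫ e₂.hom)
    (h' : g' = e₂.inv ≫ g ≫ e₃.hom) {w : f' ≫ g' = 0} (H : (ShortComplex.mk f' g' w).Exact) :
    Function.Exact f g := by
  have w' : f ≫ g = 0 := by
    rw [← cancel_epi e₁.inv, ← cancel_mono e₃.hom]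
    simpa [h, h'] using w
  have : (ShortComplex.mk f g w').Exact :=
    (ShortComplex.exact_iff_of_iso (ShortComplex.isoMk e₁ e₂ e₃ (by simp [h]) (by simp [h']))).2 H
  exact (ShortComplex.ab_exact_iff_function_exact _).1 this

namespace AbelianModelStructure

variable {M : AbelianModelStructure C} (hM : M.IsHereditary)
  {ρ : ∀ A : C, M.BifibrantReplacement A} {E : ℤ → Cᵒᵖ ⥤ C ⥤ AddCommGrpCat.{v}}

/-- One canonical resolution of `A` and a short exact sequence of fibrant replacements compute all
the groups. Lifting holds degreewise since the terms are trivially cofibrant and the subobject is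
fibrant. The connecting maps are those of the Hom complexes. -/
lemma exists_long_exact_sequence_obj (β : ∀ n, E n ≅ ext hM ρ n) {S : ShortComplex C}
    (hS : S.ShortExact) (A : C) :
    ∃ δ : ∀ n : ℤ, ((E n).obj (op A)).obj S.X₃ ⟶ ((E (n + 1)).obj (op A)).obj S.X₁,
      ∀ n : ℤ,
        Function.Exact (((E n).obj (op A)).map S.f) (((E n).obj (op A)).map S.g) ∧
        Function.Exact (((E n).obj (op A)).map S.g) (δ n) ∧
        Function.Exact (δ n) (((E (n + 1)).obj (op A)).map S.f) := by
  obtain ⟨T₁, T₂, T₃, f, g, w, hf, hg, h⟩ := exists_shortExact_fibrantReplacement hM hS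
  obtain ⟨P⟩ := M.nonempty_cofibrantReplacement A
  obtain ⟨W⟩ := M.nonempty_resolution P.obj
  obtain ⟨w', hK⟩ := shortExact_homFrom W.complex h (fun n x ↦ by
    -- The term of the tower at position `m` is the chain object in degree `-(m + 1)`.
    obtain ⟨n, rfl⟩ : ∃ m, n = -(m + 1) := ⟨-n - 1, by lia⟩
    exact M.right_cotorsionPair.exists_lift h (W.tower.isLeft hM P.cofibrant_obj n).1
      T₁.fibrant_obj x)
  let e (n : ℤ) {B : C} (T : M.FibrantReplacement B) :
      ((E n).obj (op A)).obj B ≅ lExt n W.complex T.obj :=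
    lExtComp hM (β n) (LeftModel.ofCofibrant P) (RightModel.ofFibrant hM T) W
  have he (n : ℤ) {B B' : C} {T : M.FibrantReplacement B} {T' : M.FibrantReplacement B'}
      {k : B ⟶ B'} {r : T.obj ⟶ T'.obj} (hr : T.IsLift T' k r) :
      lExt.map n (𝟙 W.complex) r = (e n T).inv ≫ ((E n).obj (op A)).map k ≫ (e n T').hom := by
    refine (lExtComp_naturality hM (β n) (X := LeftModel.ofCofibrant P)
      (X' := LeftModel.ofCofibrant P) (Y := RightModel.ofFibrant hM T)
      (Y' := RightModel.ofFibrant hM T') W W (f := 𝟙 A) (f' := 𝟙 P.obj)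
      (LeftModel.ofCofibrant_isLift (by simp [CofibrantReplacement.IsLift]))
      (RightModel.ofFibrant_isLift hM hr) (φ := 𝟙 _) ⟨?_, ?_⟩).trans ?_
    · exact (Category.id_comp _).trans (Category.comp_id _).symm
    · exact (Category.comp_id _).trans (Category.id_comp _).symm
    · exact congrArg (fun t ↦ (e n T).inv ≫ t ≫ (e n T').hom) (by simp [bifunctorMap])
  have hn (n : ℤ) : (ComplexShape.down ℤ).symm.Rel n (n + 1) := by simp
  refine ⟨fun n ↦ (e n T₃).hom ≫ hK.δ n (n + 1) (hn n) ≫ (e (n + 1) T₁).inv, fun n ↦ ⟨?_, ?_, ?_⟩⟩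
  · exact exact_of_isos (e n T₁) (e n T₂) (e n T₃) (he n hf) (he n hg) (hK.homology_exact₂ n)
  · exact exact_of_isos (e n T₂) (e n T₃) (e (n + 1) T₁) (he n hg) (by simp)
      (hK.homology_exact₃ n (n + 1) (hn n))
  · exact exact_of_isos (e n T₃) (e (n + 1) T₁) (e (n + 1) T₂) (by simp) (he (n + 1) hf)
      (hK.homology_exact₁ n (n + 1) (hn n))

/-- Dual argument: a coresolution of `RB` has trivially fibrant terms, into which morphisms extend
because the quotient in the sequence of replacements is cofibrant. -/
lemma exists_long_exact_sequence_flip_obj (β : ∀ n, E n ≅ ext hM ρ n) {S : ShortComplex C}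
    (hS : S.ShortExact) (B : C) :
    ∃ δ : ∀ n : ℤ, ((E n).obj (op S.X₁)).obj B ⟶ ((E (n + 1)).obj (op S.X₃)).obj B,
      ∀ n : ℤ,
        Function.Exact (((E n).map S.g.op).app B) (((E n).map S.f.op).app B) ∧
        Function.Exact (((E n).map S.f.op).app B) (δ n) ∧
        Function.Exact (δ n) (((E (n + 1)).map S.g.op).app B) := by
  obtain ⟨P₁, P₂, P₃, f, g, w, hf, hg, h⟩ := exists_shortExact_cofibrantReplacement hM hS
  obtain ⟨T⟩ := M.nonempty_fibrantReplacement B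
  obtain ⟨V⟩ := M.nonempty_coresolution T.obj
  obtain ⟨w', hK⟩ := shortExact_homTo V.complex h (fun n x ↦
    M.left_cotorsionPair.exists_extension h P₃.cofibrant_obj
      (V.tower.isRight hM T.fibrant_obj n).1 x)
  let e (n : ℤ) {A : C} (P : M.CofibrantReplacement A) :
      ((E n).obj (op A)).obj B ≅ rExt n P.obj V.complex :=
    rExtComp hM (β n) (LeftModel.ofCofibrant P) (RightModel.ofFibrant hM T) V
  have he (n : ℤ) {A A' : C} {P : M.CofibrantReplacement A} {P' : M.CofibrantReplacement A'}
      {k : A' ⟶ A} {q : P'.obj ⟶ P.obj} (hq : P'.IsLift P k q) :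
      rExt.map n q (𝟙 V.complex) = (e n P).inv ≫ ((E n).map k.op).app B ≫ (e n P').hom := by
    refine (rExtComp_naturality hM (β n) (X := LeftModel.ofCofibrant P)
      (X' := LeftModel.ofCofibrant P') (Y := RightModel.ofFibrant hM T)
      (Y' := RightModel.ofFibrant hM T) V V (g := 𝟙 B) (g' := 𝟙 T.obj)
      (LeftModel.ofCofibrant_isLift hq)
      (RightModel.ofFibrant_isLift hM (by simp [FibrantReplacement.IsLift])) (φ := 𝟙 _)
      ⟨?_, ?_⟩).trans ?_
    · exact (Category.id_comp _).trans (Category.comp_id _).symm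
    · exact (Category.comp_id _).trans (Category.id_comp _).symm
    · exact congrArg (fun t ↦ (e n P).inv ≫ t ≫ (e n P').hom) (by simp [bifunctorMap])
  have hn (n : ℤ) : (ComplexShape.up ℤ).Rel n (n + 1) := by simp
  refine ⟨fun n ↦ (e n P₁).hom ≫ hK.δ n (n + 1) (hn n) ≫ (e (n + 1) P₃).inv, fun n ↦ ⟨?_, ?_, ?_⟩⟩
  · exact exact_of_isos (e n P₃) (e n P₂) (e n P₁) (he n hg) (he n hf) (hK.homology_exact₂ n)
  · exact exact_of_isos (e n P₂) (e n P₁) (e (n + 1) P₃) (he n hf) (by simp)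
      (hK.homology_exact₃ n (n + 1) (hn n))
  · exact exact_of_isos (e n P₁) (e (n + 1) P₃) (e (n + 1) P₂) (by simp) (he (n + 1) hg)
      (hK.homology_exact₁ n (n + 1) (hn n))

end AbelianModelStructure

end HoExt

end

noncomputable section

namespace HoExt

variable {C : Type u} [Category.{v} C] [Abelian C]

namespace AbelianModelStructure

variable {M : AbelianModelStructure C} (hM : M.IsHereditary)
  {ρ : ∀ A : C, M.BifibrantReplacement A} {n : ℤ} {E : Cᵒᵖ ⥤ C ⥤ AddCommGrpCat.{v}}

/-! ### Computation by canonical resolutions and coresolutions -/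

/-- The computation by models, applied to `QA` and `RB`. Existence of lifts gives the converse
direction of the equivalence. -/
lemma exists_iso_canonicalResolution (β : E ≅ ext hM ρ n) :
    ∃ Φ : ∀ (A B : C) (W : M.CanonicalResolution A) (T : M.FibrantReplacement B),
        (E.obj (op A)).obj B ≅ lExt n W.res.complex T.obj,
      ∀ {A A' B B' : C} (f : A' ⟶ A) (g : B ⟶ B')
        (W : M.CanonicalResolution A) (W' : M.CanonicalResolution A')
        (T : M.FibrantReplacement B) (T' : M.FibrantReplacement B')
        (m : lExt n W.res.complex T.obj ⟶ lExt n W'.res.complex T'.obj),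
        (∃ (φ : W'.res.complex ⟶ W.res.complex) (r : T.obj ⟶ T'.obj),
          W'.IsLift W f φ ∧ T.IsLift T' g r ∧ m = lExt.map n φ r) ↔
        m = (Φ A B W T).inv ≫ bifunctorMap E f g ≫ (Φ A' B' W' T').hom := by
  have key {A A' B B' : C} {f : A' ⟶ A} {g : B ⟶ B'} (W : M.CanonicalResolution A)
      (W' : M.CanonicalResolution A') {T : M.FibrantReplacement B} {T' : M.FibrantReplacement B'}
      {φ : W'.res.complex ⟶ W.res.complex} {r : T.obj ⟶ T'.obj} (hφ : W'.IsLift W f φ)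
      (hr : T.IsLift T' g r) :
      lExt.map n φ r =
        (lExtComp hM β (LeftModel.ofCofibrant W.cof) (RightModel.ofFibrant hM T) W.res).inv ≫
          bifunctorMap E f g ≫ (lExtComp hM β (LeftModel.ofCofibrant W'.cof)
            (RightModel.ofFibrant hM T') W'.res).hom := by
    obtain ⟨q, hq, hφ⟩ := hφ
    exact lExtComp_naturality hM β (X := LeftModel.ofCofibrant W.cof)
      (Y := RightModel.ofFibrant hM T) W.res (X' := LeftModel.ofCofibrant W'.cof)
      (Y' := RightModel.ofFibrant hM T') W'.res (LeftModel.ofCofibrant_isLift hq)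
      (RightModel.ofFibrant_isLift hM hr) hφ
  refine ⟨fun A B W T ↦
    lExtComp hM β (LeftModel.ofCofibrant W.cof) (RightModel.ofFibrant hM T) W.res,
    fun {A A' B B'} f g W W' T T' m ↦ ⟨?_, fun hm ↦ ?_⟩⟩
  · rintro ⟨φ, r, hφ, hr, rfl⟩
    exact key W W' hφ hr
  · obtain ⟨q, hq⟩ := W.cof.exists_lift W'.cof.cofibrant_obj (W'.cof.π ≫ f)
    obtain ⟨φ, hφ⟩ := W'.res.exists_isLift W.res q
    obtain ⟨r, hr⟩ := T.exists_extension T'.fibrant_obj (g ≫ T'.ι)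
    exact ⟨φ, r, ⟨q, hq, hφ⟩, hr, hm.trans (key W W' ⟨q, hq, hφ⟩ hr).symm⟩

lemma exists_iso_canonicalCoresolution (β : E ≅ ext hM ρ n) :
    ∃ Φ : ∀ (A B : C) (P : M.CofibrantReplacement A) (W : M.CanonicalCoresolution B),
        (E.obj (op A)).obj B ≅ rExt n P.obj W.cores.complex,
      ∀ {A A' B B' : C} (f : A' ⟶ A) (g : B ⟶ B')
        (P : M.CofibrantReplacement A) (P' : M.CofibrantReplacement A')
        (W : M.CanonicalCoresolution B) (W' : M.CanonicalCoresolution B')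
        (m : rExt n P.obj W.cores.complex ⟶ rExt n P'.obj W'.cores.complex),
        (∃ (q : P'.obj ⟶ P.obj) (φ : W.cores.complex ⟶ W'.cores.complex),
          P'.IsLift P f q ∧ W.IsLift W' g φ ∧ m = rExt.map n q φ) ↔
        m = (Φ A B P W).inv ≫ bifunctorMap E f g ≫ (Φ A' B' P' W').hom := by
  have key {A A' B B' : C} {f : A' ⟶ A} {g : B ⟶ B'} {P : M.CofibrantReplacement A}
      {P' : M.CofibrantReplacement A'} (W : M.CanonicalCoresolution B)
      (W' : M.CanonicalCoresolution B') {q : P'.obj ⟶ P.obj}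
      {φ : W.cores.complex ⟶ W'.cores.complex} (hq : P'.IsLift P f q) (hφ : W.IsLift W' g φ) :
      rExt.map n q φ =
        (rExtComp hM β (LeftModel.ofCofibrant P) (RightModel.ofFibrant hM W.fib) W.cores).inv ≫
          bifunctorMap E f g ≫ (rExtComp hM β (LeftModel.ofCofibrant P')
            (RightModel.ofFibrant hM W'.fib) W'.cores).hom := by
    obtain ⟨r, hr, hφ⟩ := hφ
    exact rExtComp_naturality hM β (X := LeftModel.ofCofibrant P)
      (Y := RightModel.ofFibrant hM W.fib) W.cores (X' := LeftModel.ofCofibrant P')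
      (Y' := RightModel.ofFibrant hM W'.fib) W'.cores (LeftModel.ofCofibrant_isLift hq)
      (RightModel.ofFibrant_isLift hM hr) hφ
  refine ⟨fun A B P W ↦
    rExtComp hM β (LeftModel.ofCofibrant P) (RightModel.ofFibrant hM W.fib) W.cores,
    fun {A A' B B'} f g P P' W W' m ↦ ⟨?_, fun hm ↦ ?_⟩⟩
  · rintro ⟨q, φ, hq, hφ, rfl⟩
    exact key W W' hq hφ
  · obtain ⟨q, hq⟩ := P.exists_lift P'.cofibrant_obj (P'.π ≫ f)
    obtain ⟨r, hr⟩ := W.fib.exists_extension W'.fib.fibrant_obj (g ≫ W'.fib.ι)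
    obtain ⟨φ, hφ⟩ := W.cores.exists_isLift W'.cores r
    exact ⟨q, φ, hq, ⟨r, hr, hφ⟩, hm.trans (key W W' hq ⟨r, hr, hφ⟩).symm⟩

end AbelianModelStructure

end HoExt

end

theorem mainTheorem1 {C : Type u} [Category.{v} C] [Abelian C]
    (M : AbelianModelStructure C) (hM : M.IsHereditary)
    (ρ : ∀ A : C, M.BifibrantReplacement A) :
    -- `M`-resolutions and `M`-coresolutions exist, and `Extⁿ(RQA, RQB)` is a bifunctor
    (∀ A : C, Nonempty (M.Resolution A)) ∧ (∀ A : C, Nonempty (M.Coresolution A)) ∧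
    (∀ n : ℤ, ∃ E : Cᵒᵖ ⥤ C ⥤ AddCommGrpCat.{v}, IsExtHo ρ n E) ∧
    ∀ E : ℤ → Cᵒᵖ ⥤ C ⥤ AddCommGrpCat.{v}, (∀ n : ℤ, IsExtHo ρ n (E n)) →
      -- it is additive in each variable
      (∀ (n : ℤ) (A : C), ((E n).obj (op A)).Additive) ∧
      (∀ (n : ℤ) (B : C), ((E n).flip.obj B).Additive) ∧
      -- the long exact sequence in the second variable
      (∀ (S : ShortComplex C), S.ShortExact → ∀ A : C,
        ∃ δ : ∀ n : ℤ, ((E n).obj (op A)).obj S.X₃ ⟶ ((E (n + 1)).obj (op A)).obj S.X₁,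
          ∀ n : ℤ,
            Function.Exact (((E n).obj (op A)).map S.f) (((E n).obj (op A)).map S.g) ∧
            Function.Exact (((E n).obj (op A)).map S.g) (δ n) ∧
            Function.Exact (δ n) (((E (n + 1)).obj (op A)).map S.f)) ∧
      -- the long exact sequence in the first variable
      (∀ (S : ShortComplex C), S.ShortExact → ∀ B : C,
        ∃ δ : ∀ n : ℤ, ((E n).obj (op S.X₁)).obj B ⟶ ((E (n + 1)).obj (op S.X₃)).obj B,
          ∀ n : ℤ,
            Function.Exact (((E n).map S.g.op).app B) (((E n).map S.f.op).app B) ∧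
            Function.Exact (((E n).map S.f.op).app B) (δ n) ∧
            Function.Exact (δ n) (((E (n + 1)).map S.g.op).app B)) ∧
      -- it descends to the homotopy category in each variable
      (∀ (n : ℤ) (A : C), ∃! F : Ho ρ ⥤ AddCommGrpCat.{v},
        toHo ρ ⋙ F = (E n).obj (op A)) ∧
      (∀ (n : ℤ) (B : C), ∃! F : (Ho ρ)ᵒᵖ ⥤ AddCommGrpCat.{v},
        (toHo ρ).op ⋙ F = (E n).flip.obj B) ∧
      -- it is naturally isomorphic to `Extⁿ(QA, RB)`, computed by any canonical resolution of `A`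
      (∀ n : ℤ, ∃ Φ : ∀ (A B : C) (W : M.CanonicalResolution A) (T : M.FibrantReplacement B),
          ((E n).obj (op A)).obj B ≅ lExt n W.res.complex T.obj,
        ∀ {A A' B B' : C} (f : A' ⟶ A) (g : B ⟶ B')
          (W : M.CanonicalResolution A) (W' : M.CanonicalResolution A')
          (T : M.FibrantReplacement B) (T' : M.FibrantReplacement B')
          (m : lExt n W.res.complex T.obj ⟶ lExt n W'.res.complex T'.obj),
          (∃ (φ : W'.res.complex ⟶ W.res.complex) (r : T.obj ⟶ T'.obj),
            W'.IsLift W f φ ∧ T.IsLift T' g r ∧ m = lExt.map n φ r) ↔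
          m = (Φ A B W T).inv ≫ bifunctorMap (E n) f g ≫ (Φ A' B' W' T').hom) ∧
      -- it is naturally isomorphic to `Extⁿ(QA, RB)`, computed by any canonical coresolution of `B`
      (∀ n : ℤ, ∃ Φ : ∀ (A B : C) (P : M.CofibrantReplacement A) (W : M.CanonicalCoresolution B),
          ((E n).obj (op A)).obj B ≅ rExt n P.obj W.cores.complex,
        ∀ {A A' B B' : C} (f : A' ⟶ A) (g : B ⟶ B')
          (P : M.CofibrantReplacement A) (P' : M.CofibrantReplacement A')
          (W : M.CanonicalCoresolution B) (W' : M.CanonicalCoresolution B')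
          (m : rExt n P.obj W.cores.complex ⟶ rExt n P'.obj W'.cores.complex),
          (∃ (q : P'.obj ⟶ P.obj) (φ : W.cores.complex ⟶ W'.cores.complex),
            P'.IsLift P f q ∧ W.IsLift W' g φ ∧ m = rExt.map n q φ) ↔
          m = (Φ A B P W).inv ≫ bifunctorMap (E n) f g ≫ (Φ A' B' P' W').hom) := by
  refine ⟨M.nonempty_resolution, M.nonempty_coresolution,
    fun n ↦ ⟨ext hM ρ n, isExtHo_of_iso hM (Iso.refl _)⟩, fun E hE ↦ ?_⟩
  -- Every bifunctor with the required description is isomorphic to the constructed one, and each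
  -- conclusion has been proved in a form that only needs this isomorphism.
  have β (n : ℤ) : E n ≅ ext hM ρ n :=
    ((hE n).nonempty_iso (isExtHo_of_iso hM (Iso.refl _))).some
  exact ⟨fun n ↦ additive_obj_of_iso hM (β n), fun n ↦ additive_flip_obj_of_iso hM (β n),
    fun S hS ↦ exists_long_exact_sequence_obj hM β hS,
    fun S hS ↦ exists_long_exact_sequence_flip_obj hM β hS,
    fun n ↦ existsUnique_obj_of_iso hM (β n), fun n ↦ existsUnique_flip_obj_of_iso hM (β n),
    fun n ↦ exists_iso_canonicalResolution hM (β n),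
    fun n ↦ exists_iso_canonicalCoresolution hM (β n)⟩
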